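/- Let $n\ge 1$, $k\ge 2$, let $U\subset \mathrm{GL}_n=\mathrm{GL}_n(\mathbb C)$ be the group of unipotent upper triangular matrices and let $B_-$ be the group of invertible lower triangular matrices. Let $U^{k+1}$ act on $\mathrm{GL}_n^k$ by $(u_0,\dots,u_k).(g_1,\dots,g_k)=(u_0g_1u_1^{-1},\dots,u_{k-1}g_ku_k^{-1})$ and put $\mathcal M_k=\mathrm{Spec}\,\mathbb C[\mathrm{GL}_n^k]^{U^{k+1}}$. For $\alpha\in\mathbb Z_{\ge0}^k$ with $\sum_i\alpha_i\le n$, the multi-corner minor $M_\alpha(g_1,\dots,g_k)$ is the $n\times n$ minor of the block matrix $[\,1\mid g_1\mid g_1g_2\mid\cdots\mid g_1\cdots g_k\,]$ on the first $n-\sum_i\alpha_i$ columns of the block $1$ and the first $\alpha_i$ columns of the block $g_1\cdots g_i$, for $i=1,\dots,k$. Write $[a,b]=\{a,\dots,b\}$, $I^{\mathrm{op}}=\{n+1-a: a\in I\}$, and $\Delta_{I,J}$ for the minor with rows $I$ and columns $J$. Let $$\Phi_{\rm BK}(g)=\sum_{i=1}^{n-1}\frac{\Delta_{([1,i+1]\setminus\{i\})^{\rm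 op},[1,i]}(g)+\Delta_{[1,i]^{\rm op},[1,i+1]\setminus\{i\}}(g)}{\Delta_{[1,i]^{\rm op},[1,i]}(g)},\qquad \Phi_k(g_1,\dots,g_k)=\sum_{i=1}^k\Phi_{\rm BK}(g_i)-\Phi_{\rm BK}(g_1\cdots g_k).$$ For $0\le l\le k-2$ let $\mathcal F_l=\{(0^l,i,j,0^{k-l-2}) : i,j\ge 0,\ i+j\le n\}$; write $[i,j]_l$ for the point $(0^l,i,j,0^{k-l-2})$. The small rhombi of $\mathcal F_l$, with long diagonal $\alpha_1\alpha_3$ and short diagonal $\alpha_2\alpha_4$, are, for all $i,j\ge0$ with $i+j+2\le n$, the quadruples $(\alpha_1,\alpha_2,\alpha_3,\alpha_4)$ equal to $([i,j]_l,[i{+}1,j]_l,[i{+}1,j{+}1]_l,[i,j{+}1]_l)$, $([i,j{+}2]_l,[i{+}1,j{+}1]_l,[i{+}1,j]_l,[i,j{+}1]_l)$ and $([i{+}2,j]_l,[i{+}1,j{+}1]_l,[i,j{+}1]_l,[i{+}1,j]_l)$. A positive chart on an irreducible affine variety with potential $(P,\Phi)$ is an open embedding $\theta:(\mathbb C^*)^d\to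 P$ such that $\Phi\circ\theta$ is a quotient of two polynomials in the natural coordinates with nonnegative real coefficients (zero being allowed for the numerator only); it is recorded by the rational functions on $P$ that are the coordinates of $\theta^{-1}$. The tropicalization in such a chart of a positive function $f=p/q$ is the function $f^t=p^t-q^t$ on $\mathbb R^d$ with values in $\mathbb R\cup\{-\infty\}$, where $(\sum_a c_ax^a)^t=\max_{c_a\ne0}\langle a,x\rangle$ (and $0^t=-\infty$). (1) All $M_\alpha$ and $\Phi_k$ descend to $\mathcal M_k$ (as regular functions $\overline M_\alpha$ and a rational function $\overline\Phi_k$). The set $\boldsymbol M_k=\{\overline M_\alpha : \alpha\in\bigcup_{l=0}^{k-2}\mathcal F_l,\ \alpha\ne0\}$ has exactly $\dim\mathcal M_k$ elements, and they are the coordinates of a positive chart on $(\mathcal M_k,\overline\Phi_k)$. For tropicalization in this chart, at every point of $\mathbb R^{\dim \mathcal M_k}$, $$\overline\Phi_k^{\,t}\le 0\iff \overline M^{\,t}_{\alpha_1}+\overline M^{\,t}_{\alpha_3}\le \overline M^{\,t}_{\alpha_2}+\overline M^{\,t}_{\alpha_4}\ \text{ for all small rhombi on all faces }\mathcal F_l,\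 0\le l\le k-2 .$$ (2) Let $\theta$ be any positive chart on $(B_-,\Phi_{\rm BK})$ that is positively equivalent to the geometric Gelfand-Zeitlin chart, whose coordinates are $\lambda^{(n-i)}_j=\Delta_{[1,j]^{\rm op},[i+1,i+j]}/\Delta_{[1,j-1]^{\rm op},[i+1,i+j-1]}$ for $0\le i\le n-1$, $j\ge 1$, $i+j\le n$ (an empty minor is $1$). That is, the coordinates of each of the two charts are subtraction-free rational expressions in those of the other. Then, in the chart $\theta\times\cdots\times\theta$ on $B_-^k$, the restrictions to $B_-^k$ of all $M_\alpha$ (with $\sum_i\alpha_i\le n$) are nonzero and positive, the restriction of $\Phi_k$ is positive, and at every real point $$\Phi_k^{t}\le 0\iff M^{t}_{\alpha_1}+M^{t}_{\alpha_3}\le M^{t}_{\alpha_2}+M^{t}_{\alpha_4}\ \text{ for all small rhombi on all faces }\mathcal F_l,\ 0\le l\le k-2 .$$ -/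

import Mathlib

open scoped NNReal

noncomputable section

namespace MultiCorner

/-! ### Matrix minors, multi-corner minors and the Berenstein-Kazhdan potential

Rows and columns are indexed by `Fin n`; the index called `m` in one-based notation is the element
of `Fin n` with value `m - 1`. -/

section Matrices

variable {R : Type} [CommRing R] {F : Type} [Field F]

/-- The minor of `A` with rows `I` and columns `J`, both listed in increasing order
(only used for `I` and `J` of the same cardinality). -/
def minor {p q : Type} [LinearOrder p] [LinearOrder q] (A : Matrix p q R)
    (I : Finset p) (J : Finset q) : R :=
  if h : J.card = I.card then
    (A.submatrix (I.orderEmbOfFin rfl) (J.orderEmbOfFin h)).det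
  else 0

/-- The interval `[a + 1, a + b]` in one-based notation, as a set of indices. -/
def interval (n a b : ℕ) : Finset (Fin n) :=
  Finset.univ.filter fun m => a + 1 ≤ (m : ℕ) + 1 ∧ (m : ℕ) + 1 ≤ a + b

/-- The set `I ^ op = {n + 1 - a | a ∈ I}`. -/
def op {n : ℕ} (I : Finset (Fin n)) : Finset (Fin n) := I.image Fin.rev

/-- The set `[1, i + 1] \ {i}` in one-based notation. -/
def gapInterval (n i : ℕ) : Finset (Fin n) :=
  (interval n 0 (i + 1)).filter fun m => (m : ℕ) + 1 ≠ i

/-- The Berenstein-Kazhdan potential. -/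
def potentialBK {n : ℕ} (g : Matrix (Fin n) (Fin n) F) : F :=
  ∑ i ∈ Finset.Icc 1 (n - 1),
    (minor g (op (gapInterval n i)) (interval n 0 i)
      + minor g (op (interval n 0 i)) (gapInterval n i))
      / minor g (op (interval n 0 i)) (interval n 0 i)

/-- `Φ_k (g₁, …, g_k) = Φ_BK (g₁) + ⋯ + Φ_BK (g_k) - Φ_BK (g₁ ⋯ g_k)`. -/
def potential {n k : ℕ} (g : Fin k → Matrix (Fin n) (Fin n) F) : F :=
  (∑ l, potentialBK (g l)) - potentialBK (Fin.partialProd g (Fin.last k))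

/-- The `n × (k + 1) n` matrix `[1 | g₁ | g₁ g₂ | ⋯ | g₁ ⋯ g_k]`. The column `(m, c)` is the
`c`-th column of the `m`-th block, and the columns are ordered block by block. -/
def blockRow {n k : ℕ} (g : Fin k → Matrix (Fin n) (Fin n) R) :
    Matrix (Fin n) (Fin (k + 1) ×ₗ Fin n) R :=
  Matrix.of fun i c => Fin.partialProd g (ofLex c).1 i (ofLex c).2

/-- The column set `J(α)`: the first `n - ∑ αᵢ` columns of the block `1` and the first `αᵢ` columns
of the block `g₁ ⋯ gᵢ`, for each `i`. -/
def columnSet {n k : ℕ} (α : Fin k → ℕ) : Finset (Fin (k + 1) ×ₗ Fin n) :=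
  Finset.univ.filter fun c =>
    ((ofLex c).2 : ℕ) < (Fin.cons (n - ∑ i, α i) α : Fin (k + 1) → ℕ) (ofLex c).1

/-- The multi-corner minor `M_α (g₁, …, g_k)`, for `α` with `∑ αᵢ ≤ n`. -/
def cornerMinor {n k : ℕ} (g : Fin k → Matrix (Fin n) (Fin n) R) (α : Fin k → ℕ) : R :=
  minor (blockRow g) Finset.univ (columnSet α)

end Matrices

/-! ### Indices and small rhombi on the faces -/

/-- The index `(0^l, i, j, 0^(k-l-2))`. -/
def facePoint (k l i j : ℕ) : Fin k → ℕ :=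
  fun m => if (m : ℕ) = l then i else if (m : ℕ) = l + 1 then j else 0

/-- The indices `(0^l, i, j, 0^(k-l-2))` with `0 ≤ l ≤ k - 2` and `0 < i + j ≤ n`. -/
def consecutiveIndex (n k : ℕ) : Set (Fin k → ℕ) :=
  {α | ∃ l i j : ℕ, l + 2 ≤ k ∧ 0 < i + j ∧ i + j ≤ n ∧ α = facePoint k l i j}

/-- The small rhombi on the triangular faces
`{(0^l, i, j, 0^(k-l-2)) | i + j ≤ n}`, `0 ≤ l ≤ k - 2`, in their three orientations.
The long diagonal is `α₁ α₃` and the short diagonal is `α₂ α₄`. -/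
inductive IsFaceRhombus (n k : ℕ) :
    (Fin k → ℕ) → (Fin k → ℕ) → (Fin k → ℕ) → (Fin k → ℕ) → Prop
  | type1 (l i j : ℕ) (hl : l + 2 ≤ k) (h : i + j + 2 ≤ n) :
      IsFaceRhombus n k (facePoint k l i j) (facePoint k l (i + 1) j)
        (facePoint k l (i + 1) (j + 1)) (facePoint k l i (j + 1))
  | type2 (l i j : ℕ) (hl : l + 2 ≤ k) (h : i + j + 2 ≤ n) :
      IsFaceRhombus n k (facePoint k l i (j + 2)) (facePoint k l (i + 1) (j + 1))
        (facePoint k l (i + 1) j) (facePoint k l i (j + 1))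
  | type3 (l i j : ℕ) (hl : l + 2 ≤ k) (h : i + j + 2 ≤ n) :
      IsFaceRhombus n k (facePoint k l (i + 2) j) (facePoint k l (i + 1) (j + 1))
        (facePoint k l i (j + 1)) (facePoint k l (i + 1) j)

/-- The rhombus inequalities, for all small rhombi on the faces. -/
def RhombusInequalities (n k : ℕ) (m : (Fin k → ℕ) → WithBot ℝ) : Prop :=
  ∀ α₁ α₂ α₃ α₄, IsFaceRhombus n k α₁ α₂ α₃ α₄ → m α₁ + m α₃ ≤ m α₂ + m α₄

/-! ### Toric charts, positive functions and tropicalization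

An integral affine variety over `ℂ` is given by its coordinate ring, a subalgebra `A` of a field
`K`; its rational functions are the quotients of elements of `A`, taken in `K`. -/

section Charts

variable {K : Type} [Field K] [Algebra ℂ K] {ι : Type}

/-- `f` is a rational function on `Spec A`. -/
def IsRational (A : Subalgebra ℂ K) (f : K) : Prop :=
  ∃ p ∈ A, ∃ q ∈ A, q ≠ 0 ∧ f = p / q

/-- The ring of Laurent polynomials in the variables `ι`, the coordinate ring of `(ℂ^*)^ι`. -/
abbrev Laurent (ι : Type) : Type := AddMonoidAlgebra ℂ (ι →₀ ℤ)

/-- The natural coordinates on the torus `(ℂ^*)^ι`. -/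
def Laurent.X (i : ι) : Laurent ι := AddMonoidAlgebra.single (Finsupp.single i 1) 1

/-- The rational functions `y` on `Spec A` are the coordinates of an open embedding
`θ : (ℂ^*)^ι → Spec A`, that is, `yᵢ ∘ θ` is the `i`-th natural coordinate. -/
def IsToricChart (A : Subalgebra ℂ K) (y : ι → K) : Prop :=
  (∀ i, IsRational A (y i)) ∧
  ∃ θ : A →ₐ[ℂ] Laurent ι,
    AlgebraicGeometry.IsOpenImmersion
      (AlgebraicGeometry.Spec.map (CommRingCat.ofHom (θ : A →+* Laurent ι))) ∧
    ∀ (i : ι) (p q : A), y i * (q : K) = (p : K) → Laurent.X i * θ q = θ p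

/-- The value at `y` of a polynomial with nonnegative real coefficients. -/
def evalPoly (y : ι → K) : MvPolynomial ι ℝ≥0 →+* K :=
  MvPolynomial.eval₂Hom
    ((algebraMap ℂ K).comp (Complex.ofRealHom.comp NNReal.toRealHom)) y

/-- `f` has a positive (subtraction-free) expression in terms of `y`. The empty expression `0` is
allowed. -/
def IsPositive (y : ι → K) (f : K) : Prop :=
  ∃ P Q : MvPolynomial ι ℝ≥0, evalPoly y Q ≠ 0 ∧ f = evalPoly y P / evalPoly y Q

/-- `y` is (the coordinate system of) a positive chart on the variety with potential
`(Spec A, Φ)`. -/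
structure IsPositiveChart (A : Subalgebra ℂ K) (Φ : K) (y : ι → K) : Prop where
  chart : IsToricChart A y
  rational : IsRational A Φ
  positive : IsPositive y Φ

/-- The tropicalization `max_a (a · x)` of a polynomial with nonnegative coefficients, the maximum
being over the monomials `a` that occur in it. The value is `⊥ = -∞` for the zero polynomial. -/
def tropPoly (P : MvPolynomial ι ℝ≥0) (x : ι → ℝ) : WithBot ℝ :=
  P.support.sup fun a => ((a.sum fun i e => (e : ℝ) * x i : ℝ) : WithBot ℝ)

/-- `P ^ t - Q ^ t` (used for `Q ≠ 0`). -/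
def tropQuot (P Q : MvPolynomial ι ℝ≥0) (x : ι → ℝ) : WithBot ℝ :=
  (tropPoly P x).map fun r => r - (tropPoly Q x).unbotD 0

open Classical in
/-- The tropicalization of a positive function `f`, in the coordinates `y`. It does not depend on
the positive expression that is used, see `trop_eq`. -/
def trop (y : ι → K) (f : K) (x : ι → ℝ) : WithBot ℝ :=
  if h : IsPositive y f then tropQuot h.choose h.choose_spec.choose x else ⊥

theorem evalPoly_injective {y : ι → K} (hy : AlgebraicIndependent ℂ y) :
    Function.Injective (evalPoly y) := by
  have hc : Function.Injective (Complex.ofRealHom.comp NNReal.toRealHom) := by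
    intro a b h
    exact NNReal.coe_injective (Complex.ofReal_injective h)
  have h : ∀ P, evalPoly y P
      = MvPolynomial.aeval y (MvPolynomial.map (Complex.ofRealHom.comp NNReal.toRealHom) P) := by
    intro P
    rw [MvPolynomial.aeval_def, MvPolynomial.eval₂_map]
    rfl
  intro P Q hPQ
  rw [h, h] at hPQ
  exact MvPolynomial.map_injective _ hc (hy hPQ)

theorem tropPoly_mul (P Q : MvPolynomial ι ℝ≥0) (x : ι → ℝ) :
    tropPoly (P * Q) x = tropPoly P x + tropPoly Q x := by
  classical
  set φ : (ι →₀ ℕ) → ℝ := fun a => a.sum fun i e => (e : ℝ) * x i with hφ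
  have hadd : ∀ a b, φ (a + b) = φ a + φ b := by
    intro a b
    simp only [hφ]
    rw [Finsupp.sum_add_index'] <;> intros <;> push_cast <;> ring
  change (P * Q).support.sup (fun a => ((φ a : ℝ) : WithBot ℝ))
    = P.support.sup (fun a => ((φ a : ℝ) : WithBot ℝ))
      + Q.support.sup (fun a => ((φ a : ℝ) : WithBot ℝ))
  rcases P.support.eq_empty_or_nonempty with hP | hP
  · have : P = 0 := MvPolynomial.support_eq_empty.mp hP
    simp [this]
  rcases Q.support.eq_empty_or_nonempty with hQ | hQ
  · have : Q = 0 := MvPolynomial.support_eq_empty.mp hQ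
    simp [this]
  apply le_antisymm
  · refine Finset.sup_le fun a ha => ?_
    obtain ⟨b, hb, c, hc, rfl⟩ := Finset.mem_add.mp (MvPolynomial.support_mul P Q ha)
    rw [hadd, WithBot.coe_add]
    exact add_le_add (Finset.le_sup (f := fun a => ((φ a : ℝ) : WithBot ℝ)) hb)
      (Finset.le_sup (f := fun a => ((φ a : ℝ) : WithBot ℝ)) hc)
  · obtain ⟨b, hb, hb'⟩ := Finset.exists_mem_eq_sup _ hP (fun a => ((φ a : ℝ) : WithBot ℝ))
    obtain ⟨c, hc, hc'⟩ := Finset.exists_mem_eq_sup _ hQ (fun a => ((φ a : ℝ) : WithBot ℝ))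
    rw [hb', hc', ← WithBot.coe_add, ← hadd]
    refine Finset.le_sup (f := fun a => ((φ a : ℝ) : WithBot ℝ)) ?_
    rw [MvPolynomial.mem_support_iff, MvPolynomial.coeff_mul]
    refine ne_of_gt (lt_of_lt_of_le ?_
      (Finset.single_le_sum (f := fun p : (ι →₀ ℕ) × (ι →₀ ℕ) =>
        MvPolynomial.coeff p.1 P * MvPolynomial.coeff p.2 Q) (fun _ _ => zero_le)
        (a := (b, c)) (Finset.HasAntidiagonal.mem_antidiagonal.mpr rfl)))
    exact mul_pos (pos_iff_ne_zero.mpr (MvPolynomial.mem_support_iff.mp hb))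
      (pos_iff_ne_zero.mpr (MvPolynomial.mem_support_iff.mp hc))

theorem tropPoly_ne_bot {Q : MvPolynomial ι ℝ≥0} (hQ : Q ≠ 0) (x : ι → ℝ) :
    ∃ r : ℝ, tropPoly Q x = r := by
  have hne : Q.support.Nonempty := by
    rw [Finset.nonempty_iff_ne_empty]
    exact fun h => hQ (MvPolynomial.support_eq_empty.mp h)
  obtain ⟨b, -, hb⟩ := Finset.exists_mem_eq_sup _ hne
    (fun a => ((a.sum fun i e => (e : ℝ) * x i : ℝ) : WithBot ℝ))
  exact ⟨_, hb⟩

/-- The tropicalization may be computed from any positive expression. -/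
theorem trop_eq {y : ι → K} (hy : AlgebraicIndependent ℂ y) (P Q : MvPolynomial ι ℝ≥0)
    (hQ : evalPoly y Q ≠ 0) (x : ι → ℝ) :
    trop y (evalPoly y P / evalPoly y Q) x = tropQuot P Q x := by
  have h : IsPositive y (evalPoly y P / evalPoly y Q) := ⟨P, Q, hQ, rfl⟩
  rw [trop, dif_pos h]
  obtain ⟨hQ', he⟩ := h.choose_spec.choose_spec
  generalize h.choose = P', h.choose_spec.choose = Q' at hQ' he ⊢
  rw [div_eq_div_iff hQ hQ', ← map_mul, ← map_mul] at he
  have hm := congrArg (fun R => tropPoly R x) (evalPoly_injective hy he)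
  simp only [tropPoly_mul] at hm
  obtain ⟨q, hq⟩ := tropPoly_ne_bot (Q := Q) (fun h0 => hQ (by rw [h0, map_zero])) x
  obtain ⟨q', hq'⟩ := tropPoly_ne_bot (Q := Q') (fun h0 => hQ' (by rw [h0, map_zero])) x
  unfold tropQuot
  rw [hq, hq'] at hm ⊢
  generalize tropPoly P x = p, tropPoly P' x = p' at hm ⊢
  induction p using WithBot.recBotCoe <;> induction p' using WithBot.recBotCoe
  · rfl
  · exact absurd hm (by simp [← WithBot.coe_add])
  · exact absurd hm (by simp [← WithBot.coe_add])
  · simp only [← WithBot.coe_add, WithBot.coe_inj] at hm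
    simp only [WithBot.map_coe, WithBot.unbotD_coe, WithBot.coe_inj]
    linarith

end Charts

/-! ### The variety `M_k = GL_n^k // U^(k+1)` -/

section Quotient

variable (n k : ℕ)

/-- The polynomial functions on `k`-tuples of `n × n` matrices. -/
abbrev PolyRing : Type := MvPolynomial (Fin k × Fin n × Fin n) ℂ

/-- The field of rational functions on `GL_n^k`. -/
abbrev RatField : Type := FractionRing (PolyRing n k)

/-- The generic `k`-tuple of matrices, with polynomial entries. -/
def genericPoly (l : Fin k) : Matrix (Fin n) (Fin n) (PolyRing n k) :=
  Matrix.of fun i j => MvPolynomial.X (l, i, j)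

/-- The generic point `(g₁, …, g_k)` of `GL_n^k`: the entries are the coordinate functions. -/
def generic (l : Fin k) : Matrix (Fin n) (Fin n) (RatField n k) :=
  (genericPoly n k l).map (algebraMap (PolyRing n k) (RatField n k))

/-- The coordinate ring of `GL_n^k`. -/
def regularRing : Subalgebra ℂ (RatField n k) :=
  Algebra.adjoin ℂ
    ({f | ∃ l i j, f = generic n k l i j} ∪ {f | ∃ l, f = (generic n k l).det⁻¹})

variable {n k}

/-- The generic tuple translated by `u`: the `l`-th matrix is `u_{l-1} g_l u_l⁻¹`. -/
def translate (u : Fin (k + 1) → GL (Fin n) ℂ) (l : Fin k) :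
    Matrix (Fin n) (Fin n) (PolyRing n k) :=
  (u l.castSucc : Matrix (Fin n) (Fin n) ℂ).map MvPolynomial.C * genericPoly n k l
    * ((u l.succ)⁻¹ : GL (Fin n) ℂ).val.map MvPolynomial.C

/-- The pullback of polynomial functions under the action of `u`. -/
def actPoly (u : Fin (k + 1) → GL (Fin n) ℂ) : PolyRing n k →ₐ[ℂ] PolyRing n k :=
  MvPolynomial.aeval fun p => translate u p.1 p.2.1 p.2.2

theorem actPoly_generic (u : Fin (k + 1) → GL (Fin n) ℂ) (l : Fin k) :
    (genericPoly n k l).map (actPoly u) = translate u l := by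
  ext i j : 2
  simp [genericPoly, actPoly]

theorem actPoly_inv (u : Fin (k + 1) → GL (Fin n) ℂ) :
    (actPoly u).comp (actPoly u⁻¹) = AlgHom.id ℂ (PolyRing n k) := by
  have hC : ∀ M : Matrix (Fin n) (Fin n) ℂ,
      (M.map (MvPolynomial.C : ℂ →+* PolyRing n k)).map (actPoly u)
        = M.map (MvPolynomial.C : ℂ →+* PolyRing n k) := by
    intro M
    ext i j : 2
    simp [actPoly]
  have key : ∀ l, (translate u⁻¹ l).map (actPoly u) = genericPoly n k l := by
    intro l
    have h1 : ((u l.castSucc)⁻¹ : GL (Fin n) ℂ).val.map (MvPolynomial.C : ℂ →+* PolyRing n k)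
        * (u l.castSucc : Matrix (Fin n) (Fin n) ℂ).map MvPolynomial.C = 1 := by
      rw [← Matrix.map_mul, ← Units.val_mul, inv_mul_cancel, Units.val_one]
      exact Matrix.map_one _ (map_zero _) (map_one _)
    have h2 : ((u l.succ)⁻¹ : GL (Fin n) ℂ).val.map (MvPolynomial.C : ℂ →+* PolyRing n k)
        * (u l.succ : Matrix (Fin n) (Fin n) ℂ).map MvPolynomial.C = 1 := by
      rw [← Matrix.map_mul, ← Units.val_mul, inv_mul_cancel, Units.val_one]
      exact Matrix.map_one _ (map_zero _) (map_one _)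
    unfold translate
    rw [Matrix.map_mul, Matrix.map_mul, hC, hC, actPoly_generic, translate]
    simp only [Pi.inv_apply, inv_inv]
    calc _ = (((u l.castSucc)⁻¹ : GL (Fin n) ℂ).val.map (MvPolynomial.C : ℂ →+* PolyRing n k)
              * (u l.castSucc : Matrix (Fin n) (Fin n) ℂ).map MvPolynomial.C) * genericPoly n k l
            * (((u l.succ)⁻¹ : GL (Fin n) ℂ).val.map (MvPolynomial.C : ℂ →+* PolyRing n k)
              * (u l.succ : Matrix (Fin n) (Fin n) ℂ).map MvPolynomial.C) := by
          simp only [Matrix.mul_assoc]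
      _ = genericPoly n k l := by rw [h1, h2, Matrix.one_mul, Matrix.mul_one]
  refine MvPolynomial.algHom_ext fun p => ?_
  obtain ⟨l, i, j⟩ := p
  have := congrFun (congrFun (key l) i) j
  simpa [actPoly, genericPoly] using this

/-- The pullback `f ↦ f (u • g)` of rational functions on `GL_n^k` under the action
`(u • g)_l = u_{l-1} g_l u_l⁻¹`. -/
def act (u : Fin (k + 1) → GL (Fin n) ℂ) : RatField n k ≃ₐ[ℂ] RatField n k :=
  IsFractionRing.algEquivOfAlgEquiv
    (AlgEquiv.ofAlgHom (actPoly u) (actPoly u⁻¹) (actPoly_inv u)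
      (by simpa using actPoly_inv u⁻¹))

/-- Upper triangular matrices with ones on the diagonal: the subgroup `U` of `GL_n`. -/
def IsUnipotentUpper (u : GL (Fin n) ℂ) : Prop :=
  (∀ i, u i i = 1) ∧ ∀ i j, j < i → u i j = 0

variable (n k)

/-- The ring of `U^(k+1)`-invariant regular functions on `GL_n^k`. -/
def invariantRing : Subalgebra ℂ (RatField n k) :=
  regularRing n k ⊓
    ⨅ (u : Fin (k + 1) → GL (Fin n) ℂ) (_ : ∀ i, IsUnipotentUpper (u i)),
      AlgHom.equalizer (act u : RatField n k →ₐ[ℂ] RatField n k) (AlgHom.id ℂ (RatField n k))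

/-- The quotient `M_k = GL_n^k // U^(k+1)`. -/
def quotientVariety : AlgebraicGeometry.Scheme :=
  AlgebraicGeometry.Spec (CommRingCat.of (invariantRing n k))

/-- The set `{M_α}` of multi-corner minors with `α = (0^l, i, j, 0^(k-l-2))`, `0 < i + j ≤ n`. -/
def consecutiveMinors : Set (RatField n k) :=
  (fun α => cornerMinor (generic n k) α) '' consecutiveIndex n k

end Quotient

/-! ### The varieties `B_-` and `B_-^k` -/

section Lower

variable (n k : ℕ)

/-- The positions on and below the diagonal. -/
abbrev LowerPos : Type := {p : Fin n × Fin n // p.2 ≤ p.1}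

/-- The field of rational functions on `B_-`, the group of invertible lower triangular matrices. -/
abbrev LowerField : Type := FractionRing (MvPolynomial (LowerPos n) ℂ)

/-- The generic point of `B_-`. -/
def lowerGeneric : Matrix (Fin n) (Fin n) (LowerField n) :=
  Matrix.of fun i j =>
    if h : j ≤ i then
      algebraMap (MvPolynomial (LowerPos n) ℂ) (LowerField n) (MvPolynomial.X ⟨(i, j), h⟩)
    else 0

/-- The coordinate ring of `B_-`. -/
def lowerRing : Subalgebra ℂ (LowerField n) :=
  Algebra.adjoin ℂ ({f | ∃ i j, f = lowerGeneric n i j} ∪ {(lowerGeneric n).det⁻¹})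

/-- The index set `δ_n = {(i, j) | 0 ≤ i ≤ n - 1, 1 ≤ j ≤ n, i + j ≤ n}`. -/
abbrev GZIndex : Type := {p : ℕ × ℕ // p.1 + 1 ≤ n ∧ 1 ≤ p.2 ∧ p.1 + p.2 ≤ n}

/-- The function `Δ_{i,j}` on `B_-`, the minor with rows `[1, j]^op` and columns `[i+1, i+j]`. -/
def lowerMinor (i j : ℕ) : LowerField n :=
  minor (lowerGeneric n) (op (interval n 0 j)) (interval n i j)

/-- The geometric Gelfand-Zeitlin coordinates `λ_j^{(n-i)} = Δ_{i,j} / Δ_{i,j-1}` on `B_-`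
(here `Δ_{i,0} = 1` is the empty minor). -/
def gzCoordinate (s : GZIndex n) : LowerField n :=
  lowerMinor n s.1.1 s.1.2 / lowerMinor n s.1.1 (s.1.2 - 1)

/-- The field of rational functions on `B_-^k`. -/
abbrev LowerPowField : Type := FractionRing (MvPolynomial (Fin k × LowerPos n) ℂ)

variable {k}

/-- The pullback of rational functions under the `l`-th projection `B_-^k → B_-`. -/
def pullback (l : Fin k) : LowerField n →ₐ[ℂ] LowerPowField n k :=
  IsFractionRing.liftAlgHom
    (g := (Algebra.algHom ℂ (MvPolynomial (Fin k × LowerPos n) ℂ) (LowerPowField n k)).comp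
      (MvPolynomial.rename fun p => (l, p)))
    ((IsFractionRing.injective (MvPolynomial (Fin k × LowerPos n) ℂ) (LowerPowField n k)).comp
      (MvPolynomial.rename_injective _ (Prod.mk_right_injective l)))

/-- The generic point of `B_-^k`. -/
def lowerPowGeneric (l : Fin k) : Matrix (Fin n) (Fin n) (LowerPowField n k) :=
  (lowerGeneric n).map (pullback n l)

variable {n}

/-- The coordinates of the product chart `θ × ⋯ × θ` on `B_-^k`, where `y` are the coordinates of
the chart `θ` on `B_-`. -/
def productChart {ι : Type} (y : ι → LowerField n) (s : Fin k × ι) : LowerPowField n k :=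
  pullback n s.1 (y s.2)

/-- `y` is a chart of the positive structure of `B_-`: a positive chart on `(B_-, Φ_BK)` that is
positively equivalent to the Gelfand-Zeitlin chart. -/
structure IsLowerChart {ι : Type} (y : ι → LowerField n) : Prop where
  chart : IsPositiveChart (lowerRing n) (potentialBK (lowerGeneric n)) y
  of_gz : ∀ s, IsPositive (gzCoordinate n) (y s)
  to_gz : ∀ s, IsPositive y (gzCoordinate n s)

end Lower

end MultiCorner

end

open MultiCorner

/-! The proof rests on an exact formula: wherever the multi-corner minors on the faces do not
vanish, the potential is the sum over all small rhombi of `M_α₁ M_α₃ / (M_α₂ M_α₄)`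
(`potential_eq_sum_rhombusIndex`). To see this, regard 1, g and gh as three flags, given by their
leading columns, and let `tripleDet` be the determinant of the first p, q, r columns with p + q + r
= n. The three-term Plücker relation writes the rhombus monomial of one orientation as a difference
of neighbouring terms of a sequence. Along a line of the triangle the sum telescopes, and the
boundary terms involve only two of the flags (`sum_rhombusTerm`). These boundary terms are the
halves of the Berenstein-Kazhdan potential; adding the three orientations and cancelling g by left
invariance gives `Φ(g) + Φ(h) - Φ(gh)` (`potentialBK_add_sub_mul`). Taking g₁⋯gₜ and gₜ₊₁ for g and
h and telescoping over t gives the formula. In algebraically independent coordinates in which the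
face minors are nonzero and positive, the tropicalization of the sum is a maximum, and both
equivalences follow (`trop_potential_le_zero_iff`).

For the quotient, the multi-corner minors are invariant because the columns taken from each block
are leading ones. Over a field, unitriangular matrices bring a tuple with nonzero face minors to a
normal form: the first matrix is antidiagonal, the others are lower triangular. There each face
minor is an edge minor times a solid minor of one lower triangular factor
(`cornerMinor_eq_mul_solidMinor`). Neville elimination recovers the entries of a lower triangular
matrix from its solid minors, and allows these to be prescribed freely. Hence invariant functions
are Laurent polynomials in the face minors (`invariantRing_le`), and the nonconstant face minors are
algebraically independent (`algebraicIndependent_consecutive`). A ring lying between the polynomials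
and the Laurent polynomials in such coordinates has the torus as a principal open subset, and its
dimension is the number of coordinates.

For `B_-^k`, the same elimination shows that all minors of a lower triangular matrix are
subtraction-free in the Gelfand-Zeitlin coordinates (`minorsIn_of_solidMinor`, used after a
reflection in the antidiagonal). Cauchy-Binet expands a multi-corner minor into products of such
minors, one of which is nonzero, and positive functions do not cancel (`det_blockRow_mem`). The
coordinates of an arbitrary chart are algebraically independent since an open immersion is flat, and
a count of transcendence degrees carries this over to the product chart. -/

noncomputable section

namespace MultiCorner

/-! ### Neville elimination for lower triangular matrices -/

section Neville

variable {R : Type*} [CommRing R] {F : Type*} [Field F]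

/-- The minor with rows `i, …, i + j - 1` and columns `0, …, j - 1` of an infinite matrix. -/
def solidMinor (b : ℕ → ℕ → R) (i j : ℕ) : R :=
  Matrix.det (Matrix.of fun r c : Fin j => b (i + r) c)

theorem solidMinor_zero (b : ℕ → ℕ → R) (i : ℕ) : solidMinor b i 0 = 1 :=
  Matrix.det_isEmpty

theorem solidMinor_one (b : ℕ → ℕ → R) (i : ℕ) : solidMinor b i 1 = b i 0 := by
  simp [solidMinor]

/-- One step of Neville elimination: clear the first column using neighbouring rows, and delete
the first row and column. -/
def nevilleStep (b : ℕ → ℕ → F) (i j : ℕ) : F :=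
  b (i + 1) (j + 1) - b (i + 1) 0 / b i 0 * b i (j + 1)

/-- Subtracting from each row the multiple of its predecessor that kills the first entry leaves the
determinant unchanged. Expansion along the cleared first column then produces the eliminated matrix.
-/
theorem solidMinor_succ (b : ℕ → ℕ → F) (i j : ℕ) (hb : ∀ r < j, b (i + r) 0 ≠ 0) :
    solidMinor b i (j + 1) = b i 0 * solidMinor (nevilleStep b) i j := by
  let B : Matrix (Fin (j + 1)) (Fin (j + 1)) F := Matrix.of fun r c =>
    Fin.cases (b i c)
      (fun r' => b (i + r' + 1) c - b (i + r' + 1) 0 / b (i + r') 0 * b (i + r') c) r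
  have h1 : solidMinor b i (j + 1) = B.det := by
    refine Matrix.det_eq_of_forall_row_eq_smul_add_pred
      (fun r => b (i + r + 1) 0 / b (i + r) 0) ?_ ?_
    · intro c
      simp [B]
    · intro r c
      simp only [B, Matrix.of_apply, Fin.cases_succ, Fin.val_succ, Fin.val_castSucc]
      rw [← add_assoc]
      ring
  rw [h1, Matrix.det_succ_column_zero, Fin.sum_univ_succ, Finset.sum_eq_zero, add_zero]
  · simp only [Fin.val_zero, pow_zero, one_mul]
    congr 1
  · intro r _
    have : B r.succ 0 = 0 := by
      simp only [B, Matrix.of_apply, Fin.cases_succ, Fin.val_zero]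
      rw [div_mul_cancel₀ _ (hb r r.2), sub_self]
    rw [this]
    ring

/-- A lower triangular matrix with `n` columns and prescribed nonzero solid minors. -/
theorem exists_solidMinor_eq (n : ℕ) (m : ℕ → ℕ → F) (hm : ∀ i j, m i j ≠ 0) :
    ∃ b : ℕ → ℕ → F, (∀ i j, i < j → b i j = 0) ∧
      ∀ i j, j < n → solidMinor b i (j + 1) = m i (j + 1) := by
  induction n generalizing m with
  | zero => exact ⟨fun _ _ => 0, fun _ _ _ => rfl, fun _ _ h => absurd h (Nat.not_lt_zero _)⟩
  | succ n ih =>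
    -- By `solidMinor_succ`, these quotients are the solid minors that the matrix must have after
    -- one elimination step.
    obtain ⟨h, hlow, hh⟩ := ih (fun i j => m i (j + 1) / m i 1)
      (fun i j => div_ne_zero (hm _ _) (hm _ _))
    -- The inverse of a Neville step: the first column is `m i 1`, and every other column is built
    -- downwards from a zero in row 0.
    let row (j : ℕ) : ℕ → F := fun i =>
      Nat.rec 0 (fun r x => h r j + m (r + 1) 1 / m r 1 * x) i
    let b : ℕ → ℕ → F := fun i j => Nat.casesOn j (m i 1) fun j' => row j' i
    have hb0 : ∀ i, b i 0 = m i 1 := fun _ => rfl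
    have hbz : ∀ j, b 0 (j + 1) = 0 := fun _ => rfl
    have hbs : ∀ i j, b (i + 1) (j + 1) = h i j + m (i + 1) 1 / m i 1 * b i (j + 1) :=
      fun _ _ => rfl
    have hstep : nevilleStep b = h := by
      funext i j
      rw [nevilleStep, hbs, hb0, hb0]
      ring
    refine ⟨b, ?_, ?_⟩
    · intro i j hij
      obtain ⟨j, rfl⟩ : ∃ j', j = j' + 1 := ⟨j - 1, by omega⟩
      induction i with
      | zero => exact hbz j
      | succ i ih' => rw [hbs, hlow i j (by omega), ih' (by omega)]; ring
    · intro i j hj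
      rw [solidMinor_succ b i j (fun r _ => by rw [hb0]; exact hm _ _), hstep, hb0]
      cases j with
      | zero => simp [solidMinor_zero]
      | succ j =>
        rw [hh i j (by omega)]
        exact mul_div_cancel₀ _ (hm _ _)

/-- All minors of the upper left `n × n` block of `b` lie in `S`. -/
def MinorsIn (S : Subsemiring R) (n : ℕ) (b : ℕ → ℕ → R) : Prop :=
  ∀ (m : ℕ) (f g : Fin m → ℕ), StrictMono f → StrictMono g → (∀ a, f a < n) → (∀ a, g a < n) →
    (Matrix.of fun a c => b (f a) (g c)).det ∈ S

/-- The block matrix with an upper left entry `x` and a lower right block `h`. -/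
def bordered (x : R) (h : ℕ → ℕ → R) : ℕ → ℕ → R
  | 0, 0 => x
  | 0, _ + 1 => 0
  | _ + 1, 0 => 0
  | i + 1, j + 1 => h i j

/-- If exactly one of row 0 and column 0 is selected, the minor has a zero row or column. If both
are, it is `x` times a minor of `h`; if neither is, it is a minor of `h`. -/
theorem MinorsIn.bordered {S : Subsemiring R} {n : ℕ} {h : ℕ → ℕ → R} {x : R}
    (hh : MinorsIn S n h) (hx : x ∈ S) : MinorsIn S (n + 1) (bordered x h) := by
  have shift : ∀ (m : ℕ) (f g : Fin m → ℕ), StrictMono f → StrictMono g → (∀ a, f a < n + 1) →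
      (∀ a, g a < n + 1) → (∀ a, f a ≠ 0) → (∀ a, g a ≠ 0) →
      (Matrix.of fun a c => MultiCorner.bordered x h (f a) (g c)).det ∈ S := by
    intro m f g hf hg hfn hgn hf0 hg0
    have := hh m (fun a => f a - 1) (fun a => g a - 1)
      (fun a b hab => by have := hf hab; have := hf0 a; show f a - 1 < f b - 1; omega)
      (fun a b hab => by have := hg hab; have := hg0 a; show g a - 1 < g b - 1; omega)
      (fun a => by have := hfn a; have := hf0 a; show f a - 1 < n; omega)
      (fun a => by have := hgn a; have := hg0 a; show g a - 1 < n; omega)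
    convert this using 2
    ext a c
    obtain ⟨p, hp⟩ := Nat.exists_eq_succ_of_ne_zero (hf0 a)
    obtain ⟨q, hq⟩ := Nat.exists_eq_succ_of_ne_zero (hg0 c)
    simp [hp, hq, MultiCorner.bordered]
  intro m f g hf hg hfn hgn
  cases m with
  | zero => rw [Matrix.det_isEmpty]; exact S.one_mem
  | succ m =>
    have hpos : ∀ {f : Fin (m + 1) → ℕ}, StrictMono f → ∀ a : Fin m, f a.succ ≠ 0 := by
      intro f hf a
      exact (Nat.zero_le _).trans_lt (hf (Fin.succ_pos a)) |>.ne'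
    have hall : ∀ {f : Fin (m + 1) → ℕ}, StrictMono f → f 0 ≠ 0 → ∀ a, f a ≠ 0 := by
      intro f hf h0 a
      exact ((Nat.pos_of_ne_zero h0).trans_le (hf.monotone (Fin.zero_le a))).ne'
    by_cases h1 : f 0 = 0 <;> by_cases h2 : g 0 = 0
    · rw [Matrix.det_succ_row_zero, Fin.sum_univ_succ, Finset.sum_eq_zero, add_zero]
      · simp only [Fin.val_zero, pow_zero, one_mul, Matrix.of_apply, h1, h2]
        refine S.mul_mem hx ?_
        have := shift m (fun a => f a.succ) (fun a => g a.succ)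
          (fun a b hab => hf (Fin.succ_lt_succ_iff.mpr hab))
          (fun a b hab => hg (Fin.succ_lt_succ_iff.mpr hab))
          (fun a => hfn _) (fun a => hgn _) (hpos hf) (hpos hg)
        convert this using 2
        ext a c
        simp
      · intro c _
        obtain ⟨q, hq⟩ := Nat.exists_eq_succ_of_ne_zero (hpos hg c)
        simp [h1, hq, MultiCorner.bordered]
    · rw [Matrix.det_eq_zero_of_row_eq_zero 0]
      · exact S.zero_mem
      · intro c
        obtain ⟨q, hq⟩ := Nat.exists_eq_succ_of_ne_zero (hall hg h2 c)
        simp [h1, hq, MultiCorner.bordered]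
    · rw [Matrix.det_eq_zero_of_column_eq_zero 0]
      · exact S.zero_mem
      · intro c
        obtain ⟨q, hq⟩ := Nat.exists_eq_succ_of_ne_zero (hall hf h1 c)
        simp [h2, hq, MultiCorner.bordered]
    · exact shift _ f g hf hg hfn hgn (hall hf h1) (hall hg h2)

/-- A minor using row `t + 1` splits, by linearity in that row, into the old minor and `c` times the
one with row `t` in its place. No sign arises because the two rows are adjacent. -/
theorem MinorsIn.add_row {S : Subsemiring R} {n : ℕ} {b b' : ℕ → ℕ → R} {c : R} {t : ℕ}
    (hb : MinorsIn S n b) (hc : c ∈ S) (hne : ∀ i, i ≠ t + 1 → b' i = b i)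
    (ht : b' (t + 1) = b (t + 1) + c • b t) : MinorsIn S n b' := by
  intro m f g hf hg hfn hgn
  by_cases h : ∃ a, f a = t + 1
  · obtain ⟨a, ha⟩ := h
    have hother : ∀ r, r ≠ a → f r ≠ t + 1 := fun r hr h => hr (hf.injective (h.trans ha.symm))
    have e : (Matrix.of fun r s => b' (f r) (g s))
        = (Matrix.of fun r s => b (f r) (g s)).updateRow a
          ((fun s => b (t + 1) (g s)) + c • fun s => b t (g s)) := by
      ext r s
      by_cases hr : r = a
      · subst hr
        simp [ha, ht]
      · simp [Matrix.updateRow_ne hr, hne _ (hother r hr)]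
    rw [e, Matrix.det_updateRow_add, Matrix.det_updateRow_smul]
    refine S.add_mem ?_ (S.mul_mem hc ?_)
    · have e2 : (Matrix.of fun r s => b (f r) (g s)).updateRow a (fun s => b (t + 1) (g s))
          = Matrix.of fun r s => b (f r) (g s) := by
        rw [← ha]
        exact Matrix.updateRow_eq_self _ a
      rw [e2]
      exact hb m f g hf hg hfn hgn
    · by_cases h' : ∃ a', f a' = t
      · obtain ⟨a', ha'⟩ := h'
        have hne' : a' ≠ a := by
          rintro rfl
          omega
        rw [Matrix.det_zero_of_row_eq hne']
        · exact S.zero_mem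
        · ext s
          simp [Matrix.updateRow_ne hne', ha']
      -- Row `t` is not selected, so replacing row `t + 1` by it keeps the selection increasing.
      · push Not at h'
        have e2 : (Matrix.of fun r s => b (f r) (g s)).updateRow a (fun s => b t (g s))
            = Matrix.of fun r s => b (Function.update f a t r) (g s) := by
          ext r s
          by_cases hr : r = a
          · subst hr
            simp
          · simp [Matrix.updateRow_ne hr, Function.update_of_ne hr]
        rw [e2]
        refine hb m _ g ?_ hg ?_ hgn
        · intro r s hrs
          have h1 := hf hrs
          by_cases hr : r = a
          · subst hr
            rw [Function.update_self, Function.update_of_ne hrs.ne']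
            omega
          · by_cases hs : s = a
            · subst hs
              rw [Function.update_self, Function.update_of_ne hr]
              have := h' r
              omega
            · rwa [Function.update_of_ne hr, Function.update_of_ne hs]
        · intro r
          by_cases hr : r = a
          · subst hr
            rw [Function.update_self]
            have := hfn r
            omega
          · rw [Function.update_of_ne hr]
            exact hfn r
  · push Not at h
    have : (Matrix.of fun r s => b' (f r) (g s)) = Matrix.of fun r s => b (f r) (g s) := by
      ext r s
      simp [hne _ (h r)]
    rw [this]
    exact hb m f g hf hg hfn hgn

/-- All minors of a lower triangular matrix are subtraction-free Laurent expressions in its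
solid minors. -/
theorem minorsIn_of_solidMinor (S : Subsemiring F) (n : ℕ) (b : ℕ → ℕ → F)
    (hlow : ∀ i j, i < j → b i j = 0)
    (hb : ∀ i j, i + j < n → solidMinor b i (j + 1) ≠ 0 ∧ solidMinor b i (j + 1) ∈ S ∧
      (solidMinor b i (j + 1))⁻¹ ∈ S) : MinorsIn S n b := by
  induction n generalizing b with
  | zero =>
    intro m f g _ _ hf _
    cases m with
    | zero => rw [Matrix.det_isEmpty]; exact S.one_mem
    | succ m => exact absurd (hf 0) (Nat.not_lt_zero _)
  | succ n ih =>
    have h0 : ∀ i ≤ n, b i 0 ≠ 0 ∧ b i 0 ∈ S ∧ (b i 0)⁻¹ ∈ S := by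
      intro i hi
      have := hb i 0 (by omega)
      rwa [zero_add, solidMinor_one] at this
    have hstep : MinorsIn S n (nevilleStep b) := by
      apply ih
      · intro i j hij
        rw [nevilleStep, hlow (i + 1) (j + 1) (by omega), hlow i (j + 1) (by omega)]
        ring
      · intro i j hij
        have hs := solidMinor_succ b i (j + 1) (fun r hr => (h0 (i + r) (by omega)).1)
        obtain ⟨ha, ha', ha''⟩ := h0 i (by omega)
        obtain ⟨hc, hc', hc''⟩ := hb i (j + 1) (by omega)
        have hs' : solidMinor (nevilleStep b) i (j + 1)
            = (b i 0)⁻¹ * solidMinor b i (j + 1 + 1) := by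
          rw [hs, inv_mul_cancel_left₀ ha]
        rw [hs']
        refine ⟨mul_ne_zero (inv_ne_zero ha) hc, S.mul_mem ha'' hc', ?_⟩
        rw [mul_inv, inv_inv]
        exact S.mul_mem ha' hc''
    have hbord := hstep.bordered (h0 0 (Nat.zero_le _)).2.1
    -- The elimination is undone from the top: rows up to `t` are those of `b`, the rest are still
    -- eliminated. Row `t + 1` is restored by adding `b (t + 1) 0 / b t 0` times row `t` of `b`, a
    -- coefficient in `S`.
    let stage (t : ℕ) : ℕ → ℕ → F := fun i =>
      if i ≤ t then b i else bordered (b 0 0) (nevilleStep b) i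
    have key : ∀ t ≤ n, MinorsIn S (n + 1) (stage t) := by
      intro t
      induction t with
      | zero =>
        intro _
        convert hbord using 1
        funext i
        by_cases hi : i = 0
        · subst hi
          funext j
          cases j with
          | zero => rfl
          | succ j => exact hlow 0 (j + 1) (Nat.succ_pos _)
        · simp [stage, hi]
      | succ t iht =>
        intro ht
        refine (iht (by omega)).add_row (t := t) (c := b (t + 1) 0 / b t 0) ?_ ?_ ?_
        · rw [div_eq_mul_inv]
          exact S.mul_mem (h0 _ ht).2.1 (h0 t (by omega)).2.2
        · intro i hi
          simp only [stage]
          by_cases h : i ≤ t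
          · rw [if_pos h, if_pos (by omega)]
          · rw [if_neg h, if_neg (by omega)]
        · funext j
          simp only [stage, le_refl, if_true, Nat.not_succ_le_self, if_false, Pi.add_apply,
            Pi.smul_apply, smul_eq_mul]
          cases j with
          | zero =>
            rw [div_mul_cancel₀ _ (h0 t (by omega)).1]
            simp [bordered]
          | succ j => simp [bordered, nevilleStep]
    intro m f g hf hg hfn hgn
    have := key n le_rfl m f g hf hg hfn hgn
    convert this using 3
    ext r s
    have := hfn r
    simp only [stage]
    rw [if_pos (by omega)]

end Neville

/-! ### Determinants of lists of columns -/

section ListDet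

variable {R : Type*} [CommRing R] {n : ℕ}

/-- The determinant of the matrix whose columns are the first `n` entries of a list. -/
def listDet (l : List (Fin n → R)) : R :=
  Matrix.det (Matrix.of fun r c : Fin n => l.getD c 0 r)

theorem listDet_swap (l₁ l₂ : List (Fin n → R)) (x y : Fin n → R)
    (h : l₁.length + 2 + l₂.length = n) :
    listDet (l₁ ++ x :: y :: l₂) = -listDet (l₁ ++ y :: x :: l₂) := by
  have hn1 : l₁.length < n := by omega
  have hn2 : l₁.length + 1 < n := by omega
  let p : Fin n := ⟨l₁.length, hn1⟩
  let q : Fin n := ⟨l₁.length + 1, hn2⟩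
  have hpq : p ≠ q := by simp [p, q, Fin.ext_iff]
  have e : (Matrix.of fun r c : Fin n => (l₁ ++ x :: y :: l₂).getD c 0 r)
      = (Matrix.of fun r c : Fin n => (l₁ ++ y :: x :: l₂).getD c 0 r).submatrix id
        (Equiv.swap p q) := by
    ext r c
    simp only [Matrix.of_apply, Matrix.submatrix_apply, id]
    by_cases h1 : c = p
    · subst h1
      simp [p, q]
    · by_cases h2 : c = q
      · subst h2
        simp [p, q]
      · rw [Equiv.swap_apply_of_ne_of_ne h1 h2]
        have h1' : (c : ℕ) ≠ l₁.length := fun h => h1 (Fin.ext h)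
        have h2' : (c : ℕ) ≠ l₁.length + 1 := fun h => h2 (Fin.ext h)
        rcases lt_or_ge (c : ℕ) l₁.length with h3 | h3
        · rw [List.getD_append _ _ _ _ h3, List.getD_append _ _ _ _ h3]
        · rw [List.getD_append_right _ _ _ _ h3, List.getD_append_right _ _ _ _ h3]
          obtain ⟨d, hd⟩ : ∃ d, (c : ℕ) - l₁.length = d + 2 :=
            ⟨(c : ℕ) - l₁.length - 2, by omega⟩
          rw [hd]
          simp
  rw [listDet, e, Matrix.det_permute', Equiv.Perm.sign_swap hpq]
  simp [listDet]

theorem listDet_move (l₁ l₂ l₃ : List (Fin n → R)) (x : Fin n → R)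
    (h : l₁.length + 1 + l₂.length + l₃.length = n) :
    listDet (l₁ ++ x :: (l₂ ++ l₃)) = (-1) ^ l₂.length * listDet (l₁ ++ (l₂ ++ x :: l₃)) := by
  induction l₂ generalizing l₁ with
  | nil => simp
  | cons y l₂ ih =>
    have h' : l₁.length + 1 + (l₂.length + 1) + l₃.length = n := by simpa using h
    have := ih (l₁ ++ [y]) (by simp; omega)
    simp only [List.append_assoc, List.singleton_append] at this
    rw [List.cons_append, listDet_swap _ _ _ _ (by simp; omega), this, List.length_cons, pow_succ]
    simp

/-- Each column of the first list is carried past the whole second list. -/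
theorem listDet_rotate (l₁ l₂ : List (Fin n → R)) (h : l₁.length + l₂.length = n) :
    listDet (l₁ ++ l₂) = (-1) ^ (l₁.length * l₂.length) * listDet (l₂ ++ l₁) := by
  induction l₁ using List.reverseRecOn generalizing l₂ with
  | nil => simp
  | append_singleton l₁ x ih =>
    have h' : l₁.length + 1 + l₂.length = n := by simpa using h
    have h1 := listDet_move l₁ l₂ [] x (by simpa using h')
    have h2 := ih (l₂ ++ [x]) (by simp; omega)
    have h3 := listDet_move l₂ l₁ [] x (by simp; omega)
    simp only [List.append_nil, List.append_assoc, List.singleton_append] at h1 h2 h3 ⊢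
    rw [h1, h2, h3, List.length_append, List.length_append, List.length_singleton,
      ← mul_assoc, ← mul_assoc, ← pow_add, ← pow_add]
    congr 1
    have : l₂.length + l₁.length * (l₂.length + 1) + l₁.length
      = (l₁.length + 1) * l₂.length + 2 * l₁.length := by ring
    rw [this, pow_add, pow_mul (-1 : R) 2]
    simp

theorem listDet_map_mulVec (g : Matrix (Fin n) (Fin n) R) (l : List (Fin n → R)) :
    listDet (l.map g.mulVec) = g.det * listDet l := by
  rw [listDet, listDet, ← Matrix.det_mul]
  congr 1
  ext r c
  simp only [Matrix.of_apply, Matrix.mul_apply]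
  rw [show (0 : Fin n → R) = g.mulVec 0 from (Matrix.mulVec_zero g).symm, List.getD_map]
  simp [Matrix.mulVec, dotProduct]

/-- By Cramer, `A.det • b` is the combination of the columns of `A` with coefficients `A.cramer b`.
Substituting it into column `p` leaves only the summands for `p` and `q`; in all others a column of
`A` is repeated. No invertibility of `A` is needed. -/
theorem det_updateCol_updateCol (A : Matrix (Fin n) (Fin n) R) {p q : Fin n} (hpq : p ≠ q)
    (b c : Fin n → R) :
    A.det * ((A.updateCol p b).updateCol q c).det
      = (A.updateCol p b).det * (A.updateCol q c).det
        - (A.updateCol q b).det * (A.updateCol p c).det := by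
  have hcomm : ∀ v, (A.updateCol p v).updateCol q c = (A.updateCol q c).updateCol p v :=
    fun v => Matrix.updateCol_comm A hpq v c
  have hlin : ∀ v : Fin n → R, ((A.updateCol p v).updateCol q c).det
      = (A.updateCol q c).cramer v p := fun v => by rw [hcomm, Matrix.cramer_apply]
  have hb : A.det • b = ∑ i, A.cramer b i • A.col i := by
    rw [← Matrix.mulVec_cramer, Matrix.mulVec_eq_sum]
    refine Finset.sum_congr rfl fun i _ => ?_
    ext r
    simp [mul_comm]
  have h1 : A.det * ((A.updateCol p b).updateCol q c).det
      = ∑ i, A.cramer b i * ((A.updateCol p (A.col i)).updateCol q c).det := by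
    rw [hlin, ← smul_eq_mul, ← Pi.smul_apply, ← map_smul, hb, map_sum, Finset.sum_apply]
    refine Finset.sum_congr rfl fun i _ => ?_
    rw [map_smul, hlin, Pi.smul_apply, smul_eq_mul]
  rw [h1, Finset.sum_eq_add_of_mem p q (Finset.mem_univ _) (Finset.mem_univ _) hpq]
  · have hp : A.updateCol p (A.col p) = A := Matrix.updateCol_eq_self A p
    have hq : ((A.updateCol p (A.col q)).updateCol q c).det = -(A.updateCol p c).det := by
      have : (A.updateCol p (A.col q)).updateCol q c
          = (A.updateCol p c).submatrix id (Equiv.swap p q) := by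
        ext r s
        by_cases hs : s = p
        · subst hs
          simp [hpq, hpq.symm]
        · by_cases hs' : s = q
          · subst hs'
            simp
          · simp [hs, hs', Equiv.swap_apply_of_ne_of_ne]
      rw [this, Matrix.det_permute', Equiv.Perm.sign_swap hpq]
      simp
    rw [hp, hq, Matrix.cramer_apply, Matrix.cramer_apply]
    ring
  · intro i _ hi
    have : ((A.updateCol p (A.col i)).updateCol q c).det = 0 := by
      refine Matrix.det_zero_of_column_eq hi.1.symm fun r => ?_
      simp [hpq, hi.1, hi.2]
    rw [this, mul_zero]

/-- This is `det_updateCol_updateCol` for the last two columns of the matrix `l, a, a'`. -/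
theorem listDet_pluecker (l : List (Fin n → R)) (h : l.length + 2 = n) (a a' b c : Fin n → R) :
    listDet (l ++ [a, a']) * listDet (l ++ [b, c])
      = listDet (l ++ [a', c]) * listDet (l ++ [a, b])
        - listDet (l ++ [a', b]) * listDet (l ++ [a, c]) := by
  let p : Fin n := ⟨l.length, by omega⟩
  let q : Fin n := ⟨l.length + 1, by omega⟩
  have hpq : p ≠ q := by simp [p, q, Fin.ext_iff]
  let A : Matrix (Fin n) (Fin n) R := Matrix.of fun r c : Fin n => (l ++ [a, a']).getD c 0 r
  have hp : (p : ℕ) = l.length := rfl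
  have hq : (q : ℕ) = l.length + 1 := rfl
  have key : ∀ x y, (A.updateCol p x).updateCol q y
      = Matrix.of fun r c : Fin n => (l ++ [x, y]).getD c 0 r := by
    intro x y
    ext r s
    by_cases h1 : s = q
    · subst h1
      simp [hq]
    · by_cases h2 : s = p
      · subst h2
        simp [hp, hpq]
      · have h3 : (s : ℕ) < l.length := by
          have := s.2
          have h1' : (s : ℕ) ≠ l.length + 1 := fun h => h1 (Fin.ext h)
          have h2' : (s : ℕ) ≠ l.length := fun h => h2 (Fin.ext h)
          omega
        simp [A, h1, h2, List.getElem?_append_left h3]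
  have hA1 : ∀ x, A.updateCol p x = (A.updateCol p x).updateCol q a' := by
    intro x
    ext r s
    by_cases h1 : s = q
    · subst h1
      simp [A, hq, hpq.symm]
    · simp [Matrix.updateCol_apply, h1]
  have hA2 : ∀ x, A.updateCol q x = (A.updateCol p a).updateCol q x := by
    intro x
    ext r s
    by_cases h1 : s = q
    · subst h1
      simp
    · by_cases h2 : s = p
      · subst h2
        simp [A, hp, hpq]
      · simp [h1, h2]
  have key' : ∀ x y, ((A.updateCol p x).updateCol q y).det = listDet (l ++ [x, y]) :=
    fun x y => by rw [key, listDet]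
  have main := det_updateCol_updateCol A hpq b c
  rw [key', hA2 c, hA2 b, hA1 b, hA1 c, key', key', key', key'] at main
  have hsw : ∀ x, listDet (l ++ [x, a']) = -listDet (l ++ [a', x]) :=
    fun x => listDet_swap l [] x a' (by simpa using h)
  change listDet (l ++ [a, a']) * _ = _ at main
  rw [main, hsw b, hsw c]
  ring

/-- The three-term Plücker relation for three flags, at the first flag. -/
theorem listDet_three_term (U V W : List (Fin n → R)) (a a' b c : Fin n → R)
    (h : U.length + V.length + W.length + 2 = n) :
    listDet (U ++ [a, a'] ++ V ++ W) * listDet (U ++ (V ++ [b]) ++ (W ++ [c]))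
      = listDet (U ++ [a'] ++ V ++ (W ++ [c])) * listDet (U ++ [a] ++ (V ++ [b]) ++ W)
        - listDet (U ++ [a'] ++ (V ++ [b]) ++ W) * listDet (U ++ [a] ++ V ++ (W ++ [c])) := by
  -- The four distinguished columns are moved to the end, where `listDet_pluecker` applies. The
  -- signs depend only on the lengths of `V` and `W`.
  have hb : ∀ x, listDet (U ++ [x] ++ (V ++ [b]) ++ W)
      = (-1) ^ V.length * listDet (U ++ V ++ W ++ [x, b]) := by
    intro x
    have h1 := listDet_move (U ++ [x] ++ V) W [] b (by simp; omega)
    have h2 := listDet_move U (V ++ W) [b] x (by simp; omega)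
    simp only [List.append_assoc, List.append_nil, List.nil_append,
      List.cons_append, List.length_append] at h1 h2 ⊢
    rw [h1, h2, ← mul_assoc, ← pow_add]
    congr 1
    rw [show W.length + (V.length + W.length) = V.length + 2 * W.length by ring, pow_add,
      pow_mul (-1 : R) 2]
    simp
  have hc : ∀ x, listDet (U ++ [x] ++ V ++ (W ++ [c]))
      = (-1) ^ (V.length + W.length) * listDet (U ++ V ++ W ++ [x, c]) := by
    intro x
    have h2 := listDet_move U (V ++ W) [c] x (by simp; omega)
    simp only [List.append_assoc, List.nil_append,
      List.cons_append, List.length_append] at h2 ⊢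
    rw [h2]
  have h3 : listDet (U ++ [a, a'] ++ V ++ W) = listDet (U ++ V ++ W ++ [a, a']) := by
    have h1 := listDet_move (U ++ [a]) (V ++ W) [] a' (by simp; omega)
    have h2 := listDet_move U (V ++ W) [a'] a (by simp; omega)
    simp only [List.append_assoc, List.append_nil, List.nil_append,
      List.cons_append, List.length_append] at h1 h2 ⊢
    rw [h1, h2, ← mul_assoc, ← pow_add, ← two_mul, pow_mul]
    simp
  have h4 : listDet (U ++ (V ++ [b]) ++ (W ++ [c]))
      = (-1) ^ W.length * listDet (U ++ V ++ W ++ [b, c]) := by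
    have h1 := listDet_move (U ++ V) W [c] b (by simp; omega)
    simp only [List.append_assoc, List.nil_append,
      List.cons_append] at h1 ⊢
    rw [h1]
  have hsign : (-1 : R) ^ (V.length + W.length) * (-1) ^ V.length = (-1) ^ W.length := by
    rw [← pow_add, show V.length + W.length + V.length = W.length + 2 * V.length by ring, pow_add,
      pow_mul (-1 : R) 2]
    simp
  have hP := listDet_pluecker (U ++ V ++ W) (by simp; omega) a a' b c
  rw [hb, hb, hc, hc, h3, h4]
  linear_combination (-1) ^ W.length * hP - (listDet (U ++ V ++ W ++ [a', c])
    * listDet (U ++ V ++ W ++ [a, b]) - listDet (U ++ V ++ W ++ [a', b])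
    * listDet (U ++ V ++ W ++ [a, c])) * hsign

end ListDet

/-! ### Three flags -/

section Flags

variable {R : Type*} [CommRing R] {F : Type*} [Field F] {n : ℕ}

/-- The first `p` columns of a sequence of columns. -/
def cols (A : ℕ → Fin n → R) (p : ℕ) : List (Fin n → R) := (List.range p).map A

@[simp] theorem length_cols {S : Type*} (A : ℕ → Fin n → S) (p : ℕ) :
    (cols A p).length = p := by simp [cols]

@[simp] theorem cols_zero {S : Type*} (A : ℕ → Fin n → S) : cols A 0 = [] := rfl

theorem cols_succ {S : Type*} (A : ℕ → Fin n → S) (p : ℕ) : cols A (p + 1) = cols A p ++ [A p] := by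
  simp [cols, List.range_succ]

theorem getD_cols (A : ℕ → Fin n → R) {p c : ℕ} (h : c < p) : (cols A p).getD c 0 = A c := by
  simp [cols, h]

/-- The determinant of the first `p`, `q`, `r` columns of three sequences of columns. -/
def tripleDet (A B C : ℕ → Fin n → R) (p q r : ℕ) : R :=
  listDet (cols A p ++ cols B q ++ cols C r)

/-- As `tripleDet` for `p + 1`, `q`, `r`, with column `p` of `A` replaced by column `p + 1`. -/
def skipDet (A B C : ℕ → Fin n → R) (p q r : ℕ) : R :=
  listDet (cols A p ++ [A (p + 1)] ++ cols B q ++ cols C r)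

theorem tripleDet_rotate (A B C : ℕ → Fin n → R) {p q r : ℕ} (h : p + q + r = n) :
    tripleDet A B C p q r = (-1) ^ (p * (q + r)) * tripleDet B C A q r p := by
  have := listDet_rotate (cols A p) (cols B q ++ cols C r) (by simp; omega)
  simpa [tripleDet] using this

theorem tripleDet_mul_tripleDet (A B C : ℕ → Fin n → R) {p q r : ℕ} (h : p + q + r + 2 = n) :
    tripleDet A B C (p + 2) q r * tripleDet A B C p (q + 1) (r + 1)
      = skipDet A B C p q (r + 1) * tripleDet A B C (p + 1) (q + 1) r
        - skipDet A B C p (q + 1) r * tripleDet A B C (p + 1) q (r + 1) := by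
  have := listDet_three_term (cols A p) (cols B q) (cols C r) (A p) (A (p + 1)) (B q) (C r)
    (by simpa using h)
  simp only [tripleDet, skipDet, cols_succ, List.append_assoc,
    List.cons_append, List.nil_append] at this ⊢
  exact this

/-- The triples `(p, q, r)` with `p + q + r + 2 = n`. -/
def triples (n : ℕ) : Finset (ℕ × ℕ × ℕ) :=
  (Finset.range n ×ˢ Finset.range n ×ˢ Finset.range n).filter
    fun t => t.1 + t.2.1 + t.2.2 + 2 = n

theorem mem_triples {n : ℕ} {t : ℕ × ℕ × ℕ} : t ∈ triples n ↔ t.1 + t.2.1 + t.2.2 + 2 = n := by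
  simp only [triples, Finset.mem_filter, Finset.mem_product, Finset.mem_range]
  omega

theorem sum_triples_rotate {M : Type*} [AddCommMonoid M] (n : ℕ) (f : ℕ → ℕ → ℕ → M) :
    ∑ t ∈ triples n, f t.2.1 t.2.2 t.1 = ∑ t ∈ triples n, f t.1 t.2.1 t.2.2 := by
  refine Finset.sum_bij' (fun t _ => (t.2.1, t.2.2, t.1)) (fun t _ => (t.2.2, t.1, t.2.1))
    ?_ ?_ ?_ ?_ ?_
  all_goals intro t ht
  · rw [mem_triples] at ht ⊢
    simp only
    omega
  · rw [mem_triples] at ht ⊢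
    simp only
    omega
  · rfl
  · rfl
  · rfl

/-- The triangle is cut into lines of constant `p`, along which the rhombus sum telescopes in `q`.
-/
theorem sum_triples {M : Type*} [AddCommMonoid M] (n : ℕ) (f : ℕ → ℕ → ℕ → M) :
    ∑ t ∈ triples n, f t.1 t.2.1 t.2.2
      = ∑ p ∈ Finset.range (n - 1), ∑ q ∈ Finset.range (n - 1 - p), f p q (n - 2 - p - q) := by
  rw [Finset.sum_sigma']
  refine Finset.sum_bij' (fun t _ => ⟨t.1, t.2.1⟩)
    (fun s _ => (s.1, s.2, n - 2 - s.1 - s.2)) ?_ ?_ ?_ ?_ ?_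
  · intro t ht
    rw [mem_triples] at ht
    simp only [Finset.mem_sigma, Finset.mem_range]
    omega
  · intro s hs
    simp only [Finset.mem_sigma, Finset.mem_range] at hs
    rw [mem_triples]
    simp only
    omega
  · rintro ⟨p, q, r⟩ ht
    rw [mem_triples] at ht
    simp only at ht ⊢
    congr 2
    omega
  · intro s hs
    rfl
  · rintro ⟨p, q, r⟩ ht
    rw [mem_triples] at ht
    simp only at ht ⊢
    congr 1
    omega

/-- The rhombus monomial at the first flag. -/
def rhombusTerm (A B C : ℕ → Fin n → F) (p q r : ℕ) : F :=
  tripleDet A B C (p + 2) q r * tripleDet A B C p (q + 1) (r + 1)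
    / (tripleDet A B C (p + 1) (q + 1) r * tripleDet A B C (p + 1) q (r + 1))

/-- The part at the flag `A` of the potential of a pair of flags. -/
def flagPotential (A B : ℕ → Fin n → F) : F :=
  ∑ p ∈ Finset.range (n - 1),
    listDet (cols A p ++ [A (p + 1)] ++ cols B (n - 1 - p))
      / listDet (cols A (p + 1) ++ cols B (n - 1 - p))

/-- Dividing the Plücker relation `tripleDet_mul_tripleDet` by the two short-diagonal determinants
makes each term `u q - u (q + 1)`, where `u` is a quotient of `skipDet` by `tripleDet`. On the line
of a given `p`, only the end without columns of `B` and the end without columns of `C` survive. -/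
theorem sum_rhombusTerm (A B C : ℕ → Fin n → F)
    (h : ∀ p q r, p + q + r = n → tripleDet A B C p q r ≠ 0) :
    ∑ t ∈ triples n, rhombusTerm A B C t.1 t.2.1 t.2.2
      = flagPotential A C - flagPotential A B := by
  rw [sum_triples n (rhombusTerm A B C), flagPotential, flagPotential, ← Finset.sum_sub_distrib]
  refine Finset.sum_congr rfl fun p hp => ?_
  rw [Finset.mem_range] at hp
  let u : ℕ → F := fun q =>
    skipDet A B C p q (n - 1 - p - q) / tripleDet A B C (p + 1) q (n - 1 - p - q)
  have hu : ∀ q ∈ Finset.range (n - 1 - p),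
      rhombusTerm A B C p q (n - 2 - p - q) = -(u (q + 1) - u q) := by
    intro q hq
    rw [Finset.mem_range] at hq
    have h1 := h (p + 1) (q + 1) (n - 2 - p - q) (by omega)
    have h2 := h (p + 1) q (n - 2 - p - q + 1) (by omega)
    have e1 : n - 1 - p - (q + 1) = n - 2 - p - q := by omega
    have e2 : n - 1 - p - q = n - 2 - p - q + 1 := by omega
    simp only [u, rhombusTerm]
    rw [tripleDet_mul_tripleDet A B C (by omega), e1, e2]
    field_simp
    ring
  rw [Finset.sum_congr rfl hu, Finset.sum_neg_distrib, Finset.sum_range_sub]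
  simp [u, skipDet, tripleDet]

/-- The signs of the cyclic rotations have the same total parity in numerator and denominator. Thus
the rhombi at the second flag are written with the determinants of the original order of flags. -/
theorem rhombusTerm_rotate (A B C : ℕ → Fin n → F) {p q r : ℕ} (h : p + q + r + 2 = n) :
    rhombusTerm B C A q r p
      = tripleDet A B C p (q + 2) r * tripleDet A B C (p + 1) q (r + 1)
        / (tripleDet A B C (p + 1) (q + 1) r * tripleDet A B C p (q + 1) (r + 1)) := by
  rw [rhombusTerm, tripleDet_rotate A B C (p := p) (by omega),
    tripleDet_rotate A B C (p := p + 1) (q := q) (by omega),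
    tripleDet_rotate A B C (p := p + 1) (q := q + 1) (by omega),
    tripleDet_rotate A B C (p := p) (q := q + 1) (by omega)]
  rw [mul_mul_mul_comm ((-1) ^ (p * (q + 2 + r))), mul_mul_mul_comm ((-1) ^ ((p + 1) * (q + 1 + r))),
    ← pow_add, ← pow_add]
  have : p * (q + 2 + r) + (p + 1) * (q + (r + 1))
      = (p + 1) * (q + 1 + r) + p * (q + 1 + (r + 1)) := by ring
  rw [this, mul_div_mul_left _ _ (pow_ne_zero _ (neg_ne_zero.mpr one_ne_zero)),
    mul_comm (tripleDet B C A (q + 1) r (p + 1))]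

/-- Numerator and denominator of every summand acquire the same factor `g.det`. -/
theorem flagPotential_mulVec (g : Matrix (Fin n) (Fin n) F) (hg : g.det ≠ 0)
    (A B : ℕ → Fin n → F) :
    flagPotential (fun c => g.mulVec (A c)) (fun c => g.mulVec (B c)) = flagPotential A B := by
  have hc : ∀ (A : ℕ → Fin n → F) p, cols (fun c => g.mulVec (A c)) p = (cols A p).map g.mulVec :=
    fun A p => by simp [cols]
  refine Finset.sum_congr rfl fun p _ => ?_
  rw [hc, hc, hc, ← List.map_singleton, ← List.map_append, ← List.map_append, ← List.map_append,
    listDet_map_mulVec, listDet_map_mulVec, mul_div_mul_left _ _ hg]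

/-- The columns of a matrix, as a sequence. -/
def colSeq (g : Matrix (Fin n) (Fin n) R) (c : ℕ) : Fin n → R :=
  fun r => if h : c < n then g r ⟨c, h⟩ else 0

theorem colSeq_of_lt (g : Matrix (Fin n) (Fin n) R) {c : ℕ} (h : c < n) (r : Fin n) :
    colSeq g c r = g r ⟨c, h⟩ := dif_pos h

theorem colSeq_mul (g h : Matrix (Fin n) (Fin n) R) :
    colSeq (g * h) = fun c => g.mulVec (colSeq h c) := by
  funext c r
  by_cases hc : c < n
  · simp [colSeq, hc, Matrix.mul_apply, Matrix.mulVec, dotProduct]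
  · simp [colSeq, hc, Matrix.mulVec, dotProduct]

/-- The leading standard basis columns make the matrix block upper triangular with an identity
block, leaving the minor on the bottom rows. -/
theorem listDet_colSeq_one {p m : ℕ} (h : p + m = n) (l : List (Fin n → R)) :
    listDet (cols (colSeq 1) p ++ l)
      = (Matrix.of fun a c : Fin m => l.getD c 0 ⟨p + a, by omega⟩).det := by
  subst h
  rw [listDet, ← Matrix.det_submatrix_equiv_self finSumFinEquiv]
  have : (Matrix.of fun r c : Fin (p + m) =>
        (cols (colSeq 1) p ++ l).getD c 0 r).submatrix finSumFinEquiv finSumFinEquiv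
      = Matrix.fromBlocks 1 (Matrix.of fun (a : Fin p) (c : Fin m) => l.getD c 0 (Fin.castAdd m a)) 0
        (Matrix.of fun a c : Fin m => l.getD c 0 (Fin.natAdd p a)) := by
    ext r c
    rcases c with c | c
    · have hc : ((Fin.castAdd m c : Fin (p + m)) : ℕ) < (cols (colSeq (1 : Matrix (Fin (p + m)) (Fin (p + m)) R)) p).length
          := by simp
      have hc' : (c : ℕ) < p + m := by omega
      have e : (⟨c, hc'⟩ : Fin (p + m)) = Fin.castAdd m c := rfl
      rcases r with r | r
      · simp only [Matrix.submatrix_apply, finSumFinEquiv_apply_left, Matrix.of_apply,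
          Matrix.fromBlocks_apply₁₁]
        rw [List.getD_append _ _ _ _ hc, Fin.val_castAdd, getD_cols _ c.2, colSeq, dif_pos hc', e]
        simp [Matrix.one_apply, Fin.ext_iff]
      · simp only [Matrix.submatrix_apply, finSumFinEquiv_apply_left, finSumFinEquiv_apply_right,
          Matrix.of_apply, Matrix.fromBlocks_apply₂₁]
        rw [List.getD_append _ _ _ _ hc, Fin.val_castAdd, getD_cols _ c.2, colSeq, dif_pos hc', e,
          Matrix.one_apply_ne]
        · rfl
        · simp only [ne_eq, Fin.ext_iff, Fin.val_natAdd, Fin.val_castAdd]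
          omega
    · have hc : (cols (colSeq (1 : Matrix (Fin (p + m)) (Fin (p + m)) R)) p).length
          ≤ ((Fin.natAdd p c : Fin (p + m)) : ℕ) := by simp
      rcases r with r | r
      · simp only [Matrix.submatrix_apply, finSumFinEquiv_apply_left, finSumFinEquiv_apply_right,
          Matrix.of_apply, Matrix.fromBlocks_apply₁₂]
        rw [List.getD_append_right _ _ _ _ hc]
        simp
      · simp only [Matrix.submatrix_apply, finSumFinEquiv_apply_right,
          Matrix.of_apply, Matrix.fromBlocks_apply₂₂]
        rw [List.getD_append_right _ _ _ _ hc]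
        simp
  rw [this, Matrix.det_fromBlocks_zero₂₁, Matrix.det_one, one_mul]
  rfl

end Flags

/-! ### Minors -/

section Minors

variable {R : Type} [CommRing R]

/-- Increasing enumerations are unique, so any explicit one may replace those in the definition of
`minor`. -/
theorem minor_image {p q : Type} [LinearOrder p] [LinearOrder q] (A : Matrix p q R) {m : ℕ}
    {e : Fin m → p} {f : Fin m → q} (he : StrictMono e) (hf : StrictMono f) :
    minor A (Finset.univ.image e) (Finset.univ.image f) = (A.submatrix e f).det := by
  have hI : (Finset.univ.image e).card = m := by
    rw [Finset.card_image_of_injective _ he.injective, Finset.card_univ, Fintype.card_fin]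
  have hJ : (Finset.univ.image f).card = m := by
    rw [Finset.card_image_of_injective _ hf.injective, Finset.card_univ, Fintype.card_fin]
  generalize hI' : Finset.univ.image e = I at *
  generalize hJ' : Finset.univ.image f = J at *
  subst hI
  rw [minor, dif_pos hJ]
  rw [← Finset.orderEmbOfFin_unique (s := I) rfl
    (fun x => by rw [← hI']; exact Finset.mem_image_of_mem _ (Finset.mem_univ _)) he,
    ← Finset.orderEmbOfFin_unique hJ
    (fun x => by rw [← hJ']; exact Finset.mem_image_of_mem _ (Finset.mem_univ _)) hf]

theorem interval_eq_image {n m p : ℕ} (h : p + m ≤ n) :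
    interval n p m = Finset.univ.image fun a : Fin m => (⟨p + a, by omega⟩ : Fin n) := by
  ext x
  simp only [interval, Finset.mem_filter, Finset.mem_univ, true_and, Finset.mem_image]
  constructor
  · intro hx
    exact ⟨⟨x - p, by omega⟩, Fin.ext (by simp only; omega)⟩
  · rintro ⟨a, rfl⟩
    simp only
    omega

theorem op_interval_eq_image {n m p : ℕ} (h : p + m = n) :
    op (interval n 0 m) = Finset.univ.image fun a : Fin m => (⟨p + a, by omega⟩ : Fin n) := by
  ext x
  simp only [op, interval, Finset.mem_filter, Finset.mem_univ, true_and, Finset.mem_image]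
  constructor
  · rintro ⟨y, hy, rfl⟩
    exact ⟨⟨m - 1 - y, by omega⟩, Fin.ext (by simp only [Fin.val_rev]; omega)⟩
  · rintro ⟨a, rfl⟩
    exact ⟨⟨m - 1 - a, by omega⟩, by simp only; omega,
      Fin.ext (by simp only [Fin.val_rev]; omega)⟩

theorem gapInterval_eq_image {n m : ℕ} (h : m + 2 ≤ n) :
    gapInterval n (m + 1) = Finset.univ.image
      fun a : Fin (m + 1) => (⟨if (a : ℕ) < m then a else m + 1, by split_ifs <;> omega⟩ : Fin n) := by
  ext x
  simp only [gapInterval, interval, Finset.mem_filter, Finset.mem_univ, true_and, Finset.mem_image]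
  constructor
  · intro hx
    by_cases hxm : (x : ℕ) < m
    · exact ⟨⟨x, by omega⟩, Fin.ext (by simp only [hxm, if_true])⟩
    · exact ⟨⟨m, by omega⟩, Fin.ext (by simp only [lt_irrefl, if_false]; omega)⟩
  · rintro ⟨a, rfl⟩
    simp only
    split_ifs <;> omega

theorem op_gapInterval_eq_image {n m p : ℕ} (h : p + m + 2 = n) :
    op (gapInterval n (m + 1)) = Finset.univ.image
      fun a : Fin (m + 1) => (⟨if (a : ℕ) = 0 then p else p + 1 + a, by split_ifs <;> omega⟩ : Fin n) := by
  ext x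
  simp only [op, gapInterval, interval, Finset.mem_filter, Finset.mem_univ, true_and,
    Finset.mem_image]
  constructor
  · rintro ⟨y, hy, rfl⟩
    by_cases hy' : (y : ℕ) = m + 1
    · exact ⟨⟨0, by omega⟩, Fin.ext (by simp only [Fin.val_rev, if_true]; omega)⟩
    · exact ⟨⟨m - y, by omega⟩, Fin.ext (by
        simp only [Fin.val_rev]; split_ifs <;> omega)⟩
  · rintro ⟨a, rfl⟩
    by_cases ha : (a : ℕ) = 0
    · exact ⟨⟨m + 1, by omega⟩, by simp only; omega,
        Fin.ext (by simp only [Fin.val_rev, ha, if_true]; omega)⟩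
    · exact ⟨⟨m - a, by omega⟩, by simp only; omega,
        Fin.ext (by simp only [Fin.val_rev, ha, if_false]; omega)⟩

theorem minor_op_interval_interval {n m p : ℕ} (h : p + m = n) (g : Matrix (Fin n) (Fin n) R) :
    minor g (op (interval n 0 m)) (interval n 0 m)
      = listDet (cols (colSeq 1) p ++ cols (colSeq g) m) := by
  rw [op_interval_eq_image h, interval_eq_image (by omega), minor_image,
    listDet_colSeq_one h]
  · congr 1
    ext a c
    simp only [Matrix.submatrix_apply, Matrix.of_apply]
    rw [getD_cols _ c.2, colSeq_of_lt g (by omega)]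
    simp
  all_goals
    intro a b hab
    simpa using hab

theorem minor_op_interval_gapInterval {n m p : ℕ} (h : p + m + 2 = n)
    (g : Matrix (Fin n) (Fin n) R) :
    minor g (op (interval n 0 (m + 1))) (gapInterval n (m + 1))
      = listDet (cols (colSeq 1) (p + 1) ++ (cols (colSeq g) m ++ [colSeq g (m + 1)])) := by
  rw [op_interval_eq_image (p := p + 1) (by omega), gapInterval_eq_image (by omega), minor_image,
    listDet_colSeq_one (m := m + 1) (by omega)]
  · congr 1
    ext a c
    simp only [Matrix.submatrix_apply, Matrix.of_apply]
    by_cases hc : (c : ℕ) < m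
    · rw [List.getD_append _ _ _ _ (by simpa using hc), getD_cols _ hc, colSeq_of_lt g (by omega)]
      simp [hc]
    · have hc' : (c : ℕ) = m := by omega
      rw [List.getD_append_right _ _ _ _ (by simp [hc'])]
      simp only [length_cols, hc', Nat.sub_self, List.getD_cons_zero]
      rw [colSeq_of_lt g (by omega)]
      simp
  · intro a b hab
    simpa using hab
  · intro a b hab
    have : (a : ℕ) < b := hab
    simp only [Fin.mk_lt_mk]
    split_ifs <;> omega

theorem listDet_map_comp_swap {n : ℕ} {p q : Fin n} (hpq : p ≠ q) (l : List (Fin n → R)) :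
    listDet (l.map fun v => v ∘ Equiv.swap p q) = -listDet l := by
  have : (Matrix.of fun r c : Fin n => (l.map fun v => v ∘ Equiv.swap p q).getD c 0 r)
      = (Matrix.of fun r c : Fin n => l.getD c 0 r).submatrix (Equiv.swap p q) id := by
    ext r c
    simp only [Matrix.of_apply, Matrix.submatrix_apply, id]
    rw [show (0 : Fin n → R) = (fun v : Fin n → R => v ∘ Equiv.swap p q) 0 from rfl, List.getD_map]
    rfl
  rw [listDet, this, Matrix.det_permute, Equiv.Perm.sign_swap hpq]
  simp [listDet]

/-- Exchanging rows `p` and `p + 1` turns the skipped basis column into the regular one, and the gap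
moves into the row set. The exchange accounts for the minus sign. -/
theorem minor_op_gapInterval_interval {n m p : ℕ} (h : p + m + 2 = n)
    (g : Matrix (Fin n) (Fin n) R) :
    minor g (op (gapInterval n (m + 1))) (interval n 0 (m + 1))
      = -listDet (cols (colSeq 1) p ++ [colSeq 1 (p + 1)] ++ cols (colSeq g) (m + 1)) := by
  have hpq : (⟨p, by omega⟩ : Fin n) ≠ ⟨p + 1, by omega⟩ := by simp
  rw [← listDet_map_comp_swap hpq, List.map_append, List.map_append, List.map_singleton]
  have e1 : (cols (colSeq (1 : Matrix (Fin n) (Fin n) R)) p).map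
      (fun v => v ∘ Equiv.swap (⟨p, by omega⟩ : Fin n) ⟨p + 1, by omega⟩)
      = cols (colSeq (1 : Matrix (Fin n) (Fin n) R)) p := by
    rw [cols, List.map_map]
    refine List.map_congr_left fun c hc => ?_
    rw [List.mem_range] at hc
    funext r
    have hc' : c < n := by omega
    simp only [Function.comp, colSeq, hc', dif_pos, Matrix.one_apply]
    congr 1
    rw [eq_iff_iff, ← Equiv.eq_symm_apply, Equiv.symm_swap,
      Equiv.swap_apply_of_ne_of_ne]
    · simp; omega
    · simp; omega
  have e2 : (colSeq (1 : Matrix (Fin n) (Fin n) R) (p + 1))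
      ∘ Equiv.swap (⟨p, by omega⟩ : Fin n) ⟨p + 1, by omega⟩ = colSeq 1 p := by
    funext r
    have hc' : p + 1 < n := by omega
    have hc : p < n := by omega
    simp only [Function.comp, colSeq, hc', hc, dif_pos, Matrix.one_apply]
    congr 1
    rw [eq_iff_iff, ← Equiv.eq_symm_apply, Equiv.symm_swap, Equiv.swap_apply_right]
  rw [e1, e2, ← cols_succ, op_gapInterval_eq_image h, interval_eq_image (by omega), minor_image,
    listDet_colSeq_one (m := m + 1) (by omega)]
  · congr 1
    ext a c
    rw [Matrix.of_apply, cols, List.map_map,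
      List.getD_eq_getElem _ _ (by simp; omega), List.getElem_map, List.getElem_range]
    simp only [Matrix.submatrix_apply, Function.comp]
    rw [colSeq_of_lt g (by omega)]
    by_cases ha : (a : ℕ) = 0
    · have : (⟨p + 1 + a, by omega⟩ : Fin n) = ⟨p + 1, by omega⟩ := by simp [ha]
      rw [this, Equiv.swap_apply_right]
      simp [ha]
    · rw [Equiv.swap_apply_of_ne_of_ne]
      · simp [ha]
      · simp; omega
      · simp [ha]
  · intro a b hab
    have : (a : ℕ) < b := hab
    simp only [Fin.mk_lt_mk]
    split_ifs <;> omega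
  · intro a b hab
    simpa using hab

end Minors

/-! ### The potential as a sum over rhombi -/

section Potential

variable {R : Type} [CommRing R] {F : Type} [Field F] {n k : ℕ}

/-- The minors with a gap in the columns form the part of the potential at the flag of `g`. Those
with a gap in the rows form the part at the standard flag, with a sign and with the order of
summation reversed. -/
theorem potentialBK_eq (g : Matrix (Fin n) (Fin n) F) :
    potentialBK g
      = flagPotential (colSeq g) (colSeq 1) - flagPotential (colSeq 1) (colSeq g) := by
  have hI : Finset.Icc 1 (n - 1) = (Finset.range (n - 1)).image (· + 1) := by
    ext x
    simp only [Finset.mem_Icc, Finset.mem_image, Finset.mem_range]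
    constructor
    · intro h
      exact ⟨x - 1, by omega, by omega⟩
    · rintro ⟨y, hy, rfl⟩
      omega
  rw [potentialBK, hI, Finset.sum_image (fun a _ b _ h => by simpa using h)]
  simp_rw [add_div]
  rw [Finset.sum_add_distrib, add_comm, sub_eq_add_neg]
  congr 1
  · refine Finset.sum_congr rfl fun p hp => ?_
    rw [Finset.mem_range] at hp
    rw [minor_op_interval_gapInterval (p := n - 2 - p) (by omega),
      minor_op_interval_interval (p := n - 1 - p) (by omega),
      show n - 2 - p + 1 = n - 1 - p by omega,
      listDet_rotate _ _ (by simp; omega), listDet_rotate (cols (colSeq 1) (n - 1 - p)) _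
        (by simp; omega)]
    simp only [List.length_append, length_cols, List.length_singleton]
    rw [mul_div_mul_left _ _ (pow_ne_zero _ (neg_ne_zero.mpr one_ne_zero))]
  · rw [flagPotential, ← Finset.sum_range_reflect, ← Finset.sum_neg_distrib]
    refine Finset.sum_congr rfl fun p hp => ?_
    rw [Finset.mem_range] at hp
    rw [minor_op_gapInterval_interval (p := p) (by omega),
      minor_op_interval_interval (p := p + 1) (by omega), neg_div,
      show n - 1 - 1 - p + 1 = n - 1 - p by omega]

theorem rhombusTerm_rotate' (A B C : ℕ → Fin n → F) {p q r : ℕ} (h : p + q + r + 2 = n) :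
    rhombusTerm C A B r p q
      = tripleDet A B C p q (r + 2) * tripleDet A B C (p + 1) (q + 1) r
        / (tripleDet A B C (p + 1) q (r + 1) * tripleDet A B C p (q + 1) (r + 1)) := by
  rw [rhombusTerm, tripleDet_rotate C A B (p := r) (by omega),
    tripleDet_rotate C A B (p := r + 2) (by omega),
    tripleDet_rotate C A B (p := r + 1) (q := p) (by omega),
    tripleDet_rotate C A B (p := r + 1) (q := p + 1) (by omega)]
  rw [mul_mul_mul_comm ((-1) ^ ((r + 2) * (p + q))),
    mul_mul_mul_comm ((-1) ^ ((r + 1) * (p + 1 + q))), ← pow_add, ← pow_add,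
    Even.neg_one_pow ⟨r * (p + q) + p + q + r, by ring⟩,
    Even.neg_one_pow ⟨(r + 1) * (p + q + 1), by ring⟩, one_mul, one_mul]

/-- The three orientations contribute the differences of flag potentials at each of the flags 1, g
and gh. The pairs (1, g) and (1, gh) give the potentials of `g` and `g * h`; the pair (g, gh) is the
translate by `g` of (1, h) and gives that of `h`. -/
theorem potentialBK_add_sub_mul (g h : Matrix (Fin n) (Fin n) F) (hg : g.det ≠ 0)
    (hT : ∀ p q r, p + q + r = n →
      tripleDet (colSeq 1) (colSeq g) (colSeq (g * h)) p q r ≠ 0) :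
    potentialBK g + potentialBK h - potentialBK (g * h)
      = ∑ t ∈ triples n,
        (rhombusTerm (colSeq 1) (colSeq g) (colSeq (g * h)) t.1 t.2.1 t.2.2
          + rhombusTerm (colSeq (g * h)) (colSeq 1) (colSeq g) t.2.2 t.1 t.2.1
          + rhombusTerm (colSeq g) (colSeq (g * h)) (colSeq 1) t.2.1 t.2.2 t.1) := by
  rw [Finset.sum_add_distrib, Finset.sum_add_distrib]
  have r1 := sum_triples_rotate n (rhombusTerm (colSeq g) (colSeq (g * h)) (colSeq 1))
  have r2 := sum_triples_rotate n (rhombusTerm (colSeq (g * h)) (colSeq 1) (colSeq g))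
  have r3 := sum_triples_rotate n
    (fun p q r => rhombusTerm (colSeq (g * h)) (colSeq 1) (colSeq g) q r p)
  rw [r1, r3, r2, sum_rhombusTerm _ _ _ hT, sum_rhombusTerm, sum_rhombusTerm]
  · have e1 : flagPotential (colSeq h) (colSeq 1)
        = flagPotential (colSeq (g * h)) (colSeq g) := by
      rw [← flagPotential_mulVec g hg, ← colSeq_mul, ← colSeq_mul, Matrix.mul_one]
    have e2 : flagPotential (colSeq 1) (colSeq h)
        = flagPotential (colSeq g) (colSeq (g * h)) := by
      rw [← flagPotential_mulVec g hg, ← colSeq_mul, ← colSeq_mul, Matrix.mul_one]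
    rw [potentialBK_eq, potentialBK_eq, potentialBK_eq, e1, e2]
    ring
  · intro p q r hpqr h0
    apply hT r p q (by omega)
    rw [tripleDet_rotate _ _ _ (by omega), h0, mul_zero]
  · intro p q r hpqr h0
    apply hT q r p (by omega)
    rw [tripleDet_rotate _ _ _ (by omega), tripleDet_rotate _ _ _ (by omega), h0, mul_zero,
      mul_zero]

/-! ### Multi-corner minors on the faces -/

theorem sum_facePoint {l i j : ℕ} (hl : l + 2 ≤ k) : ∑ m, facePoint k l i j m = i + j := by
  have hne : (⟨l, by omega⟩ : Fin k) ≠ ⟨l + 1, by omega⟩ := by simp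
  rw [Finset.sum_eq_add_of_mem (⟨l, by omega⟩ : Fin k) ⟨l + 1, by omega⟩ (Finset.mem_univ _)
    (Finset.mem_univ _) hne]
  · simp [facePoint]
  · rintro c _ ⟨h1, h2⟩
    have h1' : (c : ℕ) ≠ l := fun h => h1 (Fin.ext h)
    have h2' : (c : ℕ) ≠ l + 1 := fun h => h2 (Fin.ext h)
    simp [facePoint, h1', h2']

theorem cornerMinor_facePoint (g : Fin k → Matrix (Fin n) (Fin n) R) {l i j : ℕ}
    (hl : l + 2 ≤ k) (hij : i + j ≤ n) :
    cornerMinor g (facePoint k l i j)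
      = tripleDet (colSeq 1) (colSeq (Fin.partialProd g ⟨l + 1, by omega⟩))
          (colSeq (Fin.partialProd g ⟨l + 2, by omega⟩)) (n - (i + j)) i j := by
  -- The increasing enumeration of the column set: only the blocks 0, `l + 1` and `l + 2`
  -- contribute.
  let e : Fin n → Fin (k + 1) ×ₗ Fin n := fun c =>
    if (c : ℕ) < n - (i + j) then toLex (⟨0, by omega⟩, c)
    else if (c : ℕ) < n - j then
      toLex (⟨l + 1, by omega⟩, ⟨(c : ℕ) - (n - (i + j)), by omega⟩)
    else toLex (⟨l + 2, by omega⟩, ⟨(c : ℕ) - (n - j), by omega⟩)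
  have he : StrictMono e := by
    intro a b hab
    have hab' : (a : ℕ) < b := hab
    simp only [e]
    split_ifs <;> simp only [Prod.Lex.toLex_lt_toLex, Fin.lt_def, Fin.ext_iff, true_and] <;> omega
  have hset : columnSet (n := n) (facePoint k l i j) = Finset.univ.image e := by
    ext x
    obtain ⟨⟨t, c⟩, rfl⟩ := toLex.surjective x
    simp only [columnSet, Finset.mem_filter, Finset.mem_univ, true_and, ofLex_toLex,
      Finset.mem_image, sum_facePoint hl]
    constructor
    · intro hc
      induction t using Fin.cases with
      | zero =>
        rw [Fin.cons_zero] at hc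
        exact ⟨c, by simp [e, hc]⟩
      | succ t =>
        rw [Fin.cons_succ, facePoint] at hc
        split_ifs at hc with h1 h2
        · refine ⟨⟨n - (i + j) + c, by omega⟩, ?_⟩
          simp only [e]
          rw [if_neg (by omega), if_pos (by omega)]
          congr 2
          · exact Fin.ext (by simp [h1])
          · exact Fin.ext (by simp)
        · refine ⟨⟨n - j + c, by omega⟩, ?_⟩
          simp only [e]
          rw [if_neg (by omega), if_neg (by omega)]
          congr 2
          · exact Fin.ext (by simp [h2])
          · exact Fin.ext (by simp)
        · omega
    · rintro ⟨a, ha⟩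
      simp only [e] at ha
      split_ifs at ha with h1 h2
      · obtain ⟨rfl, rfl⟩ := Prod.mk.inj (toLex.injective ha)
        exact h1
      · obtain ⟨rfl, rfl⟩ := Prod.mk.inj (toLex.injective ha)
        rw [show (⟨l + 1, by omega⟩ : Fin (k + 1)) = Fin.succ ⟨l, by omega⟩ from rfl, Fin.cons_succ,
          facePoint]
        simp only [if_true]
        omega
      · obtain ⟨rfl, rfl⟩ := Prod.mk.inj (toLex.injective ha)
        rw [show (⟨l + 2, by omega⟩ : Fin (k + 1)) = Fin.succ ⟨l + 1, by omega⟩ from rfl,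
          Fin.cons_succ, facePoint]
        simp
        omega
  have hminor := minor_image (blockRow g) strictMono_id he
  rw [Finset.image_id] at hminor
  rw [cornerMinor, hset, hminor, tripleDet, listDet]
  congr 1
  ext r c
  simp only [Matrix.submatrix_apply, Matrix.of_apply, id, e, blockRow]
  split_ifs with h1 h2
  · rw [List.append_assoc, List.getD_append _ _ _ _ (by simpa using h1), getD_cols _ h1,
      colSeq_of_lt _ c.2]
    simp only [ofLex_toLex]
    exact congrFun (congrFun (Fin.partialProd_zero g) r) c
  · rw [List.getD_append _ _ _ _ (by simp; omega),
      List.getD_append_right _ _ _ _ (by simp; omega), length_cols, getD_cols _ (by omega),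
      colSeq_of_lt _ (by omega)]
    rfl
  · rw [List.getD_append_right _ _ _ _ (by simp; omega), List.length_append, length_cols,
      length_cols, show n - (i + j) + i = n - j by omega, getD_cols _ (by omega),
      colSeq_of_lt _ (by omega)]
    rfl

/-- The index set of the small rhombi: a face, a position and an orientation. -/
def rhombusIndex (n k : ℕ) : Finset (ℕ × (ℕ × ℕ × ℕ) × Fin 3) :=
  Finset.range (k - 1) ×ˢ triples n ×ˢ Finset.univ

/-- The corners of a small rhombus. -/
def rhombusCorner (k : ℕ) (s : ℕ × (ℕ × ℕ × ℕ) × Fin 3) : Fin 4 → Fin k → ℕ :=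
  let P := facePoint k s.1
  let i := s.2.1.2.1
  let j := s.2.1.2.2
  ![![P i j, P (i + 1) j, P (i + 1) (j + 1), P i (j + 1)],
    ![P i (j + 2), P (i + 1) (j + 1), P (i + 1) j, P i (j + 1)],
    ![P (i + 2) j, P (i + 1) (j + 1), P i (j + 1), P (i + 1) j]] s.2.2

theorem mem_rhombusIndex {s : ℕ × (ℕ × ℕ × ℕ) × Fin 3} :
    s ∈ rhombusIndex n k ↔ s.1 + 2 ≤ k ∧ s.2.1.1 + s.2.1.2.1 + s.2.1.2.2 + 2 = n := by
  simp only [rhombusIndex, Finset.mem_product, Finset.mem_range, mem_triples, Finset.mem_univ,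
    and_true]
  omega

theorem isFaceRhombus_iff {α₁ α₂ α₃ α₄ : Fin k → ℕ} :
    IsFaceRhombus n k α₁ α₂ α₃ α₄ ↔ ∃ s ∈ rhombusIndex n k, rhombusCorner k s 0 = α₁ ∧
      rhombusCorner k s 1 = α₂ ∧ rhombusCorner k s 2 = α₃ ∧ rhombusCorner k s 3 = α₄ := by
  constructor
  · rintro (⟨l, i, j, hl, h⟩ | ⟨l, i, j, hl, h⟩ | ⟨l, i, j, hl, h⟩)
    · exact ⟨(l, (n - 2 - i - j, i, j), 0), mem_rhombusIndex.mpr ⟨hl, by simp only; omega⟩,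
        rfl, rfl, rfl, rfl⟩
    · exact ⟨(l, (n - 2 - i - j, i, j), 1), mem_rhombusIndex.mpr ⟨hl, by simp only; omega⟩,
        rfl, rfl, rfl, rfl⟩
    · exact ⟨(l, (n - 2 - i - j, i, j), 2), mem_rhombusIndex.mpr ⟨hl, by simp only; omega⟩,
        rfl, rfl, rfl, rfl⟩
  · rintro ⟨⟨l, ⟨p, i, j⟩, s⟩, hs, rfl, rfl, rfl, rfl⟩
    obtain ⟨hl, h⟩ := mem_rhombusIndex.mp hs
    simp only at hl h
    fin_cases s
    · exact .type1 l i j hl (by omega)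
    · exact .type2 l i j hl (by omega)
    · exact .type3 l i j hl (by omega)

theorem exists_facePoint_eq_rhombusCorner {s : ℕ × (ℕ × ℕ × ℕ) × Fin 3}
    (hs : s ∈ rhombusIndex n k) (a : Fin 4) :
    ∃ l i j, l + 2 ≤ k ∧ i + j ≤ n ∧ rhombusCorner k s a = facePoint k l i j := by
  obtain ⟨l, ⟨p, i, j⟩, s⟩ := s
  obtain ⟨hl, h⟩ := mem_rhombusIndex.mp hs
  simp only at hl h
  fin_cases s <;> fin_cases a <;> refine ⟨l, _, _, hl, ?_, rfl⟩ <;> simp only <;> omega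

theorem partialProd_succ_nat {M : Type*} [Monoid M] (g : Fin k → M) {t : ℕ} (ht : t < k) :
    Fin.partialProd g ⟨t + 1, by omega⟩ = Fin.partialProd g ⟨t, by omega⟩ * g ⟨t, ht⟩ :=
  Fin.partialProd_succ g ⟨t, ht⟩

/-- The potentials of the partial products telescope, from that of the first matrix to that of the
full product. -/
theorem potential_eq_sum_potentialBK (hk : 0 < k) (g : Fin k → Matrix (Fin n) (Fin n) F) :
    potential g = ∑ l : Fin (k - 1),
      (potentialBK (Fin.partialProd g ⟨l + 1, by omega⟩) + potentialBK (g ⟨l + 1, by omega⟩)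
        - potentialBK (Fin.partialProd g ⟨l + 2, by omega⟩)) := by
  obtain ⟨k, rfl⟩ : ∃ k', k = k' + 1 := ⟨k - 1, by omega⟩
  let φ : ℕ → F := fun t =>
    if h : t < k + 2 then potentialBK (Fin.partialProd g ⟨t, h⟩) else 0
  have h1 : ∑ l : Fin k, (φ (l + 1) - φ (l + 2)) = φ 1 - φ (k + 1) := by
    rw [Fin.sum_univ_eq_sum_range (fun l => φ (l + 1) - φ (l + 2)) k]
    exact Finset.sum_range_sub' (fun l => φ (l + 1)) k
  have h2 : φ 1 = potentialBK (g 0) := by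
    simp only [φ]
    rw [dif_pos (by omega), partialProd_succ_nat g (t := 0) (by omega)]
    have : Fin.partialProd g ⟨0, by omega⟩ = 1 := Fin.partialProd_zero g
    rw [this, one_mul]
    rfl
  have h3 : φ (k + 1) = potentialBK (Fin.partialProd g (Fin.last (k + 1))) := by
    simp only [φ]
    rw [dif_pos (by omega)]
    rfl
  rw [potential, Fin.sum_univ_succ, ← h2, ← h3]
  have h4 : ∀ l : Fin k, potentialBK (Fin.partialProd g ⟨l + 1, by omega⟩)
        + potentialBK (g ⟨l + 1, by omega⟩) - potentialBK (Fin.partialProd g ⟨l + 2, by omega⟩)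
      = potentialBK (g l.succ) + (φ (l + 1) - φ (l + 2)) := by
    intro l
    simp only [φ]
    rw [dif_pos (by omega), dif_pos (by omega)]
    have : (⟨l + 1, by omega⟩ : Fin (k + 1)) = l.succ := rfl
    rw [this]
    ring
  calc _ = ∑ l : Fin k, (potentialBK (g l.succ) + (φ (l + 1) - φ (l + 2))) := by
        rw [Finset.sum_add_distrib, h1]
        ring
    _ = _ := (Finset.sum_congr rfl fun l _ => h4 l).symm

/-- The potential is the sum over all small rhombi of the quotients of the products of the
multi-corner minors at the ends of the two diagonals. -/
theorem potential_eq_sum_rhombusIndex (hk : 0 < k) (g : Fin k → Matrix (Fin n) (Fin n) F)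
    (hM : ∀ l i j, l + 2 ≤ k → i + j ≤ n → cornerMinor g (facePoint k l i j) ≠ 0) :
    potential g = ∑ s ∈ rhombusIndex n k,
      cornerMinor g (rhombusCorner k s 0) * cornerMinor g (rhombusCorner k s 2)
        / (cornerMinor g (rhombusCorner k s 1) * cornerMinor g (rhombusCorner k s 3)) := by
  rw [potential_eq_sum_potentialBK hk, rhombusIndex, Finset.sum_product,
    Finset.sum_range]
  refine Finset.sum_congr rfl fun l _ => ?_
  have hl : (l : ℕ) + 2 ≤ k := by omega
  have hprod := partialProd_succ_nat g (t := l + 1) (by omega)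
  have hT : ∀ p q r, p + q + r = n →
      tripleDet (colSeq 1) (colSeq (Fin.partialProd g ⟨l + 1, by omega⟩))
        (colSeq (Fin.partialProd g ⟨l + 2, by omega⟩)) p q r
        = cornerMinor g (facePoint k l q r) := by
    intro p q r h
    rw [cornerMinor_facePoint g hl (by omega), show n - (q + r) = p by omega]
  -- At the vertex `(n, 0)` of the face the multi-corner minor is this determinant.
  have hdet : (Fin.partialProd g ⟨l + 1, by omega⟩).det ≠ 0 := by
    have h0 := hM l n 0 hl (by omega)
    rw [← hT 0 n 0 (by omega), tripleDet] at h0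
    have : listDet (cols (colSeq (Fin.partialProd g ⟨l + 1, by omega⟩)) n)
        = (Fin.partialProd g ⟨l + 1, by omega⟩).det := by
      rw [listDet]
      congr 1
      ext r c
      rw [Matrix.of_apply, getD_cols _ c.2, colSeq_of_lt _ c.2]
    rw [← this]
    simpa using h0
  rw [hprod] at hT ⊢
  rw [potentialBK_add_sub_mul _ _ hdet (fun p q r h => by
    rw [hT p q r h]; exact hM l q r hl (by omega)), Finset.sum_product]
  refine Finset.sum_congr rfl fun t ht => ?_
  obtain ⟨p, q, r⟩ := t
  rw [mem_triples] at ht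
  simp only at ht
  simp only
  rw [Fin.sum_univ_three, rhombusTerm_rotate _ _ _ ht, rhombusTerm_rotate' _ _ _ ht, rhombusTerm,
    hT _ _ _ (by omega), hT _ _ _ (by omega), hT _ _ _ (by omega), hT _ _ _ (by omega),
    hT _ _ _ (by omega), hT _ _ _ (by omega)]
  simp only [rhombusCorner, Matrix.cons_val]
  ring

end Potential

/-! ### Positive functions and their tropicalizations -/

section Positive

variable {K : Type} [Field K] [Algebra ℂ K] {ι : Type} {y : ι → K}

theorem IsPositive.mul {f g : K} (hf : IsPositive y f) (hg : IsPositive y g) :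
    IsPositive y (f * g) := by
  obtain ⟨P, Q, hQ, rfl⟩ := hf
  obtain ⟨P', Q', hQ', rfl⟩ := hg
  exact ⟨P * P', Q * Q', by rw [map_mul]; exact mul_ne_zero hQ hQ',
    by rw [map_mul, map_mul, div_mul_div_comm]⟩

theorem IsPositive.add {f g : K} (hf : IsPositive y f) (hg : IsPositive y g) :
    IsPositive y (f + g) := by
  obtain ⟨P, Q, hQ, rfl⟩ := hf
  obtain ⟨P', Q', hQ', rfl⟩ := hg
  exact ⟨P * Q' + Q * P', Q * Q', by rw [map_mul]; exact mul_ne_zero hQ hQ',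
    by rw [div_add_div _ _ hQ hQ', map_add, map_mul, map_mul, map_mul]⟩

theorem IsPositive.inv {f : K} (hf : IsPositive y f) : IsPositive y f⁻¹ := by
  obtain ⟨P, Q, hQ, rfl⟩ := hf
  -- The inverse of zero is zero, which is positive with an empty numerator.
  by_cases hP : evalPoly y P = 0
  · exact ⟨0, 1, by simp, by simp [hP]⟩
  · exact ⟨Q, P, hP, by rw [inv_div]⟩

variable (y) in
theorem isPositive_evalPoly (P : MvPolynomial ι ℝ≥0) : IsPositive y (evalPoly y P) :=
  ⟨P, 1, by simp, by simp⟩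

variable (y) in
theorem isPositive_coord (s : ι) : IsPositive y (y s) := by
  simpa [evalPoly] using isPositive_evalPoly y (MvPolynomial.X s)

variable (y) in
/-- The subsemiring of positive functions. -/
def positiveFunctions : Subsemiring K where
  carrier := {f | IsPositive y f}
  mul_mem' := IsPositive.mul
  add_mem' := IsPositive.add
  one_mem' := by simpa using isPositive_evalPoly y 1
  zero_mem' := by simpa using isPositive_evalPoly y 0

theorem mem_positiveFunctions {f : K} : f ∈ positiveFunctions y ↔ IsPositive y f := Iff.rfl

theorem IsPositive.div {f g : K} (hf : IsPositive y f) (hg : IsPositive y g) :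
    IsPositive y (f / g) := by
  rw [div_eq_mul_inv]
  exact hf.mul hg.inv

/-- Nonnegative coefficients cannot cancel, so the support of a sum is the union of the supports. -/
theorem tropPoly_add (P Q : MvPolynomial ι ℝ≥0) (x : ι → ℝ) :
    tropPoly (P + Q) x = max (tropPoly P x) (tropPoly Q x) := by
  classical
  have : (P + Q).support = P.support ∪ Q.support := by
    ext a
    simp only [MvPolynomial.mem_support_iff, MvPolynomial.coeff_add, Finset.mem_union, ne_eq,
      add_eq_zero, not_and_or]
  rw [tropPoly, this, Finset.sup_union]
  rfl

/-- This replaces the subtraction by an addition, so that identities of tropical quotients follow by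
cancelling real summands. -/
theorem tropQuot_add_tropPoly {P Q : MvPolynomial ι ℝ≥0} (hQ : Q ≠ 0) (x : ι → ℝ) :
    tropQuot P Q x + tropPoly Q x = tropPoly P x := by
  obtain ⟨q, hq⟩ := tropPoly_ne_bot hQ x
  rw [tropQuot, hq]
  generalize tropPoly P x = p
  induction p using WithBot.recBotCoe with
  | bot => rfl
  | coe p => simp [← WithBot.coe_add]

theorem add_coe_inj {a b : WithBot ℝ} {r : ℝ} : a + r = b + r ↔ a = b := by
  induction a using WithBot.recBotCoe <;> induction b using WithBot.recBotCoe <;>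
    simp [← WithBot.coe_add]

theorem tropQuot_mul {P Q P' Q' : MvPolynomial ι ℝ≥0} (hQ : Q ≠ 0) (hQ' : Q' ≠ 0) (x : ι → ℝ) :
    tropQuot (P * P') (Q * Q') x = tropQuot P Q x + tropQuot P' Q' x := by
  have h := tropQuot_add_tropPoly (P := P * P') (mul_ne_zero hQ hQ') x
  have h1 := tropQuot_add_tropPoly (P := P) hQ x
  have h2 := tropQuot_add_tropPoly (P := P') hQ' x
  rw [tropPoly_mul, tropPoly_mul, ← h1, ← h2] at h
  obtain ⟨q, hq⟩ := tropPoly_ne_bot hQ x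
  obtain ⟨q', hq'⟩ := tropPoly_ne_bot hQ' x
  rw [hq, hq', add_add_add_comm, ← WithBot.coe_add] at h
  exact add_coe_inj.mp h

theorem tropQuot_add {P Q P' Q' : MvPolynomial ι ℝ≥0} (hQ : Q ≠ 0) (hQ' : Q' ≠ 0) (x : ι → ℝ) :
    tropQuot (P * Q' + Q * P') (Q * Q') x = max (tropQuot P Q x) (tropQuot P' Q' x) := by
  have h := tropQuot_add_tropPoly (P := P * Q' + Q * P') (mul_ne_zero hQ hQ') x
  have h1 := tropQuot_add_tropPoly (P := P) hQ x
  have h2 := tropQuot_add_tropPoly (P := P') hQ' x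
  rw [tropPoly_add, tropPoly_mul, tropPoly_mul, tropPoly_mul, ← h1, ← h2] at h
  obtain ⟨q, hq⟩ := tropPoly_ne_bot hQ x
  obtain ⟨q', hq'⟩ := tropPoly_ne_bot hQ' x
  have e : max (tropQuot P Q x + q + q') (q + (tropQuot P' Q' x + q'))
      = max (tropQuot P Q x) (tropQuot P' Q' x) + ((q + q' : ℝ) : WithBot ℝ) := by
    rw [max_add, WithBot.coe_add, add_assoc, add_left_comm (q : WithBot ℝ) (tropQuot P' Q' x)]
  rw [hq, hq', e, ← WithBot.coe_add] at h
  exact add_coe_inj.mp h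

theorem evalPoly_ne_zero_imp {Q : MvPolynomial ι ℝ≥0} (hQ : evalPoly y Q ≠ 0) : Q ≠ 0 :=
  fun h => hQ (by rw [h, map_zero])

variable (hy : AlgebraicIndependent ℂ y) (x : ι → ℝ)
include hy

theorem trop_mul {f g : K} (hf : IsPositive y f) (hg : IsPositive y g) :
    trop y (f * g) x = trop y f x + trop y g x := by
  obtain ⟨P, Q, hQ, rfl⟩ := hf
  obtain ⟨P', Q', hQ', rfl⟩ := hg
  rw [trop_eq hy _ _ hQ, trop_eq hy _ _ hQ', div_mul_div_comm, ← map_mul, ← map_mul,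
    trop_eq hy _ _ (by rw [map_mul]; exact mul_ne_zero hQ hQ'),
    tropQuot_mul (evalPoly_ne_zero_imp hQ) (evalPoly_ne_zero_imp hQ')]

theorem trop_add {f g : K} (hf : IsPositive y f) (hg : IsPositive y g) :
    trop y (f + g) x = max (trop y f x) (trop y g x) := by
  obtain ⟨P, Q, hQ, rfl⟩ := hf
  obtain ⟨P', Q', hQ', rfl⟩ := hg
  rw [trop_eq hy _ _ hQ, trop_eq hy _ _ hQ', div_add_div _ _ hQ hQ', ← map_mul, ← map_mul,
    ← map_mul, ← map_add,
    trop_eq hy _ _ (by rw [map_mul]; exact mul_ne_zero hQ hQ'),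
    tropQuot_add (evalPoly_ne_zero_imp hQ) (evalPoly_ne_zero_imp hQ')]

theorem trop_zero : trop y 0 x = ⊥ := by
  have := trop_eq hy 0 1 (by simp) x
  rw [map_zero, zero_div] at this
  rw [this]
  simp [tropQuot, tropPoly]

theorem exists_trop_eq_coe {f : K} (hf : IsPositive y f) (h0 : f ≠ 0) :
    ∃ r : ℝ, trop y f x = r := by
  obtain ⟨P, Q, hQ, rfl⟩ := hf
  have hP : P ≠ 0 := by
    rintro rfl
    simp at h0
  obtain ⟨p, hp⟩ := tropPoly_ne_bot hP x
  rw [trop_eq hy _ _ hQ, tropQuot, hp]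
  exact ⟨_, rfl⟩

/-- The tropicalization of the sum is at least that of `f`, which is a real number, whereas that of
zero is `⊥`. -/
theorem add_ne_zero_of_isPositive {f g : K} (hf : IsPositive y f) (hg : IsPositive y g)
    (h0 : f ≠ 0) : f + g ≠ 0 := by
  intro h
  have h1 := trop_add hy 0 hf hg
  rw [h, trop_zero hy] at h1
  obtain ⟨r, hr⟩ := exists_trop_eq_coe hy 0 hf h0
  have : (r : WithBot ℝ) ≤ ⊥ := by
    rw [← hr, h1]
    exact le_max_left _ _
  simp at this

/-- Tropicalization turns the sum into a maximum; the empty sum has value `⊥`. -/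
theorem trop_sum_le_zero_iff {σ : Type*} (I : Finset σ) (f : σ → K)
    (hf : ∀ s ∈ I, IsPositive y (f s)) :
    trop y (∑ s ∈ I, f s) x ≤ 0 ↔ ∀ s ∈ I, trop y (f s) x ≤ 0 := by
  classical
  induction I using Finset.induction_on with
  | empty => simp [trop_zero hy]
  | insert a I ha ih =>
    have hI : ∀ s ∈ I, IsPositive y (f s) := fun s hs => hf s (Finset.mem_insert_of_mem hs)
    rw [Finset.sum_insert ha, trop_add hy x (hf a (Finset.mem_insert_self _ _))
      (sum_mem (S := positiveFunctions y) hI), max_le_iff, ih hI, Finset.forall_mem_insert]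

theorem trop_div_le_zero_iff {f g : K} (hf : IsPositive y f) (hg : IsPositive y g) (h0 : g ≠ 0) :
    trop y (f / g) x ≤ 0 ↔ trop y f x ≤ trop y g x := by
  have h := trop_mul hy x (hf.div hg) hg
  rw [div_mul_cancel₀ _ h0] at h
  obtain ⟨r, hr⟩ := exists_trop_eq_coe hy x hg h0
  rw [h, hr]
  generalize trop y (f / g) x = p
  induction p using WithBot.recBotCoe with
  | bot => simp
  | coe p =>
    rw [← WithBot.coe_add, WithBot.coe_le_coe, ← WithBot.coe_zero, WithBot.coe_le_coe]
    simp

/-- The tropical potential is nonpositive exactly when the rhombus inequalities hold. -/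
theorem trop_potential_le_zero_iff {n k : ℕ} (hk : 0 < k) (g : Fin k → Matrix (Fin n) (Fin n) K)
    (hM : ∀ l i j, l + 2 ≤ k → i + j ≤ n → cornerMinor g (facePoint k l i j) ≠ 0 ∧
      IsPositive y (cornerMinor g (facePoint k l i j))) :
    IsPositive y (potential g) ∧ (trop y (potential g) x ≤ 0 ↔
      RhombusInequalities n k fun α => trop y (cornerMinor g α) x) := by
  have hs : ∀ s ∈ rhombusIndex n k, ∀ a, cornerMinor g (rhombusCorner k s a) ≠ 0 ∧
      IsPositive y (cornerMinor g (rhombusCorner k s a)) := by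
    intro s hs a
    obtain ⟨l, i, j, hl, hij, he⟩ := exists_facePoint_eq_rhombusCorner hs a
    rw [he]
    exact hM l i j hl hij
  rw [potential_eq_sum_rhombusIndex hk g fun l i j hl hij => (hM l i j hl hij).1]
  have hpos : ∀ s ∈ rhombusIndex n k, IsPositive y
      (cornerMinor g (rhombusCorner k s 0) * cornerMinor g (rhombusCorner k s 2)
        / (cornerMinor g (rhombusCorner k s 1) * cornerMinor g (rhombusCorner k s 3))) :=
    fun s h => ((hs s h 0).2.mul (hs s h 2).2).div ((hs s h 1).2.mul (hs s h 3).2)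
  refine ⟨sum_mem (S := positiveFunctions y) hpos, ?_⟩
  rw [trop_sum_le_zero_iff hy x _ _ hpos]
  have hiff : ∀ s ∈ rhombusIndex n k, (trop y
      (cornerMinor g (rhombusCorner k s 0) * cornerMinor g (rhombusCorner k s 2)
        / (cornerMinor g (rhombusCorner k s 1) * cornerMinor g (rhombusCorner k s 3))) x ≤ 0 ↔
      trop y (cornerMinor g (rhombusCorner k s 0)) x
        + trop y (cornerMinor g (rhombusCorner k s 2)) x
      ≤ trop y (cornerMinor g (rhombusCorner k s 1)) x
        + trop y (cornerMinor g (rhombusCorner k s 3)) x) := by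
    intro s h
    rw [trop_div_le_zero_iff hy x ((hs s h 0).2.mul (hs s h 2).2)
      ((hs s h 1).2.mul (hs s h 3).2) (mul_ne_zero (hs s h 1).1 (hs s h 3).1),
      trop_mul hy x (hs s h 0).2 (hs s h 2).2, trop_mul hy x (hs s h 1).2 (hs s h 3).2]
  constructor
  · intro h α₁ α₂ α₃ α₄ hr
    obtain ⟨s, hs', rfl, rfl, rfl, rfl⟩ := isFaceRhombus_iff.mp hr
    exact (hiff s hs').mp (h s hs')
  · intro h s hs'
    exact (hiff s hs').mpr (h _ _ _ _ (isFaceRhombus_iff.mpr ⟨s, hs', rfl, rfl, rfl, rfl⟩))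

end Positive

/-! ### Unipotent matrices and the invariance of the multi-corner minors -/

section Unipotent

variable {R : Type} [CommRing R] {F : Type} [Field F] {n k : ℕ}

/-- Upper triangular matrices with ones on the diagonal. -/
def IsUnitriangular (u : Matrix (Fin n) (Fin n) R) : Prop :=
  (∀ i, u i i = 1) ∧ ∀ i j, j < i → u i j = 0

theorem isUnitriangular_one : IsUnitriangular (1 : Matrix (Fin n) (Fin n) R) :=
  ⟨fun _ => Matrix.one_apply_eq _, fun _ _ h => Matrix.one_apply_ne h.ne'⟩

theorem IsUnitriangular.det {u : Matrix (Fin n) (Fin n) R} (hu : IsUnitriangular u) :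
    u.det = 1 := by
  rw [Matrix.det_of_isUpperTriangular fun i j h => hu.2 i j h]
  exact Finset.prod_eq_one fun i _ => hu.1 i

theorem IsUnitriangular.isUnit_det {u : Matrix (Fin n) (Fin n) R} (hu : IsUnitriangular u) :
    IsUnit u.det := by
  rw [hu.det]
  exact isUnit_one

theorem IsUnitriangular.inv {u : Matrix (Fin n) (Fin n) R} (hu : IsUnitriangular u) :
    IsUnitriangular u⁻¹ := by
  have : Invertible u := Matrix.invertibleOfIsUnitDet u hu.isUnit_det
  have hinv : u⁻¹.BlockTriangular id :=
    Matrix.blockTriangular_inv_of_blockTriangular fun i j h => hu.2 i j h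
  refine ⟨fun i => ?_, fun i j h => hinv h⟩
  have h1 := congrFun (congrFun (Matrix.mul_nonsing_inv u hu.isUnit_det) i) i
  rw [Matrix.mul_apply, Matrix.one_apply_eq, Finset.sum_eq_single i, hu.1, one_mul] at h1
  · exact h1
  · intro j _ hj
    rcases lt_or_gt_of_ne hj with h | h
    · rw [hu.2 i j h, zero_mul]
    · rw [hinv (i := j) (j := i) h, mul_zero]
  · simp

/-- The tuple of matrices `u_l g_l u_{l+1}⁻¹`. -/
def translateBy (u : Fin (k + 1) → Matrix (Fin n) (Fin n) R)
    (g : Fin k → Matrix (Fin n) (Fin n) R) (l : Fin k) : Matrix (Fin n) (Fin n) R :=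
  u l.castSucc * g l * (u l.succ)⁻¹

/-- The inner unitriangular factors cancel in pairs. -/
theorem partialProd_translateBy {u : Fin (k + 1) → Matrix (Fin n) (Fin n) R}
    (hu : ∀ l, IsUnitriangular (u l)) (g : Fin k → Matrix (Fin n) (Fin n) R) (t : Fin (k + 1)) :
    Fin.partialProd (translateBy u g) t = u 0 * Fin.partialProd g t * (u t)⁻¹ := by
  induction t using Fin.induction with
  | zero =>
    rw [Fin.partialProd_zero, Fin.partialProd_zero, Matrix.mul_one,
      Matrix.mul_nonsing_inv _ (hu 0).isUnit_det]
  | succ t ih =>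
    rw [Fin.partialProd_succ, Fin.partialProd_succ, ih, translateBy]
    calc _ = u 0 * Fin.partialProd g t.castSucc * ((u t.castSucc)⁻¹ * u t.castSucc) * g t
          * (u t.succ)⁻¹ := by simp only [Matrix.mul_assoc]
      _ = _ := by
        rw [Matrix.nonsing_inv_mul _ (hu _).isUnit_det, Matrix.mul_one]
        simp only [Matrix.mul_assoc]

/-- The selected columns of each block form an initial segment, and right multiplication by an upper
triangular matrix adds to a column only multiples of earlier ones. So the selected submatrix changes
by unitriangular factors on both sides. -/
theorem cornerMinor_translateBy {u : Fin (k + 1) → Matrix (Fin n) (Fin n) R}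
    (hu : ∀ l, IsUnitriangular (u l)) (g : Fin k → Matrix (Fin n) (Fin n) R) (α : Fin k → ℕ) :
    cornerMinor (translateBy u g) α = cornerMinor g α := by
  rw [cornerMinor, cornerMinor, minor, minor]
  split_ifs with h
  swap
  · rfl
  generalize hJ : columnSet (n := n) α = J at h
  let f := J.orderEmbOfFin h
  let e := (Finset.univ : Finset (Fin n)).orderEmbOfFin rfl
  -- The combined column operation: on each block, the part of the inverse matrix indexed by the
  -- selected columns.
  let W : Matrix (Fin (Finset.univ : Finset (Fin n)).card) (Fin (Finset.univ : Finset (Fin n)).card)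
      R := Matrix.of fun a b =>
    if (ofLex (f a)).1 = (ofLex (f b)).1 then
      (u (ofLex (f b)).1)⁻¹ (ofLex (f a)).2 (ofLex (f b)).2 else 0
  have he : Function.Bijective e := (Fintype.bijective_iff_injective_and_card _).mpr
    ⟨e.injective, by simp⟩
  have hmul : (blockRow (translateBy u g)).submatrix e f
      = (u 0).submatrix e e * (blockRow g).submatrix e f * W := by
    ext a b
    have h1 : (u 0).submatrix e e * (blockRow g).submatrix e f
        = (u 0 * blockRow g).submatrix e f := by
      rw [← Matrix.submatrix_mul_equiv _ _ _ (Equiv.ofBijective e he)]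
      rfl
    rw [h1, Matrix.submatrix_apply, blockRow, Matrix.of_apply, partialProd_translateBy hu,
      Matrix.mul_apply, Matrix.mul_apply]
    generalize hm : ofLex (f b) = mc
    obtain ⟨m, c⟩ := mc
    simp only
    have hmem : ∀ c' ≤ c, toLex (m, c') ∈ J := by
      intro c' hc'
      have hb : f b ∈ J := Finset.orderEmbOfFin_mem J h b
      rw [← hJ] at hb ⊢
      simp only [columnSet, Finset.mem_filter, Finset.mem_univ, true_and, hm, ofLex_toLex] at hb ⊢
      exact lt_of_le_of_lt hc' hb
    calc ∑ c', (u 0 * Fin.partialProd g m) (e a) c' * (u m)⁻¹ c' c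
        = ∑ x ∈ J, (u 0 * blockRow g) (e a) x * (if (ofLex x).1 = m then
            (u m)⁻¹ (ofLex x).2 c else 0) := by
          symm
          simp only [mul_ite, mul_zero]
          rw [← Finset.sum_filter]
          refine Finset.sum_of_injOn (fun x => (ofLex x).2) ?_ ?_ ?_ ?_
          · intro x hx x' hx' hxx
            simp only [Finset.coe_filter, Set.mem_ofPred_eq] at hx hx'
            exact ofLex.injective (Prod.ext (hx.2.trans hx'.2.symm) hxx)
          · intro x _
            simp
          · intro c' _ hc'
            rcases lt_or_ge c c' with h' | h'
            · rw [(hu m).inv.2 c' c h', mul_zero]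
            · exact absurd ⟨toLex (m, c'), by
                simp only [Finset.coe_filter, Set.mem_ofPred_eq]
                exact ⟨hmem c' h', rfl⟩, rfl⟩ hc'
          · intro x hx
            rw [Finset.mem_filter] at hx
            rw [← hx.2]
            rfl
      _ = ∑ d, (u 0 * blockRow g) (e a) (f d) * (if (ofLex (f d)).1 = m then
            (u m)⁻¹ (ofLex (f d)).2 c else 0) := by
          rw [← Finset.image_orderEmbOfFin_univ J h, Finset.sum_image fun x _ y _ hxy =>
            f.injective hxy]
      _ = _ := by
          refine Finset.sum_congr rfl fun d _ => ?_
          simp only [W, Matrix.of_apply, Matrix.submatrix_apply, hm]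
  have hW : W.det = 1 := by
    rw [Matrix.det_of_isUpperTriangular]
    · refine Finset.prod_eq_one fun a _ => ?_
      simp only [W, Matrix.of_apply, if_true]
      exact (hu _).inv.1 _
    · intro a b hab
      have hlt : f b < f a := f.strictMono hab
      simp only [W, Matrix.of_apply]
      split_ifs with hm
      · refine (hu _).inv.2 _ _ ?_
        rcases Prod.Lex.lt_iff.mp hlt with h' | h'
        · exact absurd hm h'.ne'
        · exact h'.2
      · rfl
  have hdet : ((u 0).submatrix e e).det = 1 := by
    have := Matrix.det_submatrix_equiv_self (Equiv.ofBijective e he) (u 0)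
    rw [(hu 0).det] at this
    exact this
  change ((blockRow (translateBy u g)).submatrix e f).det = ((blockRow g).submatrix e f).det
  rw [hmul, Matrix.det_mul, Matrix.det_mul, hW, hdet, one_mul, mul_one]

end Unipotent

/-! ### Normal forms -/

section NormalForm

variable {R : Type} [CommRing R] {F : Type} [Field F] {n k : ℕ}

/-- A matrix extended by zero. -/
def toSeq (b : Matrix (Fin n) (Fin n) R) (r c : ℕ) : R :=
  if h : r < n ∧ c < n then b ⟨r, h.1⟩ ⟨c, h.2⟩ else 0

theorem toSeq_of_lt (b : Matrix (Fin n) (Fin n) R) {r c : ℕ} (hr : r < n) (hc : c < n) :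
    toSeq b r c = b ⟨r, hr⟩ ⟨c, hc⟩ := dif_pos ⟨hr, hc⟩

/-- The upper left triangular matrices. -/
def IsAntitriangular (X : Matrix (Fin n) (Fin n) R) : Prop :=
  ∀ r c : Fin n, n ≤ (r : ℕ) + c → X r c = 0

/-- The lower triangular matrices. -/
def IsLower (b : Matrix (Fin n) (Fin n) R) : Prop := ∀ r c, r < c → b r c = 0

theorem IsAntitriangular.mul {X b : Matrix (Fin n) (Fin n) R} (hX : IsAntitriangular X)
    (hb : IsLower b) : IsAntitriangular (X * b) := by
  intro r c hrc
  rw [Matrix.mul_apply]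
  refine Finset.sum_eq_zero fun s _ => ?_
  rcases lt_or_ge s c with h | h
  · rw [hb s c h, mul_zero]
  · rw [hX r s (hrc.trans (Nat.add_le_add_left h _)), zero_mul]

theorem solidMinor_eq_listDet (b : ℕ → ℕ → R) (i j : ℕ) :
    solidMinor b i j = listDet (cols (colSeq (1 : Matrix (Fin (i + j)) (Fin (i + j)) R)) i
      ++ cols (fun c s => b s c) j) := by
  rw [listDet_colSeq_one rfl, solidMinor]
  congr 1
  ext a c
  simp only [Matrix.of_apply]
  rw [getD_cols _ c.2]

/-- On the last `i + j` rows, `X` vanishes beyond its first `i + j` columns. There the columns of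
`X` and `X * b` are this square block of `X` times `[1 | b]`, and the determinant of the second
factor is a solid minor. -/
theorem tripleDet_mul_right {X : Matrix (Fin n) (Fin n) R} (hX : IsAntitriangular X)
    (b : Matrix (Fin n) (Fin n) R) {i j : ℕ} (hij : i + j ≤ n) :
    tripleDet (colSeq 1) (colSeq X) (colSeq (X * b)) (n - (i + j)) i j
      = listDet (cols (colSeq 1) (n - (i + j)) ++ cols (colSeq X) (i + j))
        * solidMinor (toSeq b) i j := by
  rw [tripleDet, List.append_assoc, listDet_colSeq_one (m := i + j) (by omega),
    listDet_colSeq_one (m := i + j) (by omega), solidMinor_eq_listDet, listDet, ← Matrix.det_mul]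
  congr 1
  ext a c
  simp only [Matrix.of_apply, Matrix.mul_apply]
  have hX' : ∀ s : Fin (i + j),
      (cols (colSeq X) (i + j)).getD s 0 ⟨n - (i + j) + a, by omega⟩
        = X ⟨n - (i + j) + a, by omega⟩ ⟨s, by omega⟩ := fun s => by
    rw [getD_cols _ s.2, colSeq_of_lt]
  simp only [hX']
  by_cases hc : (c : ℕ) < i
  · rw [List.getD_append _ _ _ _ (by simpa using hc), getD_cols _ hc, colSeq_of_lt _ (by omega),
      Finset.sum_eq_single c]
    · rw [List.getD_append _ _ _ _ (by simpa using hc), getD_cols _ hc, colSeq_of_lt _ c.2]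
      simp
    · intro s _ hs
      rw [List.getD_append _ _ _ _ (by simpa using hc), getD_cols _ hc, colSeq_of_lt _ c.2,
        Matrix.one_apply_ne hs, mul_zero]
    · simp
  · have hc' : (c : ℕ) - i < j := by omega
    rw [List.getD_append_right _ _ _ _ (by simp; omega), length_cols, getD_cols _ hc',
      colSeq_of_lt _ (by omega), Matrix.mul_apply]
    symm
    refine Fintype.sum_of_injective (fun s : Fin (i + j) => (⟨s, by omega⟩ : Fin n))
      (fun s s' h => Fin.ext (by simpa using h)) _ _ ?_ ?_
    · intro s hs
      rw [hX _ _ _, zero_mul]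
      have : ¬ (s : ℕ) < i + j := fun h => hs ⟨⟨s, h⟩, rfl⟩
      simp only
      omega
    · intro s
      rw [List.getD_append_right _ _ _ _ (by simp; omega), length_cols, getD_cols _ hc',
        toSeq_of_lt b (by omega) (by omega)]

theorem isAntitriangular_partialProd {g : Fin k → Matrix (Fin n) (Fin n) R} {t : ℕ} (ht : t + 1 ≤ k)
    (h0 : IsAntitriangular (g ⟨0, by omega⟩))
    (hg : ∀ l : Fin k, 0 < (l : ℕ) → (l : ℕ) < t + 1 → IsLower (g l)) :
    IsAntitriangular (Fin.partialProd g ⟨t + 1, by omega⟩) := by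
  induction t with
  | zero =>
    rw [partialProd_succ_nat g (by omega)]
    have : Fin.partialProd g ⟨0, by omega⟩ = 1 := Fin.partialProd_zero g
    rwa [this, Matrix.one_mul]
  | succ t ih =>
    rw [partialProd_succ_nat g (by omega)]
    exact (ih (by omega) h0 fun l h1 h2 => hg l h1 (by omega)).mul
      (hg _ (Nat.succ_pos _) (Nat.lt_succ_self _))

theorem cornerMinor_facePoint_zero (g : Fin k → Matrix (Fin n) (Fin n) R) {l i : ℕ}
    (hl : l + 2 ≤ k) (hi : i ≤ n) :
    cornerMinor g (facePoint k l i 0) = listDet (cols (colSeq 1) (n - i)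
      ++ cols (colSeq (Fin.partialProd g ⟨l + 1, by omega⟩)) i) := by
  rw [cornerMinor_facePoint g hl (by omega), tripleDet]
  simp

/-- Consecutive faces share an edge. This is how edge minors are passed from one face to the next.
-/
theorem facePoint_succ (l i : ℕ) : facePoint k (l + 1) i 0 = facePoint k l 0 i := by
  funext m
  simp only [facePoint]
  split_ifs <;> omega

/-- The multi-corner minors of a face in terms of the solid minors of one of the matrices. -/
theorem cornerMinor_eq_mul_solidMinor (g : Fin k → Matrix (Fin n) (Fin n) R) {l i j : ℕ}
    (hl : l + 2 ≤ k) (hij : i + j ≤ n)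
    (hX : IsAntitriangular (Fin.partialProd g ⟨l + 1, by omega⟩)) :
    cornerMinor g (facePoint k l i j) = cornerMinor g (facePoint k l (i + j) 0)
      * solidMinor (toSeq (g ⟨l + 1, by omega⟩)) i j := by
  rw [cornerMinor_facePoint g hl hij, cornerMinor_facePoint_zero g hl hij,
    partialProd_succ_nat g (t := l + 1) (by omega), tripleDet_mul_right hX _ hij]

/-- The matrix of the longest permutation. -/
def reversal (n : ℕ) (R : Type) [CommRing R] : Matrix (Fin n) (Fin n) R :=
  (1 : Matrix (Fin n) (Fin n) R).submatrix Fin.rev id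

theorem reversal_mul (A : Matrix (Fin n) (Fin n) R) :
    reversal n R * A = A.submatrix Fin.rev id := by
  ext r c
  simp [reversal, Matrix.mul_apply, Matrix.one_apply]

theorem reversal_mul_reversal : reversal n R * reversal n R = 1 := by
  rw [reversal_mul]
  ext r c
  rw [Matrix.submatrix_apply, reversal, Matrix.submatrix_apply, Fin.rev_rev]
  rfl

theorem mul_reversal (A : Matrix (Fin n) (Fin n) R) :
    A * reversal n R = A.submatrix id Fin.rev := by
  ext r c
  rw [Matrix.mul_apply, Finset.sum_eq_single (Fin.rev c)]
  · rw [reversal, Matrix.submatrix_apply, Fin.rev_rev, id, Matrix.one_apply_eq, mul_one]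
    rfl
  · intro s _ hs
    have : Fin.rev s ≠ c := fun h => hs (by rw [← h, Fin.rev_rev])
    simp [reversal, this]
  · simp

theorem isAntitriangular_reversal : IsAntitriangular (reversal n R) := by
  intro r c h
  have : Fin.rev r ≠ c := fun h' => by
    rw [← h', Fin.val_rev] at h
    omega
  simp [reversal, this]

/-- The lower left minors of the matrix of the longest permutation. -/
def reversalMinor (n i : ℕ) (R : Type) [CommRing R] : R :=
  listDet (cols (colSeq (1 : Matrix (Fin n) (Fin n) R)) (n - i) ++ cols (colSeq (reversal n R)) i)

theorem reversalMinor_eq {i : ℕ} (hi : i ≤ n) :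
    reversalMinor n i R = ((Equiv.Perm.sign (Fin.revPerm : Equiv.Perm (Fin i)) : ℤ) : R) := by
  rw [reversalMinor, listDet_colSeq_one (m := i) (by omega)]
  have : (Matrix.of fun a c : Fin i => (cols (colSeq (reversal n R)) i).getD c 0
      ⟨n - i + a, by omega⟩) = (1 : Matrix (Fin i) (Fin i) R).submatrix Fin.revPerm id := by
    ext a c
    rw [Matrix.of_apply, getD_cols _ c.2, colSeq_of_lt _ (by omega)]
    simp only [reversal, Matrix.submatrix_apply, Matrix.one_apply, Fin.revPerm_apply, id]
    congr 1
    simp only [Fin.ext_iff, Fin.val_rev, eq_iff_iff]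
    omega
  rw [this, Matrix.det_permute]
  simp

theorem isUnit_reversalMinor {i : ℕ} (hi : i ≤ n) : IsUnit (reversalMinor n i R) := by
  rw [reversalMinor_eq hi]
  rcases Int.units_eq_one_or (Equiv.Perm.sign (Fin.revPerm : Equiv.Perm (Fin i))) with h | h <;>
    simp [h]

/-- The lower left minors of a matrix in terms of the leading minors of its reversal. -/
theorem listDet_cols_eq_reversalMinor_mul (A : Matrix (Fin n) (Fin n) R) {i : ℕ} (hi : i ≤ n) :
    listDet (cols (colSeq 1) (n - i) ++ cols (colSeq A) i)
      = reversalMinor n i R * solidMinor (toSeq (reversal n R * A)) 0 i := by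
  have h := tripleDet_mul_right isAntitriangular_reversal (reversal n R * A) (i := 0) (j := i)
    (by omega)
  rw [← Matrix.mul_assoc, reversal_mul_reversal, Matrix.one_mul, zero_add] at h
  rw [reversalMinor, ← h, tripleDet]
  simp

theorem solidMinor_diagonal_succ (d : Fin n → R) {i : ℕ} (hi : i < n) :
    solidMinor (toSeq (Matrix.diagonal d)) 0 (i + 1)
      = solidMinor (toSeq (Matrix.diagonal d)) 0 i * d ⟨i, hi⟩ := by
  have h : ∀ j ≤ n, solidMinor (toSeq (Matrix.diagonal d)) 0 j
      = ∏ s : Fin j, toSeq (Matrix.diagonal d) s s := by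
    intro j hj
    rw [solidMinor, ← Matrix.det_diagonal]
    congr 1
    ext a c
    rw [Matrix.of_apply, Matrix.diagonal_apply, toSeq_of_lt _ (by omega) (by omega),
      Matrix.diagonal_apply]
    by_cases hac : a = c
    · subst hac
      rw [if_pos (by simp), if_pos rfl, toSeq_of_lt _ (by omega) (by omega),
        Matrix.diagonal_apply_eq]
      simp
    · rw [if_neg, if_neg hac]
      simpa [Fin.ext_iff] using hac
  rw [h _ hi, h _ hi.le, Fin.prod_univ_castSucc]
  congr 1
  simp [toSeq_of_lt, hi]

/-- A matrix with nonzero leading minors can be made lower triangular by a unitriangular column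
operation. -/
theorem exists_mul_isLower (A : Matrix (Fin n) (Fin n) F)
    (hA : ∀ j ≤ n, solidMinor (toSeq A) 0 j ≠ 0) :
    ∃ v, IsUnitriangular v ∧ IsLower (A * v) := by
  -- Column `j` is cleared above the diagonal by solving a linear system whose matrix is the leading
  -- `j × j` block.
  have hcol : ∀ j : Fin n, ∃ w : Fin j → F, ∀ a : Fin j,
      ∑ b : Fin j, A ⟨a, by omega⟩ ⟨b, by omega⟩ * w b = -A ⟨a, by omega⟩ j := by
    intro j
    let B : Matrix (Fin j) (Fin j) F := Matrix.of fun a b => A ⟨a, by omega⟩ ⟨b, by omega⟩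
    have hB : IsUnit B.det := by
      rw [isUnit_iff_ne_zero]
      convert hA j j.2.le using 1
      rw [solidMinor]
      congr 1
      ext a b
      simp only [B, Matrix.of_apply]
      rw [toSeq_of_lt _ (by omega) (by omega)]
      simp
    refine ⟨B⁻¹.mulVec fun a => -A ⟨a, by omega⟩ j, fun a => ?_⟩
    have : B.mulVec (B⁻¹.mulVec fun a => -A ⟨a, by omega⟩ j) a = -A ⟨a, by omega⟩ j := by
      rw [Matrix.mulVec_mulVec, Matrix.mul_nonsing_inv _ hB, Matrix.one_mulVec]
    exact this
  choose w hw using hcol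
  refine ⟨Matrix.of fun s j => if h : (s : ℕ) < j then w j ⟨s, h⟩ else if s = j then 1 else 0,
    ⟨?_, ?_⟩, ?_⟩
  · intro i
    simp
  · intro i j hij
    have h1 : ¬ (i : ℕ) < j := not_lt.mpr (le_of_lt hij)
    rw [Matrix.of_apply, dif_neg h1, if_neg hij.ne']
  · intro r c hrc
    rw [Matrix.mul_apply]
    have hsplit : ∀ s : Fin n, A r s * (Matrix.of fun s j : Fin n =>
        if h : (s : ℕ) < j then w j ⟨s, h⟩ else if s = j then 1 else 0) s c
        = (if h : (s : ℕ) < c then A r s * w c ⟨s, h⟩ else 0) + if s = c then A r s else 0 := by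
      intro s
      simp only [Matrix.of_apply]
      split_ifs with h1 h2
      · exact absurd h1 (by simp [h2])
      · simp
      · simp
      · simp
    rw [Finset.sum_congr rfl fun s _ => hsplit s, Finset.sum_add_distrib, Finset.sum_ite_eq',
      if_pos (Finset.mem_univ _)]
    have := hw c ⟨r, hrc⟩
    have e : ∑ s : Fin n, (if h : (s : ℕ) < c then A r s * w c ⟨s, h⟩ else 0)
        = ∑ b : Fin c, A r ⟨b, by omega⟩ * w c b := by
      symm
      refine Fintype.sum_of_injective (fun s : Fin c => (⟨s, by omega⟩ : Fin n))
        (fun s s' h => Fin.ext (by simpa using h)) _ _ ?_ ?_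
      · intro s hs
        exact dif_neg fun h => hs ⟨⟨s, h⟩, rfl⟩
      · intro s
        rw [dif_pos s.2]
    rw [e, this, neg_add_cancel]

end NormalForm

/-! ### Normal forms of tuples under unitriangular translations -/

section NormalTuple

variable {R : Type} [CommRing R] {F : Type} [Field F] {n k : ℕ}

/-- Tuples whose first matrix is antidiagonal, and whose other matrices are lower triangular. -/
def IsNormalTuple (g : Fin k → Matrix (Fin n) (Fin n) R) : Prop :=
  (∀ l : Fin k, (l : ℕ) = 0 → ∃ d, g l = reversal n R * Matrix.diagonal d) ∧
    ∀ l : Fin k, 0 < (l : ℕ) → IsLower (g l)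

theorem isLower_diagonal (d : Fin n → R) : IsLower (Matrix.diagonal d) :=
  fun _ _ h => Matrix.diagonal_apply_ne _ h.ne

theorem partialProd_one_eq (g : Fin k → Matrix (Fin n) (Fin n) R) (hk : 0 < k) :
    Fin.partialProd g ⟨0 + 1, by omega⟩ = g ⟨0, hk⟩ := by
  rw [partialProd_succ_nat g hk]
  have : Fin.partialProd g ⟨0, by omega⟩ = 1 := Fin.partialProd_zero g
  rw [this, Matrix.one_mul]

theorem solidMinor_transpose (A : Matrix (Fin n) (Fin n) R) (j : ℕ) :
    solidMinor (toSeq A.transpose) 0 j = solidMinor (toSeq A) 0 j := by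
  rw [solidMinor, solidMinor, ← Matrix.det_transpose]
  congr 1
  ext a b
  simp [toSeq, and_comm]

theorem IsLower.mul {a b : Matrix (Fin n) (Fin n) R} (ha : IsLower a) (hb : IsLower b) :
    IsLower (a * b) := by
  intro r c hrc
  rw [Matrix.mul_apply]
  refine Finset.sum_eq_zero fun s _ => ?_
  rcases lt_or_ge r s with h | h
  · rw [ha r s h, zero_mul]
  · rw [hb s c (lt_of_le_of_lt h hrc), mul_zero]

/-- A matrix with nonzero lower left minors can be made antidiagonal. -/
theorem exists_mul_mul_eq_reversal_mul (A : Matrix (Fin n) (Fin n) F)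
    (hA : ∀ j ≤ n, listDet (cols (colSeq 1) (n - j) ++ cols (colSeq A) j) ≠ 0) :
    ∃ u v, IsUnitriangular u ∧ IsUnitriangular v ∧
      ∃ d, u * A * v = reversal n F * Matrix.diagonal d := by
  have hA' : ∀ j ≤ n, solidMinor (toSeq (reversal n F * A)) 0 j ≠ 0 := by
    intro j hj h0
    apply hA j hj
    rw [listDet_cols_eq_reversalMinor_mul A hj, h0, mul_zero]
  -- Column operations make the reversed matrix lower triangular. Those on its transpose are row
  -- operations and make it upper triangular. Performed together they preserve both properties, so
  -- the outcome is diagonal.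
  obtain ⟨v, hv, hlow⟩ := exists_mul_isLower _ hA'
  obtain ⟨w, hw, hup⟩ := exists_mul_isLower (reversal n F * A).transpose fun j hj => by
    rw [solidMinor_transpose]
    exact hA' j hj
  have hwlow : IsLower w.transpose := fun r c h => hw.2 c r h
  have h1 : IsLower (w.transpose * (reversal n F * A) * v) := by
    rw [Matrix.mul_assoc]
    exact hwlow.mul hlow
  have hvlow : IsLower v.transpose := fun r c h => hv.2 c r h
  have h2 : IsLower (w.transpose * (reversal n F * A) * v).transpose := by
    rw [Matrix.transpose_mul, Matrix.transpose_mul, Matrix.transpose_transpose]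
    exact hvlow.mul hup
  -- Conjugation by the reversal makes the lower triangular `w.transpose` upper triangular.
  refine ⟨reversal n F * w.transpose * reversal n F, v, ?_, hv,
    fun i => (w.transpose * (reversal n F * A) * v) i i, ?_⟩
  · rw [reversal_mul, mul_reversal]
    exact ⟨fun i => hw.1 _, fun i j h => hw.2 _ _ (Fin.rev_lt_rev.mpr h)⟩
  · have : Matrix.diagonal (fun i => (w.transpose * (reversal n F * A) * v) i i)
        = w.transpose * (reversal n F * A) * v := by
      ext r c
      rcases lt_trichotomy r c with h | h | h
      · rw [Matrix.diagonal_apply_ne _ h.ne, h1 r c h]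
      · subst h
        rw [Matrix.diagonal_apply_eq]
      · rw [Matrix.diagonal_apply_ne _ h.ne']
        exact (h2 c r h).symm
    rw [this]
    simp only [Matrix.mul_assoc]

/-- Every tuple with nonzero multi-corner minors on the faces can be brought to normal form. -/
theorem exists_isNormalTuple_translateBy (g : Fin k → Matrix (Fin n) (Fin n) F)
    (hM : ∀ l i j, l + 2 ≤ k → i + j ≤ n → cornerMinor g (facePoint k l i j) ≠ 0) (hk : 2 ≤ k) :
    ∃ u : Fin (k + 1) → Matrix (Fin n) (Fin n) F, (∀ l, IsUnitriangular (u l)) ∧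
      IsNormalTuple (translateBy u g) := by
  have key : ∀ t, t + 1 ≤ k → ∃ u : Fin (k + 1) → Matrix (Fin n) (Fin n) F,
      (∀ l, IsUnitriangular (u l)) ∧
      (∀ l : Fin k, (l : ℕ) = 0 → ∃ d, translateBy u g l = reversal n F * Matrix.diagonal d) ∧
      ∀ l : Fin k, 0 < (l : ℕ) → (l : ℕ) < t + 1 → IsLower (translateBy u g l) := by
    intro t
    induction t with
    | zero =>
      intro _
      obtain ⟨u, v, hu, hv, d, hd⟩ := exists_mul_mul_eq_reversal_mul (g ⟨0, by omega⟩) fun j hj => by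
        rw [← partialProd_one_eq g, ← cornerMinor_facePoint_zero g hk hj]
        exact hM 0 j 0 hk (by omega)
      -- The right factor enters `translateBy` through its inverse, hence `v⁻¹`.
      refine ⟨fun s => if (s : ℕ) = 0 then u else if (s : ℕ) = 1 then v⁻¹ else 1, ?_, ?_, ?_⟩
      · intro s
        dsimp only
        split_ifs
        exacts [hu, hv.inv, isUnitriangular_one]
      · intro l hl
        have h0k : 0 < k := by omega
        obtain rfl : l = ⟨0, h0k⟩ := Fin.ext hl
        refine ⟨d, ?_⟩
        rw [← hd]
        simp [translateBy, Matrix.nonsing_inv_nonsing_inv _ hv.isUnit_det]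
      · intro l h1 h2
        omega
    | succ t ih =>
      intro ht
      obtain ⟨u, hu, h0, hlow⟩ := ih (by omega)
      -- The matrix in place `t + 1` now has its left factor fixed and its right factor trivial. The
      -- right factor is free to be chosen without disturbing the earlier matrices.
      let u' : Fin (k + 1) → Matrix (Fin n) (Fin n) F := fun s => if (s : ℕ) ≤ t + 1 then u s else 1
      have hu' : ∀ l, IsUnitriangular (u' l) := by
        intro l
        simp only [u']
        split_ifs
        exacts [hu l, isUnitriangular_one]
      have hold : ∀ (w : Fin (k + 1) → Matrix (Fin n) (Fin n) F),
          (∀ s : Fin (k + 1), (s : ℕ) ≤ t + 1 → w s = u s) → ∀ l : Fin k, (l : ℕ) < t + 1 →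
          translateBy w g l = translateBy u g l := by
        intro w hw l hl
        rw [translateBy, translateBy, hw _ (by simp; omega), hw _ (by simp; omega)]
      have hu'u : ∀ s : Fin (k + 1), (s : ℕ) ≤ t + 1 → u' s = u s := fun s hs => if_pos hs
      have hanti : IsAntitriangular (Fin.partialProd (translateBy u' g) ⟨t + 1, by omega⟩) := by
        apply isAntitriangular_partialProd (by omega)
        · obtain ⟨d, hd⟩ := h0 ⟨0, by omega⟩ rfl
          rw [hold u' hu'u _ (Nat.succ_pos _), hd]
          exact isAntitriangular_reversal.mul (isLower_diagonal d)
        · intro l h1 h2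
          rw [hold u' hu'u l h2]
          exact hlow l h1 h2
      -- On the edge `i = 0` of face `t`, the nonzero multi-corner minors are edge minors times the
      -- leading minors of this matrix.
      obtain ⟨v, hv, hvlow⟩ := exists_mul_isLower (translateBy u' g ⟨t + 1, by omega⟩) fun j hj h => by
        have := cornerMinor_eq_mul_solidMinor (translateBy u' g) (l := t) (i := 0) (j := j)
          (by omega) (by omega) hanti
        rw [h, mul_zero, cornerMinor_translateBy hu'] at this
        exact hM t 0 j (by omega) (by omega) this
      let w : Fin (k + 1) → Matrix (Fin n) (Fin n) F := fun s =>
        if (s : ℕ) = t + 2 then v⁻¹ else u' s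
      have hwu : ∀ s : Fin (k + 1), (s : ℕ) ≤ t + 1 → w s = u s := fun s hs => by
        simp only [w]
        rw [if_neg (by omega), hu'u s hs]
      refine ⟨w, ?_, ?_, ?_⟩
      · intro l
        simp only [w]
        split_ifs
        exacts [hv.inv, hu' l]
      · intro l hl
        rw [hold w hwu l (by omega)]
        exact h0 l hl
      · intro l h1 h2
        rcases Nat.lt_succ_iff_lt_or_eq.mp h2 with h3 | h3
        · rw [hold w hwu l h3]
          exact hlow l h1 h3
        · have htk : t + 1 < k := by omega
          obtain rfl : l = ⟨t + 1, htk⟩ := Fin.ext h3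
          convert hvlow using 1
          simp [translateBy, w, u', Matrix.nonsing_inv_nonsing_inv _ hv.isUnit_det]
  obtain ⟨u, hu, h0, hlow⟩ := key (k - 1) (by omega)
  exact ⟨u, hu, h0, fun l h => hlow l h (by omega)⟩

theorem IsNormalTuple.isAntitriangular_partialProd {g : Fin k → Matrix (Fin n) (Fin n) R}
    (hg : IsNormalTuple g) {t : ℕ} (ht : t + 1 ≤ k) :
    IsAntitriangular (Fin.partialProd g ⟨t + 1, by omega⟩) := by
  apply MultiCorner.isAntitriangular_partialProd ht
  · obtain ⟨d, hd⟩ := hg.1 ⟨0, by omega⟩ rfl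
    rw [hd]
    exact isAntitriangular_reversal.mul (isLower_diagonal d)
  · exact fun l h _ => hg.2 l h

/-- The entries of a tuple in normal form are Laurent polynomials in its multi-corner minors on
the faces. -/
theorem IsNormalTuple.entry_mem [Algebra ℂ F] {g : Fin k → Matrix (Fin n) (Fin n) F}
    (hg : IsNormalTuple g) (hk : 2 ≤ k) (S : Subalgebra ℂ F)
    (hM : ∀ l i j, l + 2 ≤ k → i + j ≤ n → cornerMinor g (facePoint k l i j) ≠ 0 ∧
      cornerMinor g (facePoint k l i j) ∈ S ∧ (cornerMinor g (facePoint k l i j))⁻¹ ∈ S)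
    (l : Fin k) (r c : Fin n) : g l r c ∈ S := by
  rcases Nat.eq_zero_or_pos l with hl | hl
  · obtain ⟨d, hd⟩ := hg.1 l hl
    -- Up to sign, the leading minors of the diagonal factor are multi-corner minors on an edge of
    -- face 0; the entries of `d` are quotients of consecutive ones.
    have hsolid : ∀ i ≤ n, solidMinor (toSeq (Matrix.diagonal d)) 0 i ≠ 0 ∧
        solidMinor (toSeq (Matrix.diagonal d)) 0 i ∈ S ∧
        (solidMinor (toSeq (Matrix.diagonal d)) 0 i)⁻¹ ∈ S := by
      intro i hi
      obtain ⟨h1, h2, h3⟩ := hM 0 i 0 hk (by omega)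
      have h := cornerMinor_facePoint_zero g (l := 0) hk hi
      have h0k : 0 < k := by omega
      obtain rfl : l = ⟨0, h0k⟩ := Fin.ext hl
      rw [partialProd_one_eq g h0k, listDet_cols_eq_reversalMinor_mul _ hi, hd, ← Matrix.mul_assoc,
        reversal_mul_reversal, Matrix.one_mul] at h
      have hr := reversalMinor_eq (R := F) hi
      have hu := isUnit_reversalMinor (R := F) hi
      have hrS : reversalMinor n i F ∈ S := by
        rw [hr]
        exact intCast_mem S _
      have hrr : reversalMinor n i F * reversalMinor n i F = 1 := by
        rw [hr, ← Int.cast_mul, ← Units.val_mul, Int.units_mul_self]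
        simp
      have he : solidMinor (toSeq (Matrix.diagonal d)) 0 i
          = reversalMinor n i F * cornerMinor g (facePoint k 0 i 0) := by
        rw [h, ← mul_assoc, hrr, one_mul]
      rw [he]
      refine ⟨mul_ne_zero hu.ne_zero h1, S.mul_mem hrS h2, ?_⟩
      rw [mul_inv, inv_eq_of_mul_eq_one_right hrr]
      exact S.mul_mem hrS h3
    have hdS : ∀ i, d i ∈ S := by
      intro i
      have := solidMinor_diagonal_succ d i.2
      have h1 := hsolid i i.2.le
      rw [eq_comm, mul_comm, ← eq_div_iff h1.1] at this
      rw [show d i = d ⟨i, i.2⟩ from rfl, this, div_eq_mul_inv]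
      exact S.mul_mem (hsolid _ i.2).2.1 h1.2.2
    rw [hd, Matrix.mul_diagonal]
    refine S.mul_mem ?_ (hdS c)
    rw [reversal, Matrix.submatrix_apply, Matrix.one_apply]
    split_ifs
    exacts [S.one_mem, S.zero_mem]
  -- The solid minors are quotients of face minors, so they and their inverses lie in `S`. The
  -- entries are recovered as the minors of size one.
  · have hMin : MinorsIn S.toSubsemiring n (toSeq (g l)) := by
      apply minorsIn_of_solidMinor
      · intro i j hij
        rw [toSeq]
        split_ifs with h
        · exact hg.2 l hl _ _ hij
        · rfl
      · intro i j hij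
        obtain ⟨t, ht⟩ : ∃ t, (l : ℕ) = t + 1 := ⟨l - 1, by omega⟩
        have htk : t + 1 < k := by omega
        obtain rfl : l = ⟨t + 1, htk⟩ := Fin.ext ht
        have h := cornerMinor_eq_mul_solidMinor g (l := t) (i := i) (j := j + 1) (by omega)
          (by omega) (hg.isAntitriangular_partialProd (by omega))
        obtain ⟨h1, h2, h3⟩ := hM t i (j + 1) (by omega) (by omega)
        obtain ⟨h1', h2', h3'⟩ := hM t (i + (j + 1)) 0 (by omega) (by omega)
        rw [eq_comm, mul_comm, ← eq_div_iff h1'] at h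
        rw [h, div_eq_mul_inv]
        refine ⟨mul_ne_zero h1 (inv_ne_zero h1'), S.mul_mem h2 h3', ?_⟩
        rw [mul_inv, inv_inv]
        exact S.mul_mem h3 h2'
    have := hMin 1 (fun _ => r) (fun _ => c) (Subsingleton.strictMono _)
      (Subsingleton.strictMono _) (fun _ => r.2) (fun _ => c.2)
    rw [Matrix.det_fin_one, Matrix.of_apply, toSeq_of_lt _ r.2 c.2] at this
    exact this

/-- There are tuples with prescribed nonzero multi-corner minors on the faces. -/
theorem exists_cornerMinor_eq (hk : 2 ≤ k) (x : (Fin k → ℕ) → F) (hx : ∀ α, x α ≠ 0)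
    (hx0 : x 0 = 1) : ∃ g : Fin k → Matrix (Fin n) (Fin n) F, ∀ l i j, l + 2 ≤ k → i + j ≤ n →
      cornerMinor g (facePoint k l i j) = x (facePoint k l i j) := by
  have hzero : ∀ l, facePoint k l 0 0 = 0 := fun l => by
    funext m
    simp [facePoint]
  -- For a tuple in normal form, `cornerMinor_eq_mul_solidMinor` forces these quotients to be the
  -- solid minors of the matrix in place `l + 1`.
  have hb := fun l => exists_solidMinor_eq n
    (fun i j => x (facePoint k l i j) / x (facePoint k l (i + j) 0))
    (fun i j => div_ne_zero (hx _) (hx _))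
  choose b hlow hsolid using hb
  -- The leading minors that the diagonal factor of the first matrix must have.
  let e : ℕ → F := fun i => (reversalMinor n i F)⁻¹ * x (facePoint k 0 i 0)
  have he : ∀ i ≤ n, e i ≠ 0 := fun i hi =>
    mul_ne_zero (inv_ne_zero (isUnit_reversalMinor hi).ne_zero) (hx _)
  let d : Fin n → F := fun i => e (i + 1) / e i
  have hd : ∀ i ≤ n, solidMinor (toSeq (Matrix.diagonal d)) 0 i = e i := by
    intro i
    induction i with
    | zero =>
      intro _
      simp only [e]
      rw [solidMinor_zero, reversalMinor_eq (Nat.zero_le _), hzero, hx0,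
        Subsingleton.elim (Fin.revPerm : Equiv.Perm (Fin 0)) 1]
      simp
    | succ i ih =>
      intro hi
      rw [solidMinor_diagonal_succ d hi, ih (by omega)]
      exact mul_div_cancel₀ _ (he i (by omega))
  let g : Fin k → Matrix (Fin n) (Fin n) F := fun l =>
    if (l : ℕ) = 0 then reversal n F * Matrix.diagonal d
    else Matrix.of fun r c => b (l - 1) r c
  have hg : IsNormalTuple g := by
    refine ⟨fun l hl => ⟨d, if_pos hl⟩, fun l hl => ?_⟩
    intro r c hrc
    simp only [g]
    rw [if_neg hl.ne']
    exact hlow _ _ _ hrc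
  have hsol : ∀ l i j (hl : l + 2 ≤ k), i + j ≤ n →
      solidMinor (toSeq (g ⟨l + 1, by omega⟩)) i j
        = x (facePoint k l i j) / x (facePoint k l (i + j) 0) := by
    intro l i j hl hij
    cases j with
    | zero => rw [solidMinor_zero, add_zero, div_self (hx _)]
    | succ j =>
      rw [← hsolid l i j (by omega), solidMinor, solidMinor]
      congr 1
      ext r c
      rw [Matrix.of_apply, Matrix.of_apply, toSeq_of_lt _ (by omega) (by omega)]
      simp [g]
  -- The edge `j = 0` of a face is the edge `i = 0` of the preceding one, where the prescribed solid
  -- minors already give the value.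
  have hedge : ∀ l i, l + 2 ≤ k → i ≤ n →
      cornerMinor g (facePoint k l i 0) = x (facePoint k l i 0) := by
    intro l
    induction l with
    | zero =>
      intro i hl hi
      have h0 : g ⟨0, by omega⟩ = reversal n F * Matrix.diagonal d := if_pos rfl
      rw [cornerMinor_facePoint_zero g hl hi, partialProd_one_eq g (by omega),
        listDet_cols_eq_reversalMinor_mul _ hi, h0, ← Matrix.mul_assoc,
        reversal_mul_reversal, Matrix.one_mul, hd i hi]
      exact mul_inv_cancel_left₀ (isUnit_reversalMinor hi).ne_zero _
    | succ l ih =>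
      intro i hl hi
      rw [facePoint_succ, cornerMinor_eq_mul_solidMinor g (by omega) (by omega)
        (hg.isAntitriangular_partialProd (by omega)), hsol l 0 i (by omega) (by omega),
        ih _ (by omega) (by omega)]
      exact mul_div_cancel₀ _ (hx _)
  refine ⟨g, fun l i j hl hij => ?_⟩
  rw [cornerMinor_eq_mul_solidMinor g hl hij (hg.isAntitriangular_partialProd (by omega)),
    hedge l _ hl hij, hsol l i j hl hij]
  exact mul_div_cancel₀ _ (hx _)

end NormalTuple

/-! ### The ring of invariants -/

section Maps

variable {R R' : Type} [CommRing R] [CommRing R'] {n k : ℕ}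

theorem partialProd_map (f : R →+* R') (g : Fin k → Matrix (Fin n) (Fin n) R) (t : Fin (k + 1)) :
    Fin.partialProd (fun l => (g l).map f) t = (Fin.partialProd g t).map f := by
  induction t using Fin.induction with
  | zero => simp [Fin.partialProd_zero]
  | succ t ih => rw [Fin.partialProd_succ, Fin.partialProd_succ, ih, Matrix.map_mul]

theorem cornerMinor_map (f : R →+* R') (g : Fin k → Matrix (Fin n) (Fin n) R) (α : Fin k → ℕ) :
    cornerMinor (fun l => (g l).map f) α = f (cornerMinor g α) := by
  have : blockRow (fun l => (g l).map f) = (blockRow g).map f := by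
    ext r c
    simp [blockRow, partialProd_map]
  rw [cornerMinor, cornerMinor, this, minor, minor]
  split_ifs with h
  · rw [RingHom.map_det]
    rfl
  · rw [map_zero]

theorem IsUnitriangular.map {u : Matrix (Fin n) (Fin n) R} (hu : IsUnitriangular u)
    (f : R →+* R') : IsUnitriangular (u.map f) :=
  ⟨fun i => by rw [Matrix.map_apply, hu.1, map_one],
    fun i j h => by rw [Matrix.map_apply, hu.2 i j h, map_zero]⟩

theorem IsUnitriangular.map_inv {u : Matrix (Fin n) (Fin n) R} (hu : IsUnitriangular u)
    (f : R →+* R') : (u.map f)⁻¹ = u⁻¹.map f := by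
  apply Matrix.inv_eq_right_inv
  rw [← Matrix.map_mul, Matrix.mul_nonsing_inv _ hu.isUnit_det]
  exact Matrix.map_one _ (map_zero f) (map_one f)

theorem translateBy_map {u : Fin (k + 1) → Matrix (Fin n) (Fin n) R}
    (hu : ∀ l, IsUnitriangular (u l)) (f : R →+* R') (g : Fin k → Matrix (Fin n) (Fin n) R)
    (l : Fin k) :
    translateBy (fun l => (u l).map f) (fun l => (g l).map f) l = (translateBy u g l).map f := by
  rw [translateBy, translateBy, Matrix.map_mul, Matrix.map_mul, (hu _).map_inv]

end Maps

/-! ### Invariance under unipotent matrices and clearing of denominators -/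

section Invariants

variable {n k : ℕ}

theorem IsUnipotentUpper.isUnitriangular {u : GL (Fin n) ℂ} (hu : IsUnipotentUpper u) :
    IsUnitriangular (u : Matrix (Fin n) (Fin n) ℂ) := hu

theorem translate_eq_translateBy {u : Fin (k + 1) → GL (Fin n) ℂ}
    (hu : ∀ l, IsUnipotentUpper (u l)) (l : Fin k) :
    translate u l = translateBy (fun l => (u l : Matrix (Fin n) (Fin n) ℂ).map MvPolynomial.C)
      (genericPoly n k) l := by
  rw [translate, translateBy, (hu _).isUnitriangular.map_inv, Matrix.coe_units_inv]

theorem act_algebraMap (u : Fin (k + 1) → GL (Fin n) ℂ) (p : PolyRing n k) :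
    act u (algebraMap _ _ p) = algebraMap _ (RatField n k) (actPoly u p) :=
  IsFractionRing.algEquivOfAlgEquiv_algebraMap _ _

theorem cornerMinor_generic (α : Fin k → ℕ) :
    cornerMinor (generic n k) α = algebraMap _ (RatField n k) (cornerMinor (genericPoly n k) α) :=
  cornerMinor_map (algebraMap (PolyRing n k) (RatField n k)) (genericPoly n k) α

theorem algebraMap_mem_regularRing (p : PolyRing n k) :
    algebraMap _ (RatField n k) p ∈ regularRing n k := by
  induction p using MvPolynomial.induction_on with
  | C a => exact (regularRing n k).algebraMap_mem a
  | add p q hp hq =>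
    rw [map_add]
    exact add_mem hp hq
  | mul_X p s hp =>
    rw [map_mul]
    exact mul_mem hp (Algebra.subset_adjoin (Or.inl ⟨s.1, s.2.1, s.2.2, rfl⟩))

theorem actPoly_cornerMinor {u : Fin (k + 1) → GL (Fin n) ℂ}
    (hu : ∀ l, IsUnipotentUpper (u l)) (α : Fin k → ℕ) :
    actPoly u (cornerMinor (genericPoly n k) α) = cornerMinor (genericPoly n k) α := by
  have h := cornerMinor_map (actPoly u).toRingHom (genericPoly n k) α
  have h2 : (fun l => (genericPoly n k l).map (actPoly u).toRingHom)
      = translateBy (fun l => (u l : Matrix (Fin n) (Fin n) ℂ).map MvPolynomial.C)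
        (genericPoly n k) := by
    funext l
    rw [← translate_eq_translateBy hu, ← actPoly_generic]
    rfl
  rw [h2, cornerMinor_translateBy fun l => (hu l).isUnitriangular.map _] at h
  exact h.symm

theorem mem_invariantRing {f : RatField n k} : f ∈ invariantRing n k ↔ f ∈ regularRing n k ∧
    ∀ u : Fin (k + 1) → GL (Fin n) ℂ, (∀ i, IsUnipotentUpper (u i)) → act u f = f := by
  rw [invariantRing, Algebra.mem_inf, Algebra.mem_iInf]
  simp only [Algebra.mem_iInf, AlgHom.mem_equalizer]
  rfl

theorem cornerMinor_mem_invariantRing (α : Fin k → ℕ) :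
    cornerMinor (generic n k) α ∈ invariantRing n k := by
  rw [mem_invariantRing, cornerMinor_generic]
  refine ⟨algebraMap_mem_regularRing _, fun u hu => ?_⟩
  rw [act_algebraMap, actPoly_cornerMinor hu]

/-- A polynomial that is invariant under complex unipotent matrices is invariant under unipotent
matrices over any field extension. -/
theorem aeval_translateBy (P : PolyRing n k)
    (hP : ∀ u : Fin (k + 1) → GL (Fin n) ℂ, (∀ i, IsUnipotentUpper (u i)) → actPoly u P = P)
    {L : Type} [Field L] [Algebra ℂ L] (g : Fin k → Matrix (Fin n) (Fin n) L)
    {u : Fin (k + 1) → Matrix (Fin n) (Fin n) L} (hu : ∀ l, IsUnitriangular (u l)) :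
    MvPolynomial.aeval (fun p => translateBy u g p.1 p.2.1 p.2.2) P
      = MvPolynomial.aeval (fun p => g p.1 p.2.1 p.2.2) P := by
  -- The universal case: the first family of variables supplies the strictly upper entries of the
  -- unitriangular matrices, the second all entries of the tuple.
  let T := MvPolynomial ((Fin (k + 1) × Fin n × Fin n) ⊕ (Fin k × Fin n × Fin n)) ℂ
  let U : Fin (k + 1) → Matrix (Fin n) (Fin n) T := fun l => Matrix.of fun i j =>
    if i < j then MvPolynomial.X (Sum.inl (l, i, j)) else if i = j then 1 else 0
  let H : Fin k → Matrix (Fin n) (Fin n) T := fun l => Matrix.of fun i j =>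
    MvPolynomial.X (Sum.inr (l, i, j))
  have hU : ∀ l, IsUnitriangular (U l) := fun l =>
    ⟨fun i => by simp [U], fun i j h => by simp [U, h.ne', not_lt.mpr h.le]⟩
  let Q : T := MvPolynomial.aeval (fun p => translateBy U H p.1 p.2.1 p.2.2) P
    - MvPolynomial.aeval (fun p => H p.1 p.2.1 p.2.2) P
  have hQ : ∀ {A : Type} [Field A] [Algebra ℂ A] (φ : T →ₐ[ℂ] A), φ Q
      = MvPolynomial.aeval (fun p => translateBy (fun l => (U l).map φ.toRingHom)
          (fun l => (H l).map φ.toRingHom) p.1 p.2.1 p.2.2) P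
        - MvPolynomial.aeval (fun p => (H p.1).map φ.toRingHom p.2.1 p.2.2) P := by
    intro A _ _ φ
    simp only [Q]
    rw [map_sub, ← AlgHom.comp_apply, ← AlgHom.comp_apply, MvPolynomial.comp_aeval,
      MvPolynomial.comp_aeval]
    congr 3
    funext p
    rw [translateBy_map hU]
    rfl
  -- At every complex point `Q` vanishes by the assumed invariance, and a polynomial over an
  -- infinite field is determined by its values.
  have hQ0 : Q = 0 := by
    apply MvPolynomial.funext
    intro z
    rw [map_zero, ← MvPolynomial.coe_aeval_eq_eval]
    change (MvPolynomial.aeval z : T →ₐ[ℂ] ℂ) Q = 0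
    rw [hQ, sub_eq_zero]
    generalize hφ : (MvPolynomial.aeval z : T →ₐ[ℂ] ℂ).toRingHom = φ
    let u' : Fin (k + 1) → GL (Fin n) ℂ := fun l =>
      Matrix.GeneralLinearGroup.mkOfDetNeZero ((U l).map φ) (by
        rw [((hU l).map φ).det]
        exact one_ne_zero)
    have hu' : ∀ l, IsUnipotentUpper (u' l) := fun l => (hU l).map φ
    have h1 := congrArg (MvPolynomial.aeval fun p : Fin k × Fin n × Fin n =>
      (H p.1).map φ p.2.1 p.2.2) (hP u' hu')
    rw [actPoly, ← AlgHom.comp_apply, MvPolynomial.comp_aeval] at h1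
    rw [← h1]
    congr 2
    funext p
    rw [translate_eq_translateBy hu']
    have h2 := translateBy_map (fun l => (hu' l).isUnitriangular.map MvPolynomial.C)
      (MvPolynomial.aeval fun p : Fin k × Fin n × Fin n =>
      (H p.1).map φ p.2.1 p.2.2 : PolyRing n k →ₐ[ℂ] ℂ).toRingHom (genericPoly n k) p.1
    have h3 := congrFun (congrFun h2 p.2.1) p.2.2
    refine Eq.trans ?_ h3
    congr 3
    · funext l
      ext i j
      simp [u', Matrix.GeneralLinearGroup.mkOfDetNeZero, Matrix.GeneralLinearGroup.mk']
      rfl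
    · funext l
      ext i j
      simp [genericPoly]
  have h := hQ (MvPolynomial.aeval (Sum.elim (fun p => u p.1 p.2.1 p.2.2)
    fun p => g p.1 p.2.1 p.2.2) : T →ₐ[ℂ] L)
  rw [hQ0, map_zero, eq_comm, sub_eq_zero] at h
  have e1 : (fun l => (U l).map (MvPolynomial.aeval (Sum.elim (fun p => u p.1 p.2.1 p.2.2)
    fun p => g p.1 p.2.1 p.2.2) : T →ₐ[ℂ] L).toRingHom) = u := by
    funext l
    ext i j
    simp only [U, Matrix.map_apply, Matrix.of_apply]
    split_ifs with h1 h2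
    · simp
    · subst h2
      rw [(hu l).1, map_one]
    · rw [(hu l).2 i j (lt_of_le_of_ne (not_lt.mp h1) (Ne.symm h2)), map_zero]
  have e2 : (fun l => (H l).map (MvPolynomial.aeval (Sum.elim (fun p => u p.1 p.2.1 p.2.2)
    fun p => g p.1 p.2.1 p.2.2) : T →ₐ[ℂ] L).toRingHom) = g := by
    funext l
    ext i j
    simp [H]
  rw [e1, e2] at h
  rw [h]
  congr 2
  funext p
  exact (congrFun (congrFun (congrFun e2 p.1) p.2.1) p.2.2)

/-- The product of the determinants of the generic matrices. -/
def detProd (n k : ℕ) : PolyRing n k := ∏ l, (genericPoly n k l).det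

theorem det_partialProd_last {R : Type} [CommRing R] (g : Fin k → Matrix (Fin n) (Fin n) R) :
    (Fin.partialProd g (Fin.last k)).det = ∏ l, (g l).det := by
  induction k with
  | zero => simp
  | succ k ih =>
    rw [← Fin.succ_last, Fin.partialProd_succ', Matrix.det_mul, Fin.prod_univ_succ, ih]
    rfl

theorem det_genericPoly_ne_zero (l : Fin k) : (genericPoly n k l).det ≠ 0 := by
  intro h
  have h1 := congrArg (MvPolynomial.eval fun p : Fin k × Fin n × Fin n =>
    (1 : Matrix (Fin n) (Fin n) ℂ) p.2.1 p.2.2) h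
  rw [RingHom.map_det, map_zero] at h1
  have h2 : (MvPolynomial.eval fun p : Fin k × Fin n × Fin n =>
      (1 : Matrix (Fin n) (Fin n) ℂ) p.2.1 p.2.2).mapMatrix (genericPoly n k l) = 1 := by
    ext i j
    simp [genericPoly]
  rw [h2, Matrix.det_one] at h1
  exact one_ne_zero h1

/-- All denominators are powers of the determinants and are cleared by a power of their product. -/
theorem exists_mem_regularRing {f : RatField n k} (hf : f ∈ regularRing n k) :
    ∃ (P : PolyRing n k) (m : ℕ), f * algebraMap _ (RatField n k) (detProd n k) ^ m
      = algebraMap _ (RatField n k) P := by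
  induction hf using Algebra.adjoin_induction with
  | mem f hf =>
    rcases hf with ⟨l, i, j, rfl⟩ | ⟨l, rfl⟩
    · exact ⟨genericPoly n k l i j, 0, by rw [pow_zero, mul_one]; rfl⟩
    · refine ⟨∏ l' ∈ Finset.univ.erase l, (genericPoly n k l').det, 1, ?_⟩
      have h1 : (generic n k l).det = algebraMap _ (RatField n k) (genericPoly n k l).det := by
        rw [RingHom.map_det]
        rfl
      have h2 : (generic n k l).det ≠ 0 := by
        rw [h1]
        exact fun h => det_genericPoly_ne_zero l
          (IsFractionRing.injective (PolyRing n k) (RatField n k) (h.trans (map_zero _).symm))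
      rw [pow_one, detProd, ← Finset.mul_prod_erase _ _ (Finset.mem_univ l), map_mul, ← h1,
        inv_mul_cancel_left₀ h2]
  | algebraMap c => exact ⟨MvPolynomial.C c, 0, by rw [pow_zero, mul_one]; rfl⟩
  | add f g _ _ hf hg =>
    obtain ⟨P, m, hP⟩ := hf
    obtain ⟨Q, m', hQ⟩ := hg
    refine ⟨P * detProd n k ^ m' + Q * detProd n k ^ m, m + m', ?_⟩
    rw [map_add, map_mul, map_mul, ← hP, ← hQ, map_pow, map_pow]
    ring
  | mul f g _ _ hf hg =>
    obtain ⟨P, m, hP⟩ := hf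
    obtain ⟨Q, m', hQ⟩ := hg
    refine ⟨P * Q, m + m', ?_⟩
    rw [map_mul, ← hP, ← hQ]
    ring

end Invariants

/-! ### Laurent polynomials -/

section LaurentPolynomials

variable {ι : Type} [Fintype ι] {B : Type} [CommRing B] [Algebra ℂ B]

/-- The elements that become polynomials in `z` after multiplication with a power of the product of
all `zᵢ`. -/
def laurentSubalgebra (z : ι → B) : Subalgebra ℂ B where
  carrier := {f | ∃ (m : ℕ) (P : MvPolynomial ι ℂ), f * (∏ i, z i) ^ m = MvPolynomial.aeval z P}
  mul_mem' := by
    rintro f g ⟨m, P, hP⟩ ⟨m', Q, hQ⟩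
    refine ⟨m + m', P * Q, ?_⟩
    rw [map_mul, ← hP, ← hQ]
    ring
  add_mem' := by
    rintro f g ⟨m, P, hP⟩ ⟨m', Q, hQ⟩
    refine ⟨m + m', P * (∏ i, MvPolynomial.X i) ^ m' + Q * (∏ i, MvPolynomial.X i) ^ m, ?_⟩
    simp only [map_add, map_mul, map_pow, map_prod, MvPolynomial.aeval_X, ← hP, ← hQ]
    ring
  algebraMap_mem' c := ⟨0, MvPolynomial.C c, by simp⟩

theorem coord_mem_laurentSubalgebra (z : ι → B) (i : ι) : z i ∈ laurentSubalgebra z :=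
  ⟨0, MvPolynomial.X i, by simp⟩

/-- Multiplied by the product of all coordinates, the inverse becomes the product of the other ones.
-/
theorem mem_laurentSubalgebra_of_mul_eq_one {z : ι → B} {i : ι} {w : B} (h : w * z i = 1) :
    w ∈ laurentSubalgebra z := by
  classical
  refine ⟨1, ∏ j ∈ Finset.univ.erase i, MvPolynomial.X j, ?_⟩
  rw [map_prod, pow_one, ← Finset.mul_prod_erase _ _ (Finset.mem_univ i), ← mul_assoc, h, one_mul]
  simp

/-- The coordinates on the torus, as units. -/
def Laurent.unit (i : ι) : (Laurent ι)ˣ where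
  val := Laurent.X i
  inv := AddMonoidAlgebra.single (Finsupp.single i (-1)) 1
  val_inv := by
    rw [Laurent.X, AddMonoidAlgebra.single_mul_single, ← Finsupp.single_add]
    simp [AddMonoidAlgebra.one_def]
  inv_val := by
    rw [Laurent.X, AddMonoidAlgebra.single_mul_single, ← Finsupp.single_add]
    simp [AddMonoidAlgebra.one_def]

theorem laurentSubalgebra_X : laurentSubalgebra (Laurent.X : ι → Laurent ι) = ⊤ := by
  have h1 : ∀ a : ι →₀ ℤ, (AddMonoidAlgebra.single a 1 : Laurent ι)
      ∈ laurentSubalgebra (Laurent.X : ι → Laurent ι) := by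
    intro a
    induction a using Finsupp.induction_linear with
    | zero => exact one_mem _
    | add a b ha hb =>
      have := mul_mem ha hb
      rwa [AddMonoidAlgebra.single_mul_single, one_mul] at this
    | single i e =>
      have hpow : ∀ (c : ℤ) (m : ℕ),
          (AddMonoidAlgebra.single (Finsupp.single i (m * c)) 1 : Laurent ι)
          = AddMonoidAlgebra.single (Finsupp.single i c) 1 ^ m := by
        intro c m
        rw [AddMonoidAlgebra.single_pow, one_pow, Finsupp.smul_single, nsmul_eq_mul]
      obtain ⟨m, rfl | rfl⟩ := e.eq_nat_or_neg
      · have := hpow 1 m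
        rw [mul_one] at this
        rw [this]
        exact pow_mem (coord_mem_laurentSubalgebra _ i) m
      · have := hpow (-1) m
        rw [mul_neg, mul_one] at this
        rw [this]
        exact pow_mem (mem_laurentSubalgebra_of_mul_eq_one (i := i) (Laurent.unit i).inv_val) m
  refine eq_top_iff.mpr fun p _ => ?_
  induction p using AddMonoidAlgebra.induction_linear with
  | zero => exact zero_mem _
  | add p q hp hq => exact add_mem (hp trivial) (hq trivial)
  | single a c =>
    have := Subalgebra.smul_mem _ (h1 a) c
    rwa [AddMonoidAlgebra.smul_single, smul_eq_mul, mul_one] at this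

/-- The evaluation of Laurent polynomials at units. -/
def evalLaurent (z : ι → Bˣ) : Laurent ι →ₐ[ℂ] B :=
  AddMonoidAlgebra.lift ℂ B (ι →₀ ℤ)
    { toFun := fun a => ((∏ i, z i ^ (a.toAdd i) : Bˣ) : B)
      map_one' := by simp
      map_mul' := fun a b => by
        simp only [toAdd_mul, Finsupp.add_apply, zpow_add, Finset.prod_mul_distrib, Units.val_mul] }

theorem evalLaurent_X (z : ι → Bˣ) (i : ι) : evalLaurent z (Laurent.X i) = z i := by
  classical
  rw [evalLaurent, Laurent.X, AddMonoidAlgebra.lift_single, one_smul]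
  simp only [MonoidHom.coe_mk, OneHom.coe_mk, toAdd_ofAdd, Units.val_inj]
  rw [Finset.prod_eq_single i]
  · simp
  · intro j _ hj
    rw [Finsupp.single_eq_of_ne hj, zpow_zero]
  · simp

theorem evalLaurent_aeval (z : ι → Bˣ) (P : MvPolynomial ι ℂ) :
    evalLaurent z (MvPolynomial.aeval Laurent.X P) = MvPolynomial.aeval (fun i => (z i : B)) P := by
  rw [MvPolynomial.comp_aeval_apply]
  simp only [evalLaurent_X]

theorem exists_mul_prod_pow_eq (p : Laurent ι) : ∃ (m : ℕ) (P : MvPolynomial ι ℂ),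
    p * ((∏ i, Laurent.unit i : (Laurent ι)ˣ) : Laurent ι) ^ m
      = MvPolynomial.aeval Laurent.X P := by
  have h : p ∈ laurentSubalgebra (Laurent.X : ι → Laurent ι) := by
    rw [laurentSubalgebra_X]; trivial
  obtain ⟨m, P, hP⟩ := h
  refine ⟨m, P, ?_⟩
  rw [← hP, Units.coe_prod]
  rfl

theorem laurent_algHom_ext {f g : Laurent ι →ₐ[ℂ] B}
    (h : ∀ i, f (Laurent.X i) = g (Laurent.X i)) : f = g := by
  refine AlgHom.ext fun p => ?_
  obtain ⟨m, P, hP⟩ := exists_mul_prod_pow_eq p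
  have hX : ∀ P : MvPolynomial ι ℂ, f (MvPolynomial.aeval Laurent.X P)
      = g (MvPolynomial.aeval Laurent.X P) := by
    intro P
    rw [MvPolynomial.comp_aeval_apply, MvPolynomial.comp_aeval_apply]
    simp only [h]
  have hu : f ((∏ i, Laurent.unit i : (Laurent ι)ˣ) : Laurent ι)
      = g ((∏ i, Laurent.unit i : (Laurent ι)ˣ) : Laurent ι) := by
    rw [Units.coe_prod, map_prod, map_prod]
    exact Finset.prod_congr rfl fun i _ => h i
  have := hX P
  rw [← hP, map_mul, map_mul, map_pow, map_pow, hu] at this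
  exact ((((∏ i, Laurent.unit i : (Laurent ι)ˣ).isUnit.map g).pow m).mul_left_inj).mp this

/-- A monomial unit turns a Laurent polynomial into a polynomial, for which this is algebraic
independence. -/
theorem evalLaurent_injective (z : ι → Bˣ)
    (hz : AlgebraicIndependent ℂ fun i => (z i : B)) : Function.Injective (evalLaurent z) := by
  rw [injective_iff_map_eq_zero]
  intro p hp
  obtain ⟨m, P, hP⟩ := exists_mul_prod_pow_eq p
  have h0 := evalLaurent_aeval z P
  rw [← hP, map_mul, hp, zero_mul] at h0
  rw [hz.eq_zero_of_aeval_eq_zero P h0.symm, map_zero] at hP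
  exact (((∏ i, Laurent.unit i : (Laurent ι)ˣ).isUnit.pow m).mul_left_eq_zero).mp hP

end LaurentPolynomials

/-! ### Chains of prime ideals -/

section Chains

variable {k A : Type} [Field k] [CommRing A] [Algebra k A]

/-- Elements `aᵢ ∈ pᵢ₊₁ \ pᵢ` for a chain of prime ideals are algebraically independent, even
modulo `p₀`. -/
theorem eq_zero_of_aeval_mem : ∀ {m : ℕ} (p : Fin (m + 1) → Ideal A) (_ : ∀ i, (p i).IsPrime)
    (a : Fin m → A) (_ : ∀ i : Fin m, p i.castSucc ≤ p i.succ)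
    (_ : ∀ i : Fin m, a i ∈ p i.succ) (_ : ∀ i : Fin m, a i ∉ p i.castSucc)
    (P : MvPolynomial (Fin m) k), MvPolynomial.aeval a P ∈ p 0 → P = 0
  | 0, p, hp, a, _, _, _, P, hP => by
    rw [MvPolynomial.eq_C_of_isEmpty P] at hP ⊢
    rw [MvPolynomial.aeval_C] at hP
    by_contra h
    have h' : P.coeff 0 ≠ 0 := fun h0 => h (by rw [h0, MvPolynomial.C_0])
    exact (hp 0).ne_top (Ideal.eq_top_of_isUnit_mem _ hP ((IsUnit.mk0 _ h').map _))
  | m + 1, p, hp, a, hle, ha, ha', P, hP => by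
    have hev : ∀ P : MvPolynomial (Fin (m + 1)) k, MvPolynomial.aeval a P
        = Polynomial.eval₂ (MvPolynomial.aeval (fun i => a (Fin.succ i)) :
            MvPolynomial (Fin m) k →ₐ[k] A).toRingHom (a 0) (MvPolynomial.finSuccEquiv k m P) := by
      intro P
      induction P using MvPolynomial.induction_on with
      | C c => simp [MvPolynomial.finSuccEquiv_apply]
      | add P Q hP hQ => simp only [map_add, hP, hQ, Polynomial.eval₂_add]
      | mul_X P i hP =>
        rw [map_mul, map_mul, Polynomial.eval₂_mul, hP]
        congr 1
        refine Fin.cases ?_ (fun j => ?_) i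
        · simp [MvPolynomial.finSuccEquiv_X_zero]
        · simp [MvPolynomial.finSuccEquiv_X_succ]
    -- Since `a 0` lies in `p 1`, so does the value of the constant coefficient, which is zero by
    -- induction on the chain. What remains is divisible by `a 0`, which is not in the prime `p 0`;
    -- cancelling it lowers the degree.
    have key : ∀ (N : ℕ) (f : Polynomial (MvPolynomial (Fin m) k)), f.natDegree < N →
        Polynomial.eval₂ (MvPolynomial.aeval (fun i => a (Fin.succ i)) :
            MvPolynomial (Fin m) k →ₐ[k] A).toRingHom (a 0) f ∈ p 0 → f = 0 := by
      intro N
      induction N with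
      | zero => intro f hf; omega
      | succ N ih =>
        intro f hN hf
        have hdec := f.divX_mul_X_add
        have h0 : f.coeff 0 = 0 := by
          refine eq_zero_of_aeval_mem (fun i => p i.succ) (fun i => hp _) (fun i => a i.succ)
            (fun i => hle i.succ) (fun i => ha i.succ) (fun i => ha' i.succ) _ ?_
          have h1 := hle 0 hf
          rw [← hdec, Polynomial.eval₂_add, Polynomial.eval₂_mul, Polynomial.eval₂_X,
            Polynomial.eval₂_C] at h1
          exact (Ideal.add_mem_iff_right _ (Ideal.mul_mem_left _ _ (ha 0))).mp h1
        rw [h0, Polynomial.C_0, add_zero] at hdec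
        rw [← hdec, Polynomial.eval₂_mul, Polynomial.eval₂_X] at hf
        have hmem := ((hp 0).mem_or_mem hf).resolve_right (ha' 0)
        rcases Nat.eq_zero_or_pos f.natDegree with hd | hd
        · rw [Polynomial.eq_C_of_natDegree_eq_zero hd, h0, Polynomial.C_0]
        · rw [← hdec, ih f.divX (by rw [Polynomial.natDegree_divX_eq_natDegree_tsub_one]; omega)
            hmem, zero_mul]
    rw [hev] at hP
    exact (MvPolynomial.finSuccEquiv k m).injective
      ((key _ _ (Nat.lt_succ_self _) hP).trans (map_zero _).symm)

/-- Elements chosen from the successive differences of a chain of primes are algebraically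
independent, so the transcendence degree bounds its length. -/
theorem ringKrullDim_le_of_trdeg_le {d : ℕ} (h : Algebra.trdeg k A ≤ d) : ringKrullDim A ≤ d := by
  refine iSup_le fun c => ?_
  have hc : ∀ i : Fin c.length, c i.castSucc < c i.succ := c.step
  have hne : ∀ i : Fin c.length, ∃ a ∈ (c i.succ).asIdeal, a ∉ (c i.castSucc).asIdeal := fun i =>
    Set.not_subset.mp fun hle => (hc i).not_ge hle
  choose a ha ha' using hne
  have hind : AlgebraicIndependent k a := by
    rw [algebraicIndependent_iff]
    intro P hP
    exact eq_zero_of_aeval_mem (fun i => (c i).asIdeal) (fun i => (c i).isPrime) a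
      (fun i => (hc i).le) ha ha' P (by rw [hP]; exact zero_mem _)
  have hle := hind.lift_cardinalMk_le_trdeg.trans (Cardinal.lift_le.mpr h)
  simp only [Cardinal.mk_fin, Cardinal.lift_natCast, Nat.cast_le] at hle
  exact_mod_cast hle

end Chains

/-! ### Toric charts from algebraically independent coordinates -/

section ChartCriterion

variable {K : Type} [Field K] [Algebra ℂ K] {ι : Type} [Fintype ι] {y : ι → K}
  {A : Subalgebra ℂ K}

theorem exists_algHom_laurent (hy : AlgebraicIndependent ℂ y) (hA : A ≤ laurentSubalgebra y) :
    ∃ θ : A →ₐ[ℂ] Laurent ι, ∀ a : A,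
      evalLaurent (fun i => Units.mk0 (y i) (hy.ne_zero i)) (θ a) = a := by
  set ev := evalLaurent (fun i => Units.mk0 (y i) (hy.ne_zero i)) with hev
  have hinj : Function.Injective ev := evalLaurent_injective _ hy
  have hle : A ≤ ev.range := by
    intro a ha
    obtain ⟨m, P, hP⟩ := hA ha
    have hu : ev ((∏ i, Laurent.unit i : (Laurent ι)ˣ) : Laurent ι) = ∏ i, y i := by
      rw [Units.coe_prod, map_prod]
      exact Finset.prod_congr rfl fun i _ => evalLaurent_X _ i
    refine ⟨MvPolynomial.aeval Laurent.X P
      * (((∏ i, Laurent.unit i)⁻¹ : (Laurent ι)ˣ) : Laurent ι) ^ m, ?_⟩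
    have h0 : (∏ i, y i) ≠ 0 := Finset.prod_ne_zero_iff.mpr fun i _ => hy.ne_zero i
    have hinv : ev (((∏ i, Laurent.unit i)⁻¹ : (Laurent ι)ˣ) : Laurent ι) * ∏ i, y i = 1 := by
      rw [← hu, ← map_mul, Units.inv_mul, map_one]
    change ev _ = a
    rw [map_mul, map_pow, hev, evalLaurent_aeval, ← hev]
    simp only [Units.val_mk0]
    change MvPolynomial.aeval y P * _ = a
    rw [← hP, mul_assoc, ← mul_pow, mul_comm (∏ i, y i), hinv, one_pow, mul_one]
  refine ⟨(AlgEquiv.ofInjective ev hinj).symm.toAlgHom.comp (Subalgebra.inclusion hle), fun a => ?_⟩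
  have := (AlgEquiv.ofInjective ev hinj).apply_symm_apply (Subalgebra.inclusion hle a)
  exact congrArg Subtype.val this

/-- The ring of Laurent polynomials is the localization of `A` at the product of the coordinates, so
the torus is a principal open subset. -/
theorem isToricChart_of_le (hy : AlgebraicIndependent ℂ y) (hyA : ∀ i, y i ∈ A)
    (hA : A ≤ laurentSubalgebra y) : IsToricChart A y := by
  obtain ⟨θ, hθ⟩ := exists_algHom_laurent hy hA
  have hinj := evalLaurent_injective (fun i => Units.mk0 (y i) (hy.ne_zero i)) hy
  have hX : ∀ i, θ ⟨y i, hyA i⟩ = Laurent.X i := fun i => hinj (by rw [hθ, evalLaurent_X]; rfl)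
  have hθinj : Function.Injective θ := fun a b hab => Subtype.ext (by rw [← hθ a, ← hθ b, hab])
  refine ⟨fun i => ⟨y i, hyA i, 1, one_mem _, one_ne_zero, (div_one _).symm⟩, θ, ?_, ?_⟩
  · algebraize [(θ : A →+* Laurent ι)]
    have hprod : θ (∏ i, ⟨y i, hyA i⟩) = ((∏ i, Laurent.unit i : (Laurent ι)ˣ) : Laurent ι) := by
      rw [map_prod, Units.coe_prod]
      exact Finset.prod_congr rfl fun i _ => hX i
    have hloc : IsLocalization.Away (∏ i, ⟨y i, hyA i⟩ : A) (Laurent ι) := by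
      refine IsLocalization.Away.mk _ ?_ (fun p => ?_) (fun a b hab => ⟨0, ?_⟩)
      · change IsUnit (θ _)
        rw [hprod]
        exact Units.isUnit _
      · obtain ⟨m, P, hP⟩ := exists_mul_prod_pow_eq p
        refine ⟨m, MvPolynomial.aeval (fun i => (⟨y i, hyA i⟩ : A)) P, ?_⟩
        change p * θ _ ^ m = θ _
        rw [hprod, hP, MvPolynomial.comp_aeval_apply]
        simp only [hX]
      · rw [hθinj hab]
    exact AlgebraicGeometry.IsOpenImmersion.of_isLocalization (∏ i, ⟨y i, hyA i⟩ : A)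
  · intro i p q hpq
    apply hinj
    rw [map_mul, hθ, hθ, evalLaurent_X]
    exact hpq

theorem ringKrullDim_eq_card (hy : AlgebraicIndependent ℂ y) (hyA : ∀ i, y i ∈ A)
    (hA : A ≤ laurentSubalgebra y) : ringKrullDim A = Fintype.card ι := by
  classical
  apply le_antisymm
  · refine ringKrullDim_le_of_trdeg_le (k := ℂ) ?_
    set s : Set A := Set.range fun i => (⟨y i, hyA i⟩ : A) with hs
    have halg : Algebra.IsAlgebraic (Algebra.adjoin ℂ s) A := by
      refine ⟨fun a => ?_⟩
      obtain ⟨m, P, hP⟩ := hA a.2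
      have hmem : ∀ Q : MvPolynomial ι ℂ,
          MvPolynomial.aeval (fun i => (⟨y i, hyA i⟩ : A)) Q ∈ Algebra.adjoin ℂ s := by
        intro Q
        rw [hs, Algebra.adjoin_range_eq_range_aeval]
        exact ⟨Q, rfl⟩
      have hval : ∀ Q : MvPolynomial ι ℂ,
          ((MvPolynomial.aeval (fun i => (⟨y i, hyA i⟩ : A)) Q : A) : K)
            = MvPolynomial.aeval y Q := by
        intro Q
        exact MvPolynomial.comp_aeval_apply (φ := A.val) _ Q
      have h0 : (⟨_, hmem ((∏ i, MvPolynomial.X i) ^ m)⟩ : Algebra.adjoin ℂ s) ≠ 0 := by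
        intro h
        have h1 : ((MvPolynomial.aeval (fun i => (⟨y i, hyA i⟩ : A)) ((∏ i, MvPolynomial.X i) ^ m) :
            A) : K) = 0 := congrArg (fun r : Algebra.adjoin ℂ s => ((r : A) : K)) h
        rw [hval, map_pow, map_prod] at h1
        simp only [MvPolynomial.aeval_X] at h1
        exact pow_ne_zero m (Finset.prod_ne_zero_iff.mpr fun i _ => hy.ne_zero i) h1
      -- The Laurent expression of `a`, cleared of denominators, is a linear equation for `a` over
      -- the polynomials in the coordinates.
      refine ⟨Polynomial.C ⟨_, hmem ((∏ i, MvPolynomial.X i) ^ m)⟩ * Polynomial.X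
        - Polynomial.C ⟨_, hmem P⟩, ?_, ?_⟩
      · intro h
        have h1 := congrArg (fun p => Polynomial.coeff p 1) h
        simp only [Polynomial.coeff_sub, Polynomial.coeff_C_mul, Polynomial.coeff_X_one, mul_one,
          Polynomial.coeff_C_succ, sub_zero, Polynomial.coeff_zero] at h1
        exact h0 h1
      · rw [map_sub, map_mul, Polynomial.aeval_C, Polynomial.aeval_C, Polynomial.aeval_X,
          sub_eq_zero]
        apply Subtype.ext
        change ((MvPolynomial.aeval (fun i => (⟨y i, hyA i⟩ : A)) ((∏ i, MvPolynomial.X i) ^ m) : A)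
          : K) * a = ((MvPolynomial.aeval (fun i => (⟨y i, hyA i⟩ : A)) P : A) : K)
        rw [hval, hval, ← hP, map_pow, map_prod, mul_comm]
        simp only [MvPolynomial.aeval_X]
    refine (Algebra.IsAlgebraic.trdeg_le_cardinalMk ℂ s).trans ?_
    refine Cardinal.mk_range_le.trans ?_
    rw [Cardinal.mk_fintype]
  · obtain ⟨θ, hθ⟩ := exists_algHom_laurent hy hA
    have hinj := evalLaurent_injective (fun i => Units.mk0 (y i) (hy.ne_zero i)) hy
    have hX : ∀ i, θ ⟨y i, hyA i⟩ = Laurent.X i := fun i => hinj (by rw [hθ, evalLaurent_X]; rfl)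
    have hX1 : ∀ i, (Laurent.X i : Laurent ι) ≠ 1 := by
      intro i h
      have h1 := congrArg (evalLaurent (fun i => Units.mk0 (y i) (hy.ne_zero i))) h
      rw [evalLaurent_X, map_one, Units.val_mk0] at h1
      exact hy.transcendental i (h1 ▸ isAlgebraic_one)
    have hdom : IsDomain (Laurent ι) := hinj.isDomain _
    let e := Fintype.equivFin ι
    -- Specialization `j` sets the first `j` coordinates to 1. The kernels form a chain of primes,
    -- and consecutive ones are separated by `y i - 1` for the coordinate that is set next.
    let z : ℕ → ι → (Laurent ι)ˣ := fun j i => if (e i : ℕ) < j then 1 else Laurent.unit i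
    let σ : ℕ → A →ₐ[ℂ] Laurent ι := fun j => (evalLaurent (z j)).comp θ
    have hz : ∀ j, (evalLaurent (z (j + 1))).comp (evalLaurent (z j))
        = evalLaurent (z (j + 1)) := by
      intro j
      refine laurent_algHom_ext fun i => ?_
      rw [AlgHom.comp_apply, evalLaurent_X, evalLaurent_X]
      by_cases h : (e i : ℕ) < j
      · simp [z, h, Nat.lt_succ_of_lt h]
      · simp only [z, if_neg h]
        exact evalLaurent_X _ i
    let p : ℕ → PrimeSpectrum A := fun j => ⟨RingHom.ker (σ j), RingHom.ker_isPrime _⟩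
    have hlt : ∀ j < Fintype.card ι, p j < p (j + 1) := by
      intro j hj
      refine lt_of_le_not_ge ?_ ?_
      · intro a ha
        change σ (j + 1) a = 0
        have ha' : evalLaurent (z j) (θ a) = 0 := ha
        change evalLaurent (z (j + 1)) (θ a) = 0
        rw [← hz, AlgHom.comp_apply, ha', map_zero]
      · intro hle
        let i := e.symm ⟨j, hj⟩
        have hei : (e i : ℕ) = j := by simp [i]
        have hs : ∀ t, σ t (⟨y i, hyA i⟩ - 1) = z t i - 1 := by
          intro t
          change evalLaurent (z t) (θ _) = _
          rw [map_sub, hX, map_one, map_sub, evalLaurent_X, map_one]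
        have h1 : σ (j + 1) (⟨y i, hyA i⟩ - 1) = 0 := by
          rw [hs]; simp [z, hei]
        have h2 : σ j (⟨y i, hyA i⟩ - 1) = 0 := hle h1
        rw [hs] at h2
        simp only [z, hei, lt_irrefl, if_false] at h2
        exact hX1 i (sub_eq_zero.mp h2)
    let c : LTSeries (PrimeSpectrum A) :=
      { length := Fintype.card ι
        toFun := fun j => p j
        step := fun j => hlt j j.2 }
    exact Order.LTSeries.length_le_krullDim c

end ChartCriterion

/-! ### The chart of consecutive minors -/

section QuotientChart

variable {n k : ℕ}

theorem finite_consecutiveIndex (n k : ℕ) : (consecutiveIndex n k).Finite := by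
  refine Set.Finite.subset (((Finset.range k ×ˢ Finset.range (n + 1) ×ˢ
    Finset.range (n + 1)).finite_toSet).image fun s => facePoint k s.1 s.2.1 s.2.2) ?_
  rintro _ ⟨l, i, j, hl, -, hij, rfl⟩
  refine ⟨(l, i, j), ?_, rfl⟩
  simp only [Finset.coe_product, Finset.coe_range, Set.mem_prod, Set.mem_Iio]
  omega

instance : Fintype (consecutiveIndex n k) := (finite_consecutiveIndex n k).fintype

theorem facePoint_zero_zero (l : ℕ) : facePoint k l 0 0 = 0 := by
  funext m
  simp [facePoint]

theorem zero_notMem_consecutiveIndex : (0 : Fin k → ℕ) ∉ consecutiveIndex n k := by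
  rintro ⟨l, i, j, hl, h0, -, h⟩
  have := sum_facePoint (i := i) (j := j) hl
  rw [← h] at this
  simp at this
  omega

theorem cornerMinor_zero {R : Type} [CommRing R] (g : Fin k → Matrix (Fin n) (Fin n) R)
    (hk : 2 ≤ k) : cornerMinor g 0 = 1 := by
  rw [← facePoint_zero_zero 0, cornerMinor_facePoint g (by omega) (by omega), tripleDet]
  have := listDet_colSeq_one (R := R) (p := n) (m := 0) rfl []
  simpa using this

/-- The denominators of regular functions on the product of general linear groups are thereby powers
of a multi-corner minor on a face. -/
theorem cornerMinor_facePoint_last {R : Type} [CommRing R]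
    (g : Fin k → Matrix (Fin n) (Fin n) R) (hk : 2 ≤ k) :
    cornerMinor g (facePoint k (k - 2) 0 n) = ∏ l, (g l).det := by
  have hlast : (⟨k - 2 + 2, by omega⟩ : Fin (k + 1)) = Fin.last k := Fin.ext (by simp; omega)
  rw [cornerMinor_facePoint g (by omega) (by omega), tripleDet, hlast, ← det_partialProd_last]
  simp only [zero_add, Nat.sub_self, cols_zero, List.nil_append, listDet]
  congr 1
  ext r c
  rw [Matrix.of_apply, getD_cols _ c.2, colSeq_of_lt]

/-- By `exists_cornerMinor_eq` there is a tuple over a rational function field whose multi-corner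
minors on the faces are the variables. Specializing the generic tuple to it carries any relation to
a relation among variables. -/
theorem algebraicIndependent_consecutive (hk : 2 ≤ k) :
    AlgebraicIndependent ℂ fun α : consecutiveIndex n k => cornerMinor (generic n k) α := by
  classical
  rw [algebraicIndependent_iff]
  intro P hP
  let S := MvPolynomial (consecutiveIndex n k) ℂ
  let L := FractionRing S
  let x : (Fin k → ℕ) → L := fun α =>
    if h : α ∈ consecutiveIndex n k then algebraMap S L (MvPolynomial.X ⟨α, h⟩) else 1
  have hx : ∀ α, x α ≠ 0 := by
    intro α
    by_cases h : α ∈ consecutiveIndex n k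
    · simp only [x, dif_pos h]
      exact fun h0 => MvPolynomial.X_ne_zero _
        (IsFractionRing.injective S L (h0.trans (map_zero _).symm))
    · simp only [x, dif_neg h]
      exact one_ne_zero
  obtain ⟨g, hg⟩ := exists_cornerMinor_eq (n := n) hk x hx (dif_neg zero_notMem_consecutiveIndex)
  let φ : PolyRing n k →ₐ[ℂ] L := MvPolynomial.aeval fun p => g p.1 p.2.1 p.2.2
  have hφ : ∀ α : consecutiveIndex n k, φ (cornerMinor (genericPoly n k) α)
      = algebraMap S L (MvPolynomial.X α) := by
    rintro ⟨α, hα⟩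
    have h1 := cornerMinor_map φ.toRingHom (genericPoly n k) α
    have h2 : (fun l => (genericPoly n k l).map φ.toRingHom) = g := by
      funext l
      ext i j
      simp [genericPoly, φ]
    rw [h2] at h1
    change φ.toRingHom _ = _
    rw [← h1]
    obtain ⟨l, i, j, hl, h0, hij, rfl⟩ := hα
    rw [hg l i j hl hij]
    exact dif_pos _
  have h1 : algebraMap (PolyRing n k) (RatField n k)
      (MvPolynomial.aeval (fun α : consecutiveIndex n k => cornerMinor (genericPoly n k) α) P)
        = 0 := by
    rw [← hP]
    simp only [cornerMinor_generic]
    exact MvPolynomial.comp_aeval_apply (φ := Algebra.algHom ℂ (PolyRing n k) (RatField n k)) _ P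
  have h2 : MvPolynomial.aeval
      (fun α : consecutiveIndex n k => cornerMinor (genericPoly n k) α) P = 0 :=
    IsFractionRing.injective (PolyRing n k) (RatField n k) (h1.trans (map_zero _).symm)
  have h3 := congrArg φ h2
  rw [MvPolynomial.comp_aeval_apply, map_zero] at h3
  simp only [hφ] at h3
  have h4 : algebraMap S L (MvPolynomial.aeval MvPolynomial.X P) = 0 := by
    rw [← h3]
    exact MvPolynomial.comp_aeval_apply (φ := Algebra.algHom ℂ S L) _ P
  rw [MvPolynomial.aeval_X_left_apply] at h4
  exact IsFractionRing.injective S L (h4.trans (map_zero _).symm)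

theorem generic_facePoint_cases (hk : 2 ≤ k) {l i j : ℕ} (hl : l + 2 ≤ k) (hij : i + j ≤ n) :
    cornerMinor (generic n k) (facePoint k l i j) = 1 ∨
      ∃ α : consecutiveIndex n k, cornerMinor (generic n k) (facePoint k l i j)
        = cornerMinor (generic n k) α := by
  rcases Nat.eq_zero_or_pos (i + j) with h | h
  · obtain ⟨rfl, rfl⟩ : i = 0 ∧ j = 0 := by omega
    left
    rw [facePoint_zero_zero, cornerMinor_zero _ hk]
  · exact Or.inr ⟨⟨_, l, i, j, hl, h, hij, rfl⟩, rfl⟩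

theorem generic_facePoint_ne_zero (hk : 2 ≤ k) {l i j : ℕ} (hl : l + 2 ≤ k) (hij : i + j ≤ n) :
    cornerMinor (generic n k) (facePoint k l i j) ≠ 0 := by
  rcases generic_facePoint_cases hk hl hij with h | ⟨α, h⟩
  · rw [h]
    exact one_ne_zero
  · rw [h]
    exact (algebraicIndependent_consecutive hk).ne_zero α

/-- Invariant functions are Laurent polynomials in the consecutive minors. -/
theorem invariantRing_le (hk : 2 ≤ k) : invariantRing n k
    ≤ laurentSubalgebra fun α : consecutiveIndex n k => cornerMinor (generic n k) α := by
  intro f hf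
  set S := laurentSubalgebra fun α : consecutiveIndex n k => cornerMinor (generic n k) α with hS
  obtain ⟨hreg, hinv⟩ := mem_invariantRing.mp hf
  obtain ⟨P, m, hP⟩ := exists_mem_regularRing hreg
  have hM : ∀ l i j, l + 2 ≤ k → i + j ≤ n →
      cornerMinor (generic n k) (facePoint k l i j) ≠ 0 ∧
      cornerMinor (generic n k) (facePoint k l i j) ∈ S ∧
      (cornerMinor (generic n k) (facePoint k l i j))⁻¹ ∈ S := by
    intro l i j hl hij
    refine ⟨generic_facePoint_ne_zero hk hl hij, ?_⟩
    rcases generic_facePoint_cases hk hl hij with h | ⟨α, h⟩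
    · rw [h, inv_one]
      exact ⟨one_mem _, one_mem _⟩
    · rw [h]
      refine ⟨coord_mem_laurentSubalgebra _ α, mem_laurentSubalgebra_of_mul_eq_one (i := α) ?_⟩
      exact inv_mul_cancel₀ ((algebraicIndependent_consecutive hk).ne_zero α)
  have hdet : algebraMap _ (RatField n k) (detProd n k)
      = cornerMinor (generic n k) (facePoint k (k - 2) 0 n) := by
    rw [cornerMinor_facePoint_last _ hk, detProd, map_prod]
    refine Finset.prod_congr rfl fun l _ => ?_
    rw [RingHom.map_det]
    rfl
  obtain ⟨h0, -, hinvS⟩ := hM (k - 2) 0 n (by omega) (by omega)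
  rw [← hdet] at h0 hinvS
  -- These unitriangular matrices have entries in the function field; `aeval_translateBy` extends
  -- the invariance of `P` to them.
  obtain ⟨u, hu, hnorm⟩ := exists_isNormalTuple_translateBy (generic n k)
    (fun l i j hl hij => (hM l i j hl hij).1) hk
  have hentry := hnorm.entry_mem hk S (fun l i j hl hij => by
    simpa only [cornerMinor_translateBy hu] using hM l i j hl hij)
  -- The cleared denominator is itself a multi-corner minor, hence invariant.
  have hPinv : ∀ u : Fin (k + 1) → GL (Fin n) ℂ, (∀ i, IsUnipotentUpper (u i)) →
      actPoly u P = P := by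
    intro u hu
    apply IsFractionRing.injective (PolyRing n k) (RatField n k)
    have hD : act u (algebraMap _ (RatField n k) (detProd n k))
        = algebraMap _ (RatField n k) (detProd n k) := by
      rw [hdet]
      exact (mem_invariantRing.mp (cornerMinor_mem_invariantRing _)).2 u hu
    rw [← act_algebraMap, ← hP, map_mul, map_pow, hD, hinv u hu]
  have hPS : algebraMap _ (RatField n k) P ∈ S := by
    have h1 := aeval_translateBy P hPinv (generic n k) hu
    have h2 : MvPolynomial.aeval (fun p : Fin k × Fin n × Fin n => generic n k p.1 p.2.1 p.2.2) P
        = algebraMap _ (RatField n k) P := by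
      have := MvPolynomial.comp_aeval_apply
        (φ := Algebra.algHom ℂ (PolyRing n k) (RatField n k)) MvPolynomial.X P
      rw [MvPolynomial.aeval_X_left_apply] at this
      exact this.symm
    rw [← h2, ← h1]
    have h3 : MvPolynomial.aeval
        (fun p : Fin k × Fin n × Fin n => translateBy u (generic n k) p.1 p.2.1 p.2.2) P
        ∈ (MvPolynomial.aeval (R := ℂ) fun p : Fin k × Fin n × Fin n =>
          translateBy u (generic n k) p.1 p.2.1 p.2.2).range := ⟨P, rfl⟩
    rw [← Algebra.adjoin_range_eq_range_aeval] at h3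
    refine Algebra.adjoin_le ?_ h3
    rintro _ ⟨p, rfl⟩
    exact hentry p.1 p.2.1 p.2.2
  have hf' : f = algebraMap _ (RatField n k) P
      * (algebraMap _ (RatField n k) (detProd n k))⁻¹ ^ m := by
    rw [← hP, mul_assoc, ← mul_pow, mul_inv_cancel₀ h0, one_pow, mul_one]
  rw [hf']
  exact mul_mem hPS (pow_mem hinvS m)

theorem IsRational.add {K : Type} [Field K] [Algebra ℂ K] {A : Subalgebra ℂ K} {f g : K}
    (hf : IsRational A f) (hg : IsRational A g) : IsRational A (f + g) := by
  obtain ⟨p, hp, q, hq, hq0, rfl⟩ := hf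
  obtain ⟨p', hp', q', hq', hq0', rfl⟩ := hg
  exact ⟨p * q' + q * p', add_mem (mul_mem hp hq') (mul_mem hq hp'), q * q', mul_mem hq hq',
    mul_ne_zero hq0 hq0', div_add_div _ _ hq0 hq0'⟩

theorem isRational_sum {K : Type} [Field K] [Algebra ℂ K] {A : Subalgebra ℂ K} {σ : Type*}
    (I : Finset σ) (f : σ → K) (hf : ∀ s ∈ I, IsRational A (f s)) :
    IsRational A (∑ s ∈ I, f s) :=
  Finset.sum_induction f (IsRational A) (fun _ _ => IsRational.add)
    ⟨0, zero_mem _, 1, one_mem _, one_ne_zero, (zero_div _).symm⟩ hf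

theorem isRational_potential (hk : 2 ≤ k) :
    IsRational (invariantRing n k) (potential (generic n k)) := by
  rw [potential_eq_sum_rhombusIndex (by omega) _ fun l i j => generic_facePoint_ne_zero hk]
  refine isRational_sum _ _ fun s hs => ?_
  have h0 : ∀ a, cornerMinor (generic n k) (rhombusCorner k s a) ≠ 0 := by
    intro a
    obtain ⟨l, i, j, hl, hij, he⟩ := exists_facePoint_eq_rhombusCorner hs a
    rw [he]
    exact generic_facePoint_ne_zero hk hl hij
  have hmem := fun a => cornerMinor_mem_invariantRing (n := n) (rhombusCorner k s a)
  exact ⟨_, mul_mem (hmem 0) (hmem 2), _, mul_mem (hmem 1) (hmem 3),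
    mul_ne_zero (h0 1) (h0 3), rfl⟩

theorem isPositive_generic_facePoint (hk : 2 ≤ k) {l i j : ℕ} (hl : l + 2 ≤ k)
    (hij : i + j ≤ n) : IsPositive
      (fun α : consecutiveIndex n k => cornerMinor (generic n k) α)
      (cornerMinor (generic n k) (facePoint k l i j)) := by
  rcases generic_facePoint_cases hk hl hij with h | ⟨α, h⟩
  · rw [h]
    exact one_mem (positiveFunctions _)
  · rw [h]
    exact isPositive_coord _ α

theorem quotient_trop_iff (hk : 2 ≤ k) (x : consecutiveIndex n k → ℝ) :
    IsPositive (fun α : consecutiveIndex n k => cornerMinor (generic n k) α)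
        (potential (generic n k)) ∧
      (trop (fun α : consecutiveIndex n k => cornerMinor (generic n k) α)
          (potential (generic n k)) x ≤ 0 ↔
        RhombusInequalities n k fun α =>
          trop (fun β : consecutiveIndex n k => cornerMinor (generic n k) β)
            (cornerMinor (generic n k) α) x) :=
  trop_potential_le_zero_iff (algebraicIndependent_consecutive hk) x (by omega) _
    fun _ _ _ hl hij => ⟨generic_facePoint_ne_zero hk hl hij,
      isPositive_generic_facePoint hk hl hij⟩

theorem isPositiveChart_consecutive (hk : 2 ≤ k) :
    IsPositiveChart (invariantRing n k) (potential (generic n k))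
      (fun α : consecutiveIndex n k => cornerMinor (generic n k) α) where
  chart := isToricChart_of_le (algebraicIndependent_consecutive hk)
    (fun _ => cornerMinor_mem_invariantRing _) (invariantRing_le hk)
  rational := isRational_potential hk
  positive := (quotient_trop_iff hk 0).1

theorem encard_consecutiveMinors (hk : 2 ≤ k) :
    ((consecutiveMinors n k).encard : WithBot ℕ∞) = topologicalKrullDim (quotientVariety n k) := by
  have hy := algebraicIndependent_consecutive (n := n) hk
  have hdim : topologicalKrullDim (quotientVariety n k) = Fintype.card (consecutiveIndex n k) :=
    (PrimeSpectrum.topologicalKrullDim_eq_ringKrullDim (invariantRing n k)).trans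
      (ringKrullDim_eq_card hy (fun α => cornerMinor_mem_invariantRing _) (invariantRing_le hk))
  have hinj : Set.InjOn (fun α => cornerMinor (generic n k) α) (consecutiveIndex n k) := by
    intro α hα β hβ h
    exact congrArg Subtype.val (hy.injective (a₁ := ⟨α, hα⟩) (a₂ := ⟨β, hβ⟩) h)
  rw [hdim, consecutiveMinors, hinj.encard_image, ← Set.coe_fintypeCard]
  rfl

end QuotientChart

/-! ### The Cauchy-Binet formula -/

section CauchyBinet

variable {R : Type} [CommRing R] {N : Type} [LinearOrder N] [Fintype N] {m : ℕ}

/-- The Cauchy-Binet formula. -/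
theorem det_mul_eq_sum (A : Matrix (Fin m) N R) (B : Matrix N (Fin m) R) :
    (A * B).det = ∑ s : {s : Finset N // s.card = m},
      (A.submatrix id (s.1.orderEmbOfFin s.2)).det
        * (B.submatrix (s.1.orderEmbOfFin s.2) id).det := by
  classical
  let T : (Fin m → N) → R := fun p => (∏ i, A i (p i)) * (B.submatrix p id).det
  have h1 : (A * B).det = ∑ p : Fin m → N, T p := by
    have hAB : (A * B) = fun i => ∑ j, A i j • B j := by
      ext i c
      simp [Matrix.mul_apply]
    rw [hAB]
    change (Matrix.detRowAlternating (n := Fin m) (R := R)).toMultilinearMap _ = _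
    rw [MultilinearMap.map_sum]
    refine Finset.sum_congr rfl fun p _ => ?_
    rw [MultilinearMap.map_smul_univ, smul_eq_mul]
    rfl
  rw [h1]
  -- An injective map is a subset together with a permutation; a map that is not injective repeats a
  -- row of `B` and contributes zero.
  have h2 : ∑ x : {s : Finset N // s.card = m} × Equiv.Perm (Fin m),
      T (fun i => x.1.1.orderEmbOfFin x.1.2 (x.2 i)) = ∑ p : Fin m → N, T p := by
    refine Fintype.sum_of_injective
      (fun (x : {s : Finset N // s.card = m} × Equiv.Perm (Fin m)) i =>
        x.1.1.orderEmbOfFin x.1.2 (x.2 i)) ?_ _ _ ?_ fun _ => rfl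
    · rintro ⟨⟨s, hs⟩, σ⟩ ⟨⟨s', hs'⟩, σ'⟩ h
      have hrange : ∀ (s : Finset N) (hs : s.card = m) (σ : Equiv.Perm (Fin m)),
          Set.range (fun i => s.orderEmbOfFin hs (σ i)) = s := by
        intro s hs σ
        rw [← s.range_orderEmbOfFin hs]
        exact σ.surjective.range_comp (s.orderEmbOfFin hs)
      have hss : s = s' := by
        have := congrArg Set.range h
        simp only [hrange] at this
        exact_mod_cast this
      subst hss
      congr 1
      ext i : 1
      exact (s.orderEmbOfFin hs).injective (congrFun h i)
    · intro p hp
      have hni : ¬ Function.Injective p := by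
        intro hinj
        apply hp
        have hcard : (Finset.univ.image p).card = m := by
          rw [Finset.card_image_of_injective _ hinj, Finset.card_univ, Fintype.card_fin]
        have hmem : ∀ i, ∃ j, (Finset.univ.image p).orderEmbOfFin hcard j = p i := by
          intro i
          have : p i ∈ Set.range ((Finset.univ.image p).orderEmbOfFin hcard) := by
            rw [Finset.range_orderEmbOfFin]
            simp
          exact this
        choose σ hσ using hmem
        have hσinj : Function.Injective σ := by
          intro i j hij
          apply hinj
          rw [← hσ i, ← hσ j, hij]
        exact ⟨(⟨_, hcard⟩, Equiv.ofBijective σ (Finite.injective_iff_bijective.mp hσinj)),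
          funext fun i => hσ i⟩
      obtain ⟨i, j, hij, hne⟩ : ∃ i j, p i = p j ∧ i ≠ j := by
        unfold Function.Injective at hni
        push Not at hni
        exact hni
      have : (B.submatrix p id).det = 0 :=
        Matrix.det_zero_of_row_eq hne (by ext c; simp [hij])
      simp only [T, this, mul_zero]
  rw [← h2, Fintype.sum_prod_type]
  refine Finset.sum_congr rfl fun s _ => ?_
  rw [← Matrix.det_transpose (A.submatrix id _), Matrix.det_apply', Finset.sum_mul]
  refine Finset.sum_congr rfl fun σ _ => ?_
  have : (B.submatrix (fun i => s.1.orderEmbOfFin s.2 (σ i)) id).det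
      = Equiv.Perm.sign σ * (B.submatrix (s.1.orderEmbOfFin s.2) id).det :=
    Matrix.det_permute σ (B.submatrix (s.1.orderEmbOfFin s.2) id)
  simp only [T, this, Matrix.transpose_apply, Matrix.submatrix_apply, id]
  ring

end CauchyBinet

/-! ### Positivity of the minors of `[1 | g₁ | ⋯ | g₁ ⋯ g_k]` -/

section BlockRow

theorem self_le_of_strictMono {m : ℕ} {f : Fin m → ℕ} (hf : StrictMono f) (a : Fin m) :
    (a : ℕ) ≤ f a := by
  obtain ⟨t, ht⟩ := a
  induction t with
  | zero => exact Nat.zero_le _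
  | succ t iht =>
    exact Nat.succ_le_of_lt
      ((iht (by omega)).trans_lt (hf (Fin.mk_lt_mk.mpr (Nat.lt_succ_self t))))

/-- An increasing sequence that takes all values below `c` must begin with them. -/
theorem exists_eq_of_strictMono {m c : ℕ} {f : Fin m → ℕ} (hf : StrictMono f)
    (h : ∀ j < c, ∃ b, f b = j) : ∀ j < c, ∃ hj : j < m, f ⟨j, hj⟩ = j := by
  intro j
  induction j using Nat.strong_induction_on with
  | _ j ih =>
    intro hj
    obtain ⟨b, hb⟩ := h j hj
    have hbj : (b : ℕ) ≤ j := hb ▸ self_le_of_strictMono hf b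
    rcases hbj.lt_or_eq with hlt | heq
    · obtain ⟨_, h'⟩ := ih b hlt (by omega)
      exact absurd (h'.symm.trans hb) hlt.ne
    · have hjm : j < m := by omega
      exact ⟨hjm, by rw [show (⟨j, hjm⟩ : Fin m) = b from Fin.ext heq.symm, hb]⟩

variable {R : Type} [CommRing R] {n k : ℕ}

theorem blockRow_zero (g : Fin k → Matrix (Fin n) (Fin n) R) (r x : Fin n) :
    blockRow g r (toLex (0, x)) = (1 : Matrix (Fin n) (Fin n) R) r x := by
  simp [blockRow]

theorem blockRow_succ (g : Fin (k + 1) → Matrix (Fin n) (Fin n) R) (r x : Fin n)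
    (t : Fin (k + 1)) : blockRow g r (toLex (t.succ, x))
      = ∑ s, g 0 r s * blockRow (Fin.tail g) s (toLex (t, x)) := by
  simp only [blockRow, Matrix.of_apply, ofLex_toLex]
  rw [Fin.partialProd_succ', Matrix.mul_apply]

/-- Columns `e` of `[1 | g₁ | ⋯]` which comprise the first `β t` columns of block `t`. -/
def IsInitialSelection {m : ℕ} (e : Fin m → Fin (k + 1) ×ₗ Fin n) (β : Fin (k + 1) → ℕ) : Prop :=
  StrictMono e ∧ (∀ t, β t ≤ n) ∧ ∀ t x, (∃ a, e a = toLex (t, x)) ↔ (x : ℕ) < β t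

theorem IsInitialSelection.first_block {m : ℕ} {e : Fin m → Fin (k + 1) ×ₗ Fin n}
    {β : Fin (k + 1) → ℕ} (he : IsInitialSelection e β) :
    ∃ m', m = β 0 + m' ∧ ∀ a : Fin m,
      ((a : ℕ) < β 0 → (ofLex (e a)).1 = 0 ∧ ((ofLex (e a)).2 : ℕ) = a) ∧
      (β 0 ≤ (a : ℕ) → (ofLex (e a)).1 ≠ 0) := by
  obtain ⟨hmono, hle, hmem⟩ := he
  -- The position of a column in the whole block matrix, which turns the lexicographic order into
  -- that of `ℕ`.
  let φ : Fin m → ℕ := fun a => ((ofLex (e a)).1 : ℕ) * n + ((ofLex (e a)).2 : ℕ)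
  have hφ : StrictMono φ := by
    intro a b hab
    have h := hmono hab
    rw [Prod.Lex.lt_iff] at h
    have h2 := (ofLex (e a)).2.2
    rcases h with h | ⟨h, h'⟩
    · have h1 : ((ofLex (e a)).1 : ℕ) + 1 ≤ (ofLex (e b)).1 := h
      have := Nat.mul_le_mul_right n h1
      simp only [φ]
      rw [Nat.add_mul] at this
      omega
    · have h1 : ((ofLex (e a)).2 : ℕ) < (ofLex (e b)).2 := h'
      simp only [φ, h]
      omega
  have hfill : ∀ j < β 0, ∃ b, φ b = j := by
    intro j hj
    obtain ⟨b, hb⟩ := (hmem 0 ⟨j, hj.trans_le (hle 0)⟩).mpr hj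
    exact ⟨b, by simp [φ, hb]⟩
  have hex := exists_eq_of_strictMono hφ hfill
  have hm : β 0 ≤ m := by
    rcases Nat.eq_zero_or_pos (β 0) with h | h
    · omega
    · obtain ⟨h', -⟩ := hex (β 0 - 1) (by omega)
      omega
  refine ⟨m - β 0, by omega, fun a => ⟨fun ha => ?_, fun ha h0 => ?_⟩⟩
  · obtain ⟨_, h⟩ := hex a ha
    have h1 : ((ofLex (e a)).1 : ℕ) * n + ((ofLex (e a)).2 : ℕ) = a := h
    have h2 : ((ofLex (e a)).1 : ℕ) = 0 := by
      by_contra hne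
      have := Nat.mul_le_mul_right n (Nat.one_le_iff_ne_zero.mpr hne)
      have := hle 0
      omega
    rw [h2] at h1
    exact ⟨Fin.ext h2, by omega⟩
  · have h1 := self_le_of_strictMono hφ a
    have h2 := (hmem 0 (ofLex (e a)).2).mp ⟨a, by rw [← h0]; rfl⟩
    simp only [φ, h0] at h1
    simp at h1
    omega

/-- Removing the block `1`. -/
theorem det_blockRow_submatrix {c m : ℕ} (g : Fin k → Matrix (Fin n) (Fin n) R)
    {f : Fin (c + m) → Fin n} (hf : StrictMono f) {e : Fin (c + m) → Fin (k + 1) ×ₗ Fin n}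
    (he : ∀ a : Fin c, (ofLex (e (Fin.castAdd m a))).1 = 0 ∧
      ((ofLex (e (Fin.castAdd m a))).2 : ℕ) = a) :
    ((∀ a : Fin c, (f (Fin.castAdd m a) : ℕ) = a) ∧ ((blockRow g).submatrix f e).det
      = ((blockRow g).submatrix (f ∘ Fin.natAdd c) (e ∘ Fin.natAdd c)).det) ∨
    ((¬ ∀ a : Fin c, (f (Fin.castAdd m a) : ℕ) = a) ∧ ((blockRow g).submatrix f e).det = 0) := by
  have hf' : StrictMono fun a => (f a : ℕ) := fun a b h => hf h
  have hentry : ∀ (r : Fin (c + m)) (a : Fin c),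
      blockRow g (f r) (e (Fin.castAdd m a)) = if (f r : ℕ) = a then 1 else 0 := by
    intro r a
    obtain ⟨h1, h2⟩ := he a
    have : e (Fin.castAdd m a) = toLex (0, (ofLex (e (Fin.castAdd m a))).2) := by
      rw [← h1]; rfl
    rw [this, blockRow_zero, Matrix.one_apply]
    simp only [Fin.ext_iff, h2]
  by_cases h : ∀ a : Fin c, (f (Fin.castAdd m a) : ℕ) = a
  · refine Or.inl ⟨h, ?_⟩
    rw [← Matrix.det_submatrix_equiv_self finSumFinEquiv]
    have hblock : ((blockRow g).submatrix f e).submatrix finSumFinEquiv finSumFinEquiv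
        = Matrix.fromBlocks 1 ((blockRow g).submatrix (f ∘ Fin.castAdd m) (e ∘ Fin.natAdd c)) 0
          ((blockRow g).submatrix (f ∘ Fin.natAdd c) (e ∘ Fin.natAdd c)) := by
      ext (r | r) (s | s)
      · simp [hentry, h, Matrix.one_apply, Fin.ext_iff]
      · simp
      · have h1 := self_le_of_strictMono hf' (Fin.natAdd c r)
        simp only [Fin.val_natAdd] at h1
        simp only [Matrix.submatrix_apply, finSumFinEquiv_apply_left, finSumFinEquiv_apply_right,
          hentry, Matrix.fromBlocks_apply₂₁, Matrix.zero_apply]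
        exact if_neg (by omega)
      · simp
    rw [hblock, Matrix.det_fromBlocks_zero₂₁, Matrix.det_one, one_mul]
  · refine Or.inr ⟨h, ?_⟩
    have : ¬ ∀ j < c, ∃ b, (f b : ℕ) = j := by
      intro hall
      apply h
      intro a
      obtain ⟨_, h'⟩ := exists_eq_of_strictMono hf' hall a a.2
      exact h'
    push Not at this
    obtain ⟨j, hj, hne⟩ := this
    refine Matrix.det_eq_zero_of_column_eq_zero (Fin.castAdd m ⟨j, hj⟩) fun r => ?_
    rw [Matrix.submatrix_apply, hentry]
    exact if_neg (hne r)

theorem sum_mem_and_ne_zero {S : Subsemiring R} (hS : ∀ f ∈ S, ∀ g ∈ S, f ≠ 0 → f + g ≠ 0)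
    {σ : Type*} (I : Finset σ) (f : σ → R) (hf : ∀ s ∈ I, f s ∈ S) :
    ∑ s ∈ I, f s ∈ S ∧ ∀ s ∈ I, f s ≠ 0 → ∑ s ∈ I, f s ≠ 0 := by
  classical
  refine ⟨sum_mem hf, fun s hs h0 => ?_⟩
  rw [← Finset.add_sum_erase _ _ hs]
  exact hS _ (hf s hs) _ (sum_mem fun t ht => hf t (Finset.mem_of_mem_erase ht)) h0

/-- The identity block either kills the minor or reduces it to the remaining rows and columns. There
`g 0` factors out on the left, and Cauchy-Binet leads to minors with one block fewer. By `hS` one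
nonzero summand makes the sum nonzero. -/
theorem det_blockRow_mem [IsDomain R] {S : Subsemiring R}
    (hS : ∀ f ∈ S, ∀ g ∈ S, f ≠ 0 → f + g ≠ 0) :
    ∀ {k : ℕ} (g : Fin k → Matrix (Fin n) (Fin n) R)
      (_ : ∀ l (m : ℕ) (f e : Fin m → Fin n), StrictMono f → StrictMono e →
        ((g l).submatrix f e).det ∈ S)
      (_ : ∀ l (m : ℕ) (f e : Fin m → Fin n), StrictMono f → StrictMono e → (∀ a, e a ≤ f a) →
        ((g l).submatrix f e).det ≠ 0)
      {m : ℕ} {f : Fin m → Fin n} (_ : StrictMono f) {e : Fin m → Fin (k + 1) ×ₗ Fin n}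
      {β : Fin (k + 1) → ℕ} (_ : IsInitialSelection e β),
      ((blockRow g).submatrix f e).det ∈ S ∧
        ((∀ a : Fin m, (a : ℕ) < β 0 → (f a : ℕ) = a) → ((blockRow g).submatrix f e).det ≠ 0)
  | 0, g, _, _, m, f, hf, e, β, he => by
    obtain ⟨m', rfl, hfirst⟩ := he.first_block
    have hm' : m' = 0 := by
      by_contra h
      exact (hfirst ⟨β 0, by omega⟩).2 le_rfl (Fin.ext (by omega))
    subst hm'
    rcases det_blockRow_submatrix g hf (fun a => (hfirst (Fin.castAdd 0 a)).1 a.2) with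
      ⟨h, hdet⟩ | ⟨h, hdet⟩
    · rw [hdet, Matrix.det_isEmpty]
      exact ⟨one_mem _, fun _ => one_ne_zero⟩
    · rw [hdet]
      exact ⟨zero_mem _, fun h' => absurd (fun a => h' (Fin.castAdd 0 a) a.2) h⟩
  | k + 1, g, hg, hg0, m, f, hf, e, β, he => by
    obtain ⟨m', rfl, hfirst⟩ := he.first_block
    rcases det_blockRow_submatrix g hf (fun a => (hfirst (Fin.castAdd m' a)).1 a.2) with
      ⟨h, hdet⟩ | ⟨h, hdet⟩
    swap
    · rw [hdet]
      exact ⟨zero_mem _, fun h' => absurd (fun a => h' (Fin.castAdd m' a) a.2) h⟩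
    have hne : ∀ a : Fin m', (ofLex (e (Fin.natAdd (β 0) a))).1 ≠ 0 := fun a =>
      (hfirst (Fin.natAdd (β 0) a)).2 (by simp)
    let e' : Fin m' → Fin (k + 1) ×ₗ Fin n := fun a =>
      toLex ((ofLex (e (Fin.natAdd (β 0) a))).1.pred (hne a), (ofLex (e (Fin.natAdd (β 0) a))).2)
    have hee' : ∀ a, e (Fin.natAdd (β 0) a) = toLex ((ofLex (e' a)).1.succ, (ofLex (e' a)).2) := by
      intro a
      simp [e']
    have he' : IsInitialSelection e' fun t => β t.succ := by
      refine ⟨fun a b hab => ?_, fun t => he.2.1 _, fun t x => ?_⟩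
      · have := he.1 (show Fin.natAdd (β 0) a < Fin.natAdd (β 0) b by simpa using hab)
        rw [hee' a, hee' b, Prod.Lex.toLex_lt_toLex] at this
        rw [Prod.Lex.lt_iff]
        simpa using this
      · rw [← he.2.2 t.succ x]
        constructor
        · rintro ⟨a, ha⟩
          exact ⟨_, by rw [hee' a, ha]; rfl⟩
        · rintro ⟨a, ha⟩
          have hle : β 0 ≤ a := by
            by_contra hlt
            have := ((hfirst a).1 (by omega)).1
            rw [ha] at this
            exact Fin.succ_ne_zero t this
          obtain ⟨b, rfl⟩ : ∃ b, a = Fin.natAdd (β 0) b :=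
            ⟨⟨a - β 0, by omega⟩, Fin.ext (by simp; omega)⟩
          rw [hee' b] at ha
          obtain ⟨h1, h2⟩ := Prod.mk.inj (toLex.injective ha)
          exact ⟨b, by rw [← Fin.succ_injective _ h1, ← h2]; rfl⟩
    have hf' : StrictMono (f ∘ Fin.natAdd (β 0)) := fun a b hab => hf (by simpa using hab)
    have hmul : (blockRow g).submatrix (f ∘ Fin.natAdd (β 0)) (e ∘ Fin.natAdd (β 0))
        = (g 0).submatrix (f ∘ Fin.natAdd (β 0)) id
          * (blockRow (Fin.tail g)).submatrix id e' := by
      ext r s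
      rw [Matrix.submatrix_apply, Function.comp, Function.comp, hee', blockRow_succ,
        Matrix.mul_apply]
      rfl
    have hrec := fun s : {s : Finset (Fin n) // s.card = m'} =>
      det_blockRow_mem hS (Fin.tail g) (fun l => hg l.succ) (fun l => hg0 l.succ)
        (f := s.1.orderEmbOfFin s.2) (s.1.orderEmbOfFin s.2).strictMono he'
    have hmain := sum_mem_and_ne_zero hS (Finset.univ : Finset {s : Finset (Fin n) // s.card = m'})
      (fun s => (((g 0).submatrix (f ∘ Fin.natAdd (β 0)) id).submatrix id
          (s.1.orderEmbOfFin s.2)).det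
        * (((blockRow (Fin.tail g)).submatrix id e').submatrix (s.1.orderEmbOfFin s.2) id).det)
      (fun s _ => mul_mem (hg 0 m' _ _ hf' (s.1.orderEmbOfFin s.2).strictMono) (hrec s).1)
    rw [hdet, hmul, det_mul_eq_sum]
    refine ⟨hmain.1, fun _ => ?_⟩
    have hmn : m' ≤ n := by
      have := Fintype.card_le_of_injective _ hf'.injective
      simpa using this
    -- The summand of the leading indices is nonzero: they lie weakly below the selected rows of `g
    -- 0`, and as row indices of the smaller minor they satisfy the condition of the induction.
    let ν : Fin m' → Fin n := Fin.castLE hmn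
    have hν : StrictMono ν := Fin.strictMono_castLE hmn
    have hcard : (Finset.univ.image ν).card = m' := by
      rw [Finset.card_image_of_injective _ hν.injective, Finset.card_univ, Fintype.card_fin]
    have hemb : ν = (Finset.univ.image ν).orderEmbOfFin hcard :=
      Finset.orderEmbOfFin_unique hcard (fun a => Finset.mem_image_of_mem _ (Finset.mem_univ a)) hν
    refine hmain.2 ⟨Finset.univ.image ν, hcard⟩ (Finset.mem_univ _) (mul_ne_zero ?_ ?_)
    · refine hg0 0 m' _ _ hf' (OrderEmbedding.strictMono _) fun a => ?_
      rw [← hemb]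
      exact self_le_of_strictMono (f := fun a => ((f ∘ Fin.natAdd (β 0)) a : ℕ))
        (fun a b hab => hf' hab) a
    · refine (hrec ⟨Finset.univ.image ν, hcard⟩).2 fun a _ => ?_
      rw [← hemb]
      rfl

theorem card_columnSet {α : Fin k → ℕ} (hα : ∑ i, α i ≤ n) :
    (columnSet (n := n) α).card = n := by
  have hβ : ∀ t, (Fin.cons (n - ∑ i, α i) α : Fin (k + 1) → ℕ) t ≤ n := by
    intro t
    refine Fin.cases ?_ (fun t => ?_) t
    · rw [Fin.cons_zero]; omega
    · rw [Fin.cons_succ]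
      exact (Finset.single_le_sum (fun _ _ => Nat.zero_le _) (Finset.mem_univ t)).trans hα
  have hsum : ∑ t, (Fin.cons (n - ∑ i, α i) α : Fin (k + 1) → ℕ) t = n := by
    rw [Fin.sum_univ_succ]
    simp only [Fin.cons_zero, Fin.cons_succ]
    omega
  rw [columnSet, Finset.card_filter, ← Equiv.sum_comp (toLex (α := Fin (k + 1) × Fin n)),
    Fintype.sum_prod_type]
  refine Eq.trans (Finset.sum_congr rfl fun t _ => ?_) hsum
  refine (Finset.card_filter _ _).symm.trans (Fin.card_filter_val_lt.trans ?_)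
  exact min_eq_right (hβ t)

/-- If all minors of the `g l` are subtraction-free, and those which do not vanish on all lower
triangular matrices are nonzero, then all multi-corner minors are subtraction-free and nonzero. -/
theorem cornerMinor_mem [IsDomain R] {S : Subsemiring R}
    (hS : ∀ f ∈ S, ∀ g ∈ S, f ≠ 0 → f + g ≠ 0) (g : Fin k → Matrix (Fin n) (Fin n) R)
    (hg : ∀ l (m : ℕ) (f e : Fin m → Fin n), StrictMono f → StrictMono e →
      ((g l).submatrix f e).det ∈ S)
    (hg0 : ∀ l (m : ℕ) (f e : Fin m → Fin n), StrictMono f → StrictMono e → (∀ a, e a ≤ f a) →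
      ((g l).submatrix f e).det ≠ 0) {α : Fin k → ℕ} (hα : ∑ i, α i ≤ n) :
    cornerMinor g α ≠ 0 ∧ cornerMinor g α ∈ S := by
  have hcard := card_columnSet hα
  set e := (columnSet (n := n) α).orderEmbOfFin hcard with he
  have hsel : IsInitialSelection e (Fin.cons (n - ∑ i, α i) α : Fin (k + 1) → ℕ) := by
    refine ⟨e.strictMono, fun t => ?_, fun t x => ?_⟩
    · refine Fin.cases ?_ (fun t => ?_) t
      · rw [Fin.cons_zero]; omega
      · rw [Fin.cons_succ]
        exact (Finset.single_le_sum (fun _ _ => Nat.zero_le _) (Finset.mem_univ t)).trans hα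
    · change toLex (t, x) ∈ Set.range e ↔ _
      rw [he, Finset.range_orderEmbOfFin]
      simp [columnSet]
  have hminor := minor_image (blockRow g) strictMono_id e.strictMono
  rw [Finset.image_id, he, Finset.image_orderEmbOfFin_univ, ← he] at hminor
  have := det_blockRow_mem hS g hg hg0 (f := id) strictMono_id hsel
  rw [cornerMinor, hminor]
  exact ⟨this.2 fun _ _ => rfl, this.1⟩

end BlockRow

/-! ### Minors of the generic lower triangular matrix -/

section LowerMinors

variable {n k : ℕ}

theorem lowerGeneric_eq_zero {i j : Fin n} (h : i < j) : lowerGeneric n i j = 0 := by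
  rw [lowerGeneric, Matrix.of_apply, dif_neg h.not_ge]

/-- Setting the variables at the positions `(f a, e a)` to 1 and all others to 0 specializes the
submatrix to the identity. -/
theorem det_lowerGeneric_submatrix_ne_zero {m : ℕ} {f e : Fin m → Fin n} (hf : StrictMono f)
    (he : StrictMono e) (h : ∀ a, e a ≤ f a) : ((lowerGeneric n).submatrix f e).det ≠ 0 := by
  classical
  let A : Matrix (Fin n) (Fin n) (MvPolynomial (LowerPos n) ℂ) := Matrix.of fun i j =>
    if h : j ≤ i then MvPolynomial.X ⟨(i, j), h⟩ else 0
  have hA : lowerGeneric n = A.map (algebraMap _ (LowerField n)) := by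
    ext i j
    simp only [lowerGeneric, A, Matrix.of_apply, Matrix.map_apply]
    split_ifs
    · rfl
    · rw [map_zero]
  have hdet : ((lowerGeneric n).submatrix f e).det
      = algebraMap _ (LowerField n) (A.submatrix f e).det := by
    rw [hA, RingHom.map_det]
    rfl
  rw [hdet]
  intro h0
  have h1 : (A.submatrix f e).det = 0 :=
    IsFractionRing.injective (MvPolynomial (LowerPos n) ℂ) (LowerField n)
      (h0.trans (map_zero _).symm)
  let v : LowerPos n → ℂ := fun p => if ∃ a, f a = p.1.1 ∧ e a = p.1.2 then 1 else 0
  have h2 : (MvPolynomial.eval v).mapMatrix (A.submatrix f e) = 1 := by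
    ext a b
    rw [RingHom.mapMatrix_apply, Matrix.map_apply, Matrix.submatrix_apply, Matrix.one_apply]
    have hiff : (∃ c, f c = f a ∧ e c = e b) ↔ a = b := by
      constructor
      · rintro ⟨c, hc, hc'⟩
        rw [← hf.injective hc, he.injective hc']
      · rintro rfl
        exact ⟨a, rfl, rfl⟩
    by_cases hle : e b ≤ f a
    · simp only [A, Matrix.of_apply, dif_pos hle, MvPolynomial.eval_X, v, hiff]
    · simp only [A, Matrix.of_apply, dif_neg hle, map_zero]
      rw [if_neg]
      rintro rfl
      exact hle (h a)
  have h3 := congrArg (MvPolynomial.eval v) h1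
  rw [RingHom.map_det, h2, Matrix.det_one, map_zero] at h3
  exact one_ne_zero h3

theorem lowerMinor_eq_det {i j p : ℕ} (hij : i + j ≤ n) (hp : p + j = n) :
    lowerMinor n i j = ((lowerGeneric n).submatrix (fun a : Fin j => (⟨p + a, by omega⟩ : Fin n))
      fun a : Fin j => (⟨i + a, by omega⟩ : Fin n)).det := by
  rw [lowerMinor, op_interval_eq_image hp, interval_eq_image hij, minor_image]
  · intro a b hab
    exact Fin.mk_lt_mk.mpr (Nat.add_lt_add_left hab p)
  · intro a b hab
    exact Fin.mk_lt_mk.mpr (Nat.add_lt_add_left hab i)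

theorem lowerMinor_ne_zero {i j : ℕ} (hij : i + j ≤ n) : lowerMinor n i j ≠ 0 := by
  rw [lowerMinor_eq_det (p := n - j) hij (by omega)]
  refine det_lowerGeneric_submatrix_ne_zero ?_ ?_ ?_
  · intro a b hab
    exact Fin.mk_lt_mk.mpr (Nat.add_lt_add_left hab _)
  · intro a b hab
    exact Fin.mk_lt_mk.mpr (Nat.add_lt_add_left hab i)
  · intro a
    exact Fin.mk_le_mk.mpr (by omega)

variable {ι : Type} {y : ι → LowerField n}

/-- A telescoping product of Gelfand-Zeitlin coordinates. -/
theorem isPositive_lowerMinor (hgz : ∀ s, IsPositive y (gzCoordinate n s)) {i j : ℕ} (hi : i < n)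
    (hij : i + j ≤ n) : IsPositive y (lowerMinor n i j) := by
  induction j with
  | zero =>
    rw [lowerMinor_eq_det (p := n) hij rfl, Matrix.det_isEmpty]
    exact one_mem (positiveFunctions y)
  | succ j ih =>
    have hij' : i + j ≤ n := by omega
    have h : IsPositive y (lowerMinor n i (j + 1) / lowerMinor n i j * lowerMinor n i j) :=
      (hgz ⟨(i, j + 1), hi, Nat.succ_pos j, hij⟩).mul (ih hij')
    rwa [div_mul_cancel₀ _ (lowerMinor_ne_zero hij')] at h

/-- Reflection in the antidiagonal preserves lower triangularity and carries the minors on the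
bottom rows and consecutive columns to solid minors, so `minorsIn_of_solidMinor` applies. -/
theorem isPositive_det_lowerGeneric_submatrix (hgz : ∀ s, IsPositive y (gzCoordinate n s))
    {m : ℕ} {f e : Fin m → Fin n} (hf : StrictMono f) (he : StrictMono e) :
    IsPositive y ((lowerGeneric n).submatrix f e).det := by
  let b : ℕ → ℕ → LowerField n := fun r c =>
    if h : r < n ∧ c < n then lowerGeneric n ⟨n - 1 - c, by omega⟩ ⟨n - 1 - r, by omega⟩ else 0
  have hb : ∀ {r c : ℕ} (hr : r < n) (hc : c < n),
      b r c = lowerGeneric n ⟨n - 1 - c, by omega⟩ ⟨n - 1 - r, by omega⟩ :=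
    fun hr hc => dif_pos ⟨hr, hc⟩
  have hmin : MinorsIn (positiveFunctions y) n b := by
    refine minorsIn_of_solidMinor _ n b (fun i j hij => ?_) fun i j hij => ?_
    · simp only [b]
      split_ifs with h
      · exact lowerGeneric_eq_zero (Fin.mk_lt_mk.mpr (by omega))
      · rfl
    · have hsolid : solidMinor b i (j + 1) = lowerMinor n (n - 1 - i - j) (j + 1) := by
        rw [lowerMinor_eq_det (p := n - (j + 1)) (by omega) (by omega), solidMinor,
          ← Matrix.det_transpose, ← Matrix.det_submatrix_equiv_self Fin.revPerm]
        congr 1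
        ext a c
        rw [Matrix.submatrix_apply, Matrix.transpose_apply, Matrix.of_apply,
          hb (by omega) (by omega), Matrix.submatrix_apply]
        congr 1 <;> refine Fin.ext ?_ <;> simp only [Fin.revPerm_apply, Fin.val_rev] <;> omega
      rw [hsolid]
      have := isPositive_lowerMinor hgz (i := n - 1 - i - j) (j := j + 1) (by omega) (by omega)
      exact ⟨lowerMinor_ne_zero (by omega), this, this.inv⟩
  have key := hmin m (fun a => n - 1 - e a.rev) (fun a => n - 1 - f a.rev)
    (fun a c h => by
      have h1 : (e c.rev : ℕ) < e a.rev := he (Fin.rev_lt_rev.mpr h)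
      simp only
      omega)
    (fun a c h => by
      have h1 : (f c.rev : ℕ) < f a.rev := hf (Fin.rev_lt_rev.mpr h)
      simp only
      omega)
    (fun a => by have := (e a.rev).2; omega) (fun a => by have := (f a.rev).2; omega)
  rw [← Matrix.det_transpose, ← Matrix.det_submatrix_equiv_self Fin.revPerm] at key
  rw [← mem_positiveFunctions]
  refine Eq.subst (motive := (· ∈ positiveFunctions y)) (congrArg Matrix.det ?_) key
  ext a c
  rw [Matrix.submatrix_apply, Matrix.submatrix_apply, Matrix.transpose_apply, Matrix.of_apply,
    hb (by have := (e (Fin.rev (Fin.revPerm c))).2; omega)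
      (by have := (f (Fin.rev (Fin.revPerm a))).2; omega)]
  simp only [Fin.revPerm_apply, Fin.rev_rev]
  congr 1 <;> refine Fin.ext ?_ <;> simp only <;> omega

/-! ### Positive functions pulled back to the product chart -/

theorem evalPoly_productChart (l : Fin k) (P : MvPolynomial ι ℝ≥0) :
    evalPoly (productChart (k := k) y) (MvPolynomial.rename (fun s => (l, s)) P)
      = pullback n l (evalPoly y P) := by
  induction P using MvPolynomial.induction_on with
  | C c =>
    rw [MvPolynomial.rename_C]
    simp only [evalPoly, MvPolynomial.eval₂Hom_C, RingHom.comp_apply]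
    exact ((pullback n l).commutes _).symm
  | add P Q hP hQ => rw [map_add, map_add, map_add, map_add, hP, hQ]
  | mul_X P i hP =>
    rw [map_mul, map_mul, map_mul, map_mul, hP, MvPolynomial.rename_X]
    congr 1
    simp only [evalPoly, MvPolynomial.eval₂Hom_X']
    rfl

theorem IsPositive.pullback {f : LowerField n} (hf : IsPositive y f) (l : Fin k) :
    IsPositive (productChart (k := k) y) (MultiCorner.pullback n l f) := by
  obtain ⟨P, Q, hQ, rfl⟩ := hf
  refine ⟨MvPolynomial.rename (fun s => (l, s)) P, MvPolynomial.rename (fun s => (l, s)) Q, ?_, ?_⟩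
  · rw [evalPoly_productChart]
    exact (map_ne_zero _).mpr hQ
  · rw [evalPoly_productChart, evalPoly_productChart, map_div₀]

theorem det_lowerPowGeneric_submatrix {m : ℕ} (l : Fin k) (f e : Fin m → Fin n) :
    ((lowerPowGeneric n l).submatrix f e).det
      = pullback n l ((lowerGeneric n).submatrix f e).det := by
  rw [AlgHom.map_det]
  rfl

end LowerMinors

/-! ### Algebraic independence of the coordinates of a chart -/

section Independence

theorem algebraicIndependent_laurent_X (ι : Type) :
    AlgebraicIndependent ℂ (Laurent.X : ι → Laurent ι) := by
  let c : (ι →₀ ℕ) →+ (ι →₀ ℤ) := Finsupp.mapRange.addMonoidHom (Nat.castAddMonoidHom ℤ)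
  have hc : Function.Injective c := Finsupp.mapRange_injective _ rfl Nat.cast_injective
  let φ : MvPolynomial ι ℂ →ₐ[ℂ] Laurent ι := AddMonoidAlgebra.mapDomainAlgHom ℂ ℂ c
  have hφ : (MvPolynomial.aeval Laurent.X : MvPolynomial ι ℂ →ₐ[ℂ] Laurent ι) = φ := by
    refine MvPolynomial.algHom_ext fun i => ?_
    rw [MvPolynomial.aeval_X]
    change _ = AddMonoidAlgebra.mapDomain c (AddMonoidAlgebra.single (Finsupp.single i 1) 1)
    rw [AddMonoidAlgebra.mapDomain_single, Laurent.X]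
    congr 1
    simp [c]
  rw [algebraicIndependent_iff_injective_aeval, hφ]
  exact AddMonoidAlgebra.mapDomain_injective hc

variable {K : Type} [Field K] [Algebra ℂ K] {ι : Type} {y : ι → K} {A : Subalgebra ℂ K}

/-- The coordinates of a chart are algebraically independent. -/
theorem IsToricChart.algebraicIndependent (h : IsToricChart A y) : AlgebraicIndependent ℂ y := by
  obtain ⟨hrat, θ, hopen, hθ⟩ := h
  have hdom : IsDomain (Laurent ι) := inferInstance
  -- An open immersion is flat, so a nonzero element of the domain `A`, being regular, acts
  -- regularly on the Laurent polynomials and is not sent to zero.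
  have hinj : Function.Injective θ := by
    have hflat : RingHom.Flat (θ : A →+* Laurent ι) :=
      (AlgebraicGeometry.Flat.SpecMap_iff
        (f := CommRingCat.ofHom (θ : A →+* Laurent ι))).mp inferInstance
    algebraize [(θ : A →+* Laurent ι)]
    rw [injective_iff_map_eq_zero]
    intro a ha
    by_contra hne
    have hreg : IsSMulRegular A a := fun b c hbc => mul_left_cancel₀ hne hbc
    have := hreg.of_flat (S := Laurent ι)
    have h1 : (algebraMap A (Laurent ι) a) • (1 : Laurent ι)
        = (algebraMap A (Laurent ι) a) • 0 := by
      change θ a * 1 = θ a * 0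
      rw [ha, zero_mul, zero_mul]
    exact one_ne_zero (this h1)
  -- The coordinates are lifted to `z` in the fraction field of `A`. There `ψ` sends `z` to the
  -- natural torus coordinates and `χ` sends it to `y`, so independence passes from the former to
  -- the latter.
  let L := FractionRing (Laurent ι)
  let E := FractionRing A
  let ψ : E →ₐ[ℂ] L := IsFractionRing.liftAlgHom
    (g := (Algebra.algHom ℂ (Laurent ι) L).comp θ)
    ((IsFractionRing.injective (Laurent ι) L).comp hinj)
  let χ : E →ₐ[ℂ] K := IsFractionRing.liftAlgHom (g := A.val) Subtype.val_injective
  choose p hp q hq hq0 hy using hrat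
  let z : ι → E := fun i => algebraMap A E ⟨p i, hp i⟩ / algebraMap A E ⟨q i, hq i⟩
  have hχ : χ ∘ z = y := by
    funext i
    change χ _ = _
    rw [map_div₀, hy i]
    congr 1
    · exact IsFractionRing.lift_algebraMap (g := A.val.toRingHom) Subtype.val_injective _
    · exact IsFractionRing.lift_algebraMap (g := A.val.toRingHom) Subtype.val_injective _
  have hψ : ψ ∘ z = algebraMap (Laurent ι) L ∘ Laurent.X := by
    funext i
    have h1 := hθ i ⟨p i, hp i⟩ ⟨q i, hq i⟩ (by
      change y i * q i = p i
      rw [hy i, div_mul_cancel₀ _ (hq0 i)])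
    have h2 : ∀ a : A, ψ (algebraMap A E a) = algebraMap (Laurent ι) L (θ a) :=
      IsFractionRing.lift_algebraMap (g := ((Algebra.algHom ℂ (Laurent ι) L).comp θ).toRingHom)
        ((IsFractionRing.injective (Laurent ι) L).comp hinj)
    change ψ _ = _
    rw [map_div₀, h2, h2, div_eq_iff, ← h1, map_mul]
    · rfl
    · intro h0
      have h3 : θ ⟨q i, hq i⟩ = 0 :=
        IsFractionRing.injective (Laurent ι) L (h0.trans (map_zero _).symm)
      exact hq0 i (congrArg Subtype.val (hinj (h3.trans (map_zero θ).symm)))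
  have hX : AlgebraicIndependent ℂ (ψ ∘ z) := by
    rw [hψ]
    exact (algebraicIndependent_laurent_X ι).map' (f := Algebra.algHom ℂ (Laurent ι) L)
      (IsFractionRing.injective (Laurent ι) L)
  have hz : AlgebraicIndependent ℂ z := hX.of_comp ψ
  rw [← hχ]
  exact hz.map' χ.toRingHom.injective

variable {n k : ℕ}

/-! ### Transcendence bases of the function field of the product -/

theorem isTranscendenceBasis_algebraMap_X (σ : Type) : IsTranscendenceBasis ℂ fun s : σ =>
    algebraMap (MvPolynomial σ ℂ) (FractionRing (MvPolynomial σ ℂ)) (MvPolynomial.X s) :=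
  have : Algebra.IsAlgebraic (MvPolynomial σ ℂ) (FractionRing (MvPolynomial σ ℂ)) :=
    IsLocalization.isAlgebraic _ (nonZeroDivisors _)
  (IsTranscendenceBasis.mvPolynomial σ ℂ).algebraMap_comp (A := FractionRing (MvPolynomial σ ℂ))

theorem pullback_algebraMap_X (l : Fin k) (p : LowerPos n) :
    pullback n l (algebraMap (MvPolynomial (LowerPos n) ℂ) (LowerField n) (MvPolynomial.X p))
      = algebraMap (MvPolynomial (Fin k × LowerPos n) ℂ) (LowerPowField n k)
        (MvPolynomial.X (l, p)) := by
  refine (IsFractionRing.lift_algebraMap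
    (g := ((Algebra.algHom ℂ (MvPolynomial (Fin k × LowerPos n) ℂ) (LowerPowField n k)).comp
      (MvPolynomial.rename fun p => (l, p))).toRingHom)
    ((IsFractionRing.injective (MvPolynomial (Fin k × LowerPos n) ℂ) (LowerPowField n k)).comp
      (MvPolynomial.rename_injective _ (Prod.mk_right_injective l))) _).trans ?_
  change algebraMap (MvPolynomial (Fin k × LowerPos n) ℂ) (LowerPowField n k)
    (MvPolynomial.rename _ _) = _
  rw [MvPolynomial.rename_X]

/-- Every matrix entry is pulled back from one factor and is algebraic over the pulled back
coordinates, hence so is the whole field. The finite family has as many members as the transcendence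
degree, so it is a basis. -/
theorem isTranscendenceBasis_productChart {ι : Type} {y : ι → LowerField n}
    (hy : IsTranscendenceBasis ℂ y) : IsTranscendenceBasis ℂ (productChart (k := k) y) := by
  have hcard : Cardinal.mk ι = Cardinal.mk (LowerPos n) :=
    hy.cardinalMk_eq (isTranscendenceBasis_algebraMap_X (LowerPos n))
  have hfin : Finite ι := by
    rw [← Cardinal.lt_aleph0_iff_finite, hcard]
    exact Cardinal.lt_aleph0_of_finite _
  let S := Algebra.adjoin ℂ (Set.range (productChart (k := k) y))
  have halg : Algebra.IsAlgebraic S (LowerPowField n k) := by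
    have hX : ∀ s : Fin k × LowerPos n,
        IsAlgebraic S (algebraMap _ (LowerPowField n k)
          (MvPolynomial.X s : MvPolynomial (Fin k × LowerPos n) ℂ)) := by
      rintro ⟨l, p⟩
      rw [← pullback_algebraMap_X]
      have h1 := hy.isAlgebraic.isAlgebraic
        (algebraMap _ (LowerField n) (MvPolynomial.X p : MvPolynomial (LowerPos n) ℂ))
      have hmap : ∀ a ∈ Algebra.adjoin ℂ (Set.range y), pullback n l a ∈ S := by
        intro a ha
        have h2 : pullback n l a ∈ (Algebra.adjoin ℂ (Set.range y)).map (pullback n l) :=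
          ⟨a, ha, rfl⟩
        rw [AlgHom.map_adjoin] at h2
        refine Algebra.adjoin_mono ?_ h2
        rintro _ ⟨_, ⟨i, rfl⟩, rfl⟩
        exact ⟨(l, i), rfl⟩
      let f : Algebra.adjoin ℂ (Set.range y) →+* S :=
        (((pullback n l).comp (Algebra.adjoin ℂ (Set.range y)).val).codRestrict S
          fun a => hmap a a.2).toRingHom
      refine h1.ringHom_of_comp_eq f (pullback n l) ?_ rfl
      intro a b hab
      exact Subtype.ext ((pullback n l).toRingHom.injective (congrArg Subtype.val hab))
    have hpoly : ∀ P : MvPolynomial (Fin k × LowerPos n) ℂ,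
        IsAlgebraic S (algebraMap _ (LowerPowField n k) P) := by
      intro P
      induction P using MvPolynomial.induction_on with
      | C c => exact isAlgebraic_algebraMap (algebraMap ℂ S c)
      | add P Q hP hQ => rw [map_add]; exact hP.add hQ
      | mul_X P s hP => rw [map_mul]; exact hP.mul (hX s)
    refine ⟨fun f => ?_⟩
    obtain ⟨P, Q, -, rfl⟩ := IsFractionRing.div_surjective
      (A := MvPolynomial (Fin k × LowerPos n) ℂ) f
    rw [div_eq_mul_inv]
    exact (hpoly P).mul (hpoly Q).inv
  refine Algebra.IsAlgebraic.isTranscendenceBasis_of_le_trdeg_of_finite ℂ _ ?_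
  rw [← (isTranscendenceBasis_algebraMap_X (Fin k × LowerPos n)).cardinalMk_eq_trdeg,
    Cardinal.mk_prod, Cardinal.mk_prod, hcard]

/-- The family is extended to a transcendence basis, to which `isTranscendenceBasis_productChart`
applies. -/
theorem algebraicIndependent_productChart {ι : Type} {y : ι → LowerField n}
    (hy : AlgebraicIndependent ℂ y) : AlgebraicIndependent ℂ (productChart (k := k) y) := by
  obtain ⟨t, ht, hbasis⟩ := exists_isTranscendenceBasis_superset hy.coe_range
  have h1 := (isTranscendenceBasis_productChart (k := k) hbasis).1
  exact h1.comp (fun s : Fin k × ι => (s.1, ⟨y s.2, ht ⟨s.2, rfl⟩⟩)) fun s s' h => by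
    obtain ⟨h1, h2⟩ := Prod.mk.inj h
    exact Prod.ext h1 (hy.injective (congrArg Subtype.val h2))

end Independence

/-! ### Positivity on `B_-^k` -/

section LowerCharts

variable {n k : ℕ} {ι : Type} {y : ι → LowerField n}

theorem IsLowerChart.algebraicIndependent (hy : IsLowerChart y) :
    AlgebraicIndependent ℂ (productChart (k := k) y) :=
  algebraicIndependent_productChart hy.chart.chart.algebraicIndependent

theorem IsLowerChart.cornerMinor_isPositive (hy : IsLowerChart y) {α : Fin k → ℕ}
    (hα : ∑ i, α i ≤ n) : cornerMinor (lowerPowGeneric n (k := k)) α ≠ 0 ∧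
      IsPositive (productChart (k := k) y) (cornerMinor (lowerPowGeneric n (k := k)) α) := by
  refine cornerMinor_mem (S := positiveFunctions (productChart (k := k) y))
    (fun f hf g hg => add_ne_zero_of_isPositive hy.algebraicIndependent hf hg) _ ?_ ?_ hα
  · intro l m f e hf he
    rw [det_lowerPowGeneric_submatrix]
    exact (isPositive_det_lowerGeneric_submatrix hy.to_gz hf he).pullback l
  · intro l m f e hf he hle
    rw [det_lowerPowGeneric_submatrix]
    exact (map_ne_zero _).mpr (det_lowerGeneric_submatrix_ne_zero hf he hle)

theorem IsLowerChart.trop_iff (hy : IsLowerChart y) (hk : 0 < k) (x : Fin k × ι → ℝ) :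
    IsPositive (productChart (k := k) y) (potential (lowerPowGeneric n (k := k))) ∧
      (trop (productChart (k := k) y) (potential (lowerPowGeneric n (k := k))) x ≤ 0 ↔
        RhombusInequalities n k fun α =>
          trop (productChart (k := k) y) (cornerMinor (lowerPowGeneric n (k := k)) α) x) :=
  trop_potential_le_zero_iff hy.algebraicIndependent x hk _ fun _ _ _ hl hij =>
    hy.cornerMinor_isPositive (by rw [sum_facePoint hl]; exact hij)

end LowerCharts

end MultiCorner

end

theorem mainTheorem8 (n k : ℕ) (hn : 0 < n) (hk : 2 ≤ k) :
    -- the multi-corner minors are regular functions on `M_k`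
    (∀ α : Fin k → ℕ, ∑ i, α i ≤ n → cornerMinor (generic n k) α ∈ invariantRing n k) ∧
    -- the number of consecutive minors is the dimension of `M_k`
    ((consecutiveMinors n k).encard : WithBot ℕ∞) = topologicalKrullDim (quotientVariety n k) ∧
    -- they form a positive chart on `M_k` with its potential
    IsPositiveChart (invariantRing n k) (potential (generic n k))
      (fun α : consecutiveIndex n k => cornerMinor (generic n k) α) ∧
    -- in this chart, `Φ_k ^ t ≤ 0` is equivalent to the rhombus inequalities
    (∀ x : consecutiveIndex n k → ℝ,
      trop (fun α : consecutiveIndex n k => cornerMinor (generic n k) α)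
          (potential (generic n k)) x ≤ 0 ↔
        RhombusInequalities n k fun α =>
          trop (fun β : consecutiveIndex n k => cornerMinor (generic n k) β)
            (cornerMinor (generic n k) α) x) ∧
    -- on `B_-^k`, with the product chart of any chart of the positive structure of `B_-`,
    -- the multi-corner minors and the potential are positive, and the same equivalence holds
    ∀ (ι : Type) (y : ι → LowerField n), IsLowerChart y →
      (∀ α : Fin k → ℕ, ∑ i, α i ≤ n →
        cornerMinor (lowerPowGeneric n (k := k)) α ≠ 0 ∧
        IsPositive (productChart (k := k) y) (cornerMinor (lowerPowGeneric n (k := k)) α)) ∧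
      IsPositive (productChart (k := k) y) (potential (lowerPowGeneric n (k := k))) ∧
      ∀ x : Fin k × ι → ℝ,
        trop (productChart (k := k) y) (potential (lowerPowGeneric n (k := k))) x ≤ 0 ↔
          RhombusInequalities n k fun α =>
            trop (productChart (k := k) y) (cornerMinor (lowerPowGeneric n (k := k)) α) x := by
  refine ⟨fun α _ => cornerMinor_mem_invariantRing α, encard_consecutiveMinors hk,
    isPositiveChart_consecutive hk, fun x => (quotient_trop_iff hk x).2, fun ι y hy =>
      ⟨fun α hα => hy.cornerMinor_isPositive hα, (hy.trop_iff (by omega) 0).1,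
        fun x => (hy.trop_iff (by omega) x).2⟩⟩
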